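/- A triple system is a pair $\mathcal F=(V,E)$ with $V$ a finite set (isolated vertices are allowed) and $E$ a set of $3$-element subsets of $V$; write $|\mathcal F|=|E|$. Write $xyz$ for $\{x,y,z\}$. Let $\mathbf A$ be the triple system on $\{1,\dots,6\}$ with triples $124,135,236$, and let $\mathbf C$ be the triple system on $\{1,2,3,4\}$ with triples $124,134,234$. A triple system is $\mathbf A\mathbf C$-free if it contains no (not necessarily induced) copy of $\mathbf A$ or of $\mathbf C$, and $\mathrm{ex}(n,\mathbf A\mathbf C)$ is the maximum number of triples in an $\mathbf A\mathbf C$-free triple system on $n$ vertices. For $m\ge 1$, let $\mathcal F^*_m$ be the triple system on $m$ vertices (unique up to isomorphism) obtained by fixing a vertex $x$ and a complete bipartite graph with parts of sizes $\lfloor\frac{m-1}{2}\rfloor$ and $\lceil\frac{m-1}{2}\rceil$ on the other $m-1$ vertices, and taking all triples consisting of $x$ and an edge of that graph. A five-ring is a triple system isomorphic to the one on $\{1,\dots,5\}$ with triples $123,234,345,451,512$. Let $\mathcal F=(V,E)$ be a triple system. A $2$-extension of $\mathcal F$ is a triple system on $V\cup\{a,b\}$, where $a,b\notin V$ are distinct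 new vertices, with triples $E\cup\{abv:v\in V\}$. A $4$-extension of $\mathcal F$ is a triple system on $V\cup\{a,b,c,d\}$, where $a,b,c,d\notin V$ are distinct new vertices, with triples $E\cup\{abv:v\in V\}\cup\{cdv:v\in V\}\cup\{abc,bcd\}$. For even $n\ge 2$, let $\mathbf F_{(n)}$ be the class of $n$-vertex triple systems that can be obtained by an arbitrary (possibly empty) sequence of $2$- and $4$-extensions starting from a system of the form $\mathcal F^*_{n-2k}$ for some $0\le k\le\frac{n-2}{2}$. For odd $n\ge5$, let $\mathbf F_{(n)}$ be the class of $n$-vertex triple systems that can be obtained by an arbitrary (possibly empty) sequence of $2$- and $4$-extensions starting from a five-ring. **Theorem 9.1.** We have $$\mathrm{ex}(n,\mathbf A\mathbf C)=\begin{cases}\lfloor\frac14(n-1)^2\rfloor & \text{if } n \text{ is even or } n=1,3,\\[2pt] \frac14(n-1)^2+1 & \text{if } n\ge 5 \text{ is odd.}\end{cases}$$ Moreover, for every $n\ge4$, an $n$-vertex triple system $\mathcal F$ is $\mathbf A\mathbf C$-free with $|\mathcal F|=\mathrm{ex}(n,\mathbf A\mathbf C)$ if and only if $\mathcal F\in\mathbf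 F_{(n)}$. -/

import Mathlib

/-- A triple system (3-uniform hypergraph): a finite vertex set `verts`, possibly with isolated
vertices, and a set `edges` of 3-element subsets of it. -/
structure TripleSystem (α : Type*) where
  verts : Finset α
  edges : Finset (Finset α)
  edges_subset : edges ⊆ verts.powersetCard 3

namespace TripleSystem

/-- `F.Contains H`: some (not necessarily induced) copy of `H` is contained in `F`. -/
def Contains {α β : Type*} [DecidableEq α] (F : TripleSystem α) (H : TripleSystem β) : Prop :=
  ∃ φ : β → α, Set.InjOn φ H.verts ∧ Set.MapsTo φ H.verts F.verts ∧
    ∀ e ∈ H.edges, e.image φ ∈ F.edges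

/-- Isomorphism of triple systems. -/
def IsIso {α β : Type*} [DecidableEq α] (F : TripleSystem α) (H : TripleSystem β) : Prop :=
  ∃ φ : β → α, Set.BijOn φ H.verts F.verts ∧ F.edges = H.edges.image (fun e => e.image φ)

/-- The configuration `A`: triples 124, 135, 236 on six vertices. -/
def configA : TripleSystem ℕ where
  verts := {1, 2, 3, 4, 5, 6}
  edges := {{1, 2, 4}, {1, 3, 5}, {2, 3, 6}}
  edges_subset := by decide

/-- The configuration `C`: triples 124, 134, 234 on four vertices. -/
def configC : TripleSystem ℕ where
  verts := {1, 2, 3, 4}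
  edges := {{1, 2, 4}, {1, 3, 4}, {2, 3, 4}}
  edges_subset := by decide

/-- `F` contains none of the configurations in `X`. -/
def IsFree {α : Type*} [DecidableEq α] (X : Set (TripleSystem ℕ)) (F : TripleSystem α) : Prop :=
  ∀ H ∈ X, ¬ F.Contains H

/-- The maximum number of triples in a triple system on `n` vertices that contains none of the
configurations in `X`. (Sizes are at most `n.choose 3`, so the supremum is that of a bounded set.) -/
noncomputable def ex (n : ℕ) (X : Set (TripleSystem ℕ)) : ℕ :=
  sSup {m : ℕ | ∃ F : TripleSystem ℕ, F.verts.card = n ∧ F.IsFree X ∧ F.edges.card = m}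

/-- `F` is the system based on the Turán graph: for some vertex `x`, the triples are exactly those
consisting of `x` and an edge of a complete bipartite graph on the other vertices, whose parts
`P`, `Q` have the sizes `⌊(m - 1) / 2⌋` and `⌈(m - 1) / 2⌉ = ⌊m / 2⌋` where `m ≥ 1` is the number
of vertices. -/
def IsTuranStar {α : Type*} [DecidableEq α] (F : TripleSystem α) : Prop :=
  ∃ x ∈ F.verts, ∃ P Q : Finset α, Disjoint P Q ∧ P ∪ Q = F.verts.erase x ∧
    P.card = (F.verts.card - 1) / 2 ∧ Q.card = F.verts.card / 2 ∧
    F.edges = (P ×ˢ Q).image (fun p => {x, p.1, p.2})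

/-- The triples of cyclically consecutive elements of 1, 2, 3, 4, 5. -/
def ring5 : TripleSystem ℕ where
  verts := {1, 2, 3, 4, 5}
  edges := {{1, 2, 3}, {2, 3, 4}, {3, 4, 5}, {4, 5, 1}, {5, 1, 2}}
  edges_subset := by decide

def IsFiveRing {α : Type*} [DecidableEq α] (F : TripleSystem α) : Prop := F.IsIso ring5

/-- `G` is a 2-extension of `F`, with new vertices `a`, `b`. -/
def IsTwoExtension {α : Type*} [DecidableEq α] (F G : TripleSystem α) : Prop :=
  ∃ a b : α, a ≠ b ∧ Disjoint F.verts {a, b} ∧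
    G.verts = F.verts ∪ {a, b} ∧
    G.edges = F.edges ∪ F.verts.image (fun v => {a, b, v})

/-- `G` is a 4-extension of `F`, with new vertices `a`, `b`, `c`, `d`. -/
def IsFourExtension {α : Type*} [DecidableEq α] (F G : TripleSystem α) : Prop :=
  ∃ a b c d : α, [a, b, c, d].Nodup ∧ Disjoint F.verts {a, b, c, d} ∧
    G.verts = F.verts ∪ {a, b, c, d} ∧
    G.edges = F.edges ∪ F.verts.image (fun v => {a, b, v}) ∪ F.verts.image (fun v => {c, d, v})
      ∪ {{a, b, c}, {b, c, d}}

/-- `G` arises from `F` by an arbitrary (possibly empty) sequence of 2- and 4-extensions. -/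
def IsIteratedExtension {α : Type*} [DecidableEq α] (F G : TripleSystem α) : Prop :=
  Relation.ReflTransGen (fun H K => IsTwoExtension H K ∨ IsFourExtension H K) F G

/-- The class of `n`-vertex triple systems obtained by sequences of 2- and 4-extensions, for even
`n` from a Turán star on `n - 2 * k ≥ 2` vertices, and for odd `n` from a five-ring. -/
def InClassF {α : Type*} [DecidableEq α] (n : ℕ) (G : TripleSystem α) : Prop :=
  G.verts.card = n ∧
    ((Even n ∧ ∃ (k : ℕ) (F : TripleSystem α), 2 * k + 2 ≤ n ∧ F.verts.card = n - 2 * k ∧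
        F.IsTuranStar ∧ IsIteratedExtension F G) ∨
      (Odd n ∧ ∃ F : TripleSystem α, F.IsFiveRing ∧ IsIteratedExtension F G))

end TripleSystem

/-!
The triples of an `AC`-free system are regarded as a symmetric ternary relation `T` (`IsACFree`).
A pair of vertices is *thick* if at least two triples contain it, *slim* if exactly one does, and
*bare* if none does. The basic fact `IsACFree.apex_unique` says that if `x p` and `x q` are thick,
then no triple other than `x p q` contains `p q`. Hence the graph of the thick pairs is
triangle-free, and the ends of a path `p x q` of thick pairs form either a bare pair or the *base*
of a triple with *apex* `x`.

*Upper bound.* A triple contains exactly two pairs that are slim or its base, unless it is *loose*,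
that is, has no thick pair: then it contains three slim pairs. Double counting (`count_eq`) yields
`4 * |E| = n * (n - 1) - w - 2 * ℓ`, where `ℓ` is the number of the loose triples and `w` is the sum
over all vertices of the number of thick pairs plus the number of bare pairs minus the number of
bases. So one needs `w + 2 * ℓ ≥ n` for even `n` and `w + 2 * ℓ ≥ n - 5` for odd `n`. The sum `w` is
estimated separately on each component of the graph of the thick pairs, first without the bare
pairs that leave the component:
* a star with `t` leaves has weight at least its size `t + 1` if `t` is odd, and at least `t` if `t`
  is even, by Mantel's theorem for the graph of its bases (`star_weight`);
* a five-ring that is a whole component has weight `0` (`ring_weight`);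
* any other component has weight at least its size, with equality only for a path of four vertices
  (`other_weight`). Here the number of bases at each vertex is replaced by the largest such number
  at a neighbour in the graph of the bases (`smooth`), which only decreases the sum
  (`sum_deg_le_sum_sup`); after that, the estimate is local.

So a deficit can occur only in five-rings and stars with an even number of leaves. Where a deficit
matters, such a component is closed: no triple meets it in exactly two vertices. By `parity`, each
vertex of a closed component then has as many bare pairs leaving it, modulo 2, as there are vertices
outside. If `n` is even, this makes up for the deficit (`even_bound`). If `n` is odd, then two
vertices in different deficient components form a bare pair or lie in a loose triple, so that only
a single five-ring is affordable (`odd_bound`).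

*Structure.* In the case of equality the system is tight (`IsTight`): in particular there are no
loose triples and, apart from pairs of trivial components, no bare pairs between components. If `u`,
`v` lie in different components, not both trivial, then the unique triple with `u v` contains a
thick pair at one of them, and this one *dominates* the other (`Dominates`). Domination is
transitive and, apart from pairs of trivial components, a tournament on the components, so some
component dominates all others (`exists_top`). If there are others, it has to be a single thick pair
or a path of four vertices, and these are the new vertices of a 2- or 4-extension; otherwise the
whole system is a Turán star or a five-ring (`structure_of_tight`). Deleting the new vertices leaves
an extremal system, so that `IsExtremal.exists_basic` follows by induction. Conversely, extensions
preserve `AC`-freeness (`IsACFree.of_two`, `IsACFree.of_four`) and add as many triples as the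
extremal function requires (`IsIteratedExtension.extremal`).
-/

namespace TripleSystem

/-! ### Thick pairs, bases and five-rings -/

section

variable {V : Type*}

/-- A ternary relation `T` that describes the triples of an `AC`-free triple system on `V`: it is
symmetric, holds only for distinct vertices, and contains no copy of the two configurations. The
inequalities in `not_A` and those implied by the triples say that the six vertices are distinct. -/
structure IsACFree (T : V → V → V → Prop) : Prop where
  rot : ∀ {a b c}, T a b c → T b c a
  swap : ∀ {a b c}, T a b c → T b a c
  ne : ∀ {a b c}, T a b c → a ≠ b
  not_C : ∀ {a b c d}, T a b d → T a c d → T b c d → False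
  not_A : ∀ {a b c d e f}, T a b d → T a c e → T b c f → d ≠ e → d ≠ f → e ≠ f →
    d ≠ c → e ≠ b → f ≠ a → False

/-- The pair `a b` is contained in at least two triples. (By `IsACFree.ne`, then `a ≠ b`.) -/
def Thick (T : V → V → V → Prop) (a b : V) : Prop := ∃ c d, c ≠ d ∧ T a b c ∧ T a b d

/-- The pair `a b` is contained in no triple. -/
def Bare (T : V → V → V → Prop) (a b : V) : Prop := a ≠ b ∧ ∀ c, ¬ T a b c

/-- The pair `p q` is the base of a triple `x p q` whose other two sides are thick. -/
def Base (T : V → V → V → Prop) (p q : V) : Prop := ∃ x, T x p q ∧ Thick T x p ∧ Thick T x q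

/-- The vertices `a b c d e` form, in this cyclic order, a five-ring. -/
def Ring (T : V → V → V → Prop) (a b c d e : V) : Prop :=
  T a b c ∧ T b c d ∧ T c d e ∧ T d e a ∧ T e a b

variable {T : V → V → V → Prop}

namespace IsACFree

theorem rot' (h : IsACFree T) {a b c : V} (t : T a b c) : T c a b := h.rot (h.rot t)

theorem swap' (h : IsACFree T) {a b c : V} (t : T a b c) : T a c b :=
  h.rot' (h.swap (h.rot' (h.rot' t)))

theorem rev (h : IsACFree T) {a b c : V} (t : T a b c) : T c b a := h.swap (h.rot t)

theorem nes (h : IsACFree T) {a b c : V} (t : T a b c) : a ≠ b ∧ a ≠ c ∧ b ≠ c :=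
  ⟨h.ne t, (h.ne (h.rot' t)).symm, h.ne (h.rot t)⟩

theorem thick_symm (h : IsACFree T) {a b : V} (t : Thick T a b) : Thick T b a := by
  obtain ⟨c, d, hcd, h1, h2⟩ := t
  exact ⟨c, d, hcd, h.swap h1, h.swap h2⟩

theorem thick_ne (h : IsACFree T) {a b : V} (t : Thick T a b) : a ≠ b := by
  obtain ⟨c, d, hcd, h1, h2⟩ := t
  exact h.ne h1

theorem bare_symm (h : IsACFree T) {a b : V} (t : Bare T a b) : Bare T b a :=
  ⟨t.1.symm, fun c hc => t.2 c (h.swap hc)⟩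

theorem base_symm (h : IsACFree T) {a b : V} (t : Base T a b) : Base T b a := by
  obtain ⟨x, t, h1, h2⟩ := t
  exact ⟨x, h.swap' t, h2, h1⟩

end IsACFree

theorem Thick.exists_ne {a b : V} (t : Thick T a b) (c : V) : ∃ d, d ≠ c ∧ T a b d := by
  obtain ⟨x, y, hxy, h1, h2⟩ := t
  by_cases hx : x = c
  · exact ⟨y, by grind, h2⟩
  · exact ⟨x, hx, h1⟩

namespace IsACFree

/-- If two thick pairs share the vertex `x`, then at most the triple formed by them contains the
pair of their other ends. All other local arguments rest on this. -/
theorem apex_unique (h : IsACFree T) {x p q z : V} (h1 : Thick T x p) (h2 : Thick T x q)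
    (t : T p q z) : z = x := by
  by_contra hz
  by_cases hT : T x p q
  -- further triples at the thick pairs and the triple `p q z` form a copy of `A` or of `C`
  · obtain ⟨r, hr, tr⟩ := h1.exists_ne q
    obtain ⟨s, hs, ts⟩ := h2.exists_ne p
    refine h.not_A tr ts t ?_ ?_ ?_ hr hs hz
    · rintro rfl
      exact h.not_C (h.rot hT) (h.rot tr) (h.rot ts)
    · rintro rfl
      exact h.not_C (h.swap' hT) (h.swap' tr) (h.rot t)
    · rintro rfl
      exact h.not_C hT (h.swap' ts) (h.swap' t)
  -- otherwise all third vertices at `x p` and `x q` other than `z` coincide, so that `z` is one too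
  · have A : ∀ c d, T x p c → T x q d → c ≠ z → d ≠ z → c = d := fun c d t1 t2 n1 n2 => by
      by_contra n3
      refine h.not_A t1 t2 t n3 n1 n2 ?_ ?_ hz
      · rintro rfl
        exact hT t1
      · rintro rfl
        exact hT (h.swap' t2)
    obtain ⟨r, hr, tr⟩ := h1.exists_ne z
    obtain ⟨s, hs, ts⟩ := h2.exists_ne z
    obtain ⟨r', hr', tr'⟩ := h1.exists_ne r
    obtain ⟨s', hs', ts'⟩ := h2.exists_ne s
    have e1 : r' = z := by
      by_contra n
      exact hr' ((A _ _ tr' ts n hs).trans (A _ _ tr ts hr hs).symm)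
    have e2 : s' = z := by
      by_contra n
      exact hs' ((A _ _ tr ts' hr n).symm.trans (A _ _ tr ts hr hs))
    exact h.not_C (e1 ▸ tr') (e2 ▸ ts') t

theorem base_not_thick (h : IsACFree T) {p q : V} (b : Base T p q) : ¬ Thick T p q := by
  obtain ⟨x, t, h1, h2⟩ := b
  intro ht
  obtain ⟨z, hz, tz⟩ := ht.exists_ne x
  exact hz (h.apex_unique h1 h2 tz)

theorem base_ne (h : IsACFree T) {p q : V} (b : Base T p q) : p ≠ q := by
  obtain ⟨x, t, h1, h2⟩ := b
  exact (h.nes t).2.2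

theorem base_not_bare (h : IsACFree T) {p q : V} (b : Base T p q) : ¬ Bare T p q := by
  obtain ⟨x, t, h1, h2⟩ := b
  exact fun hb => hb.2 _ (h.rot t)

theorem thick_not_bare {p q : V} (b : Thick T p q) : ¬ Bare T p q := by
  obtain ⟨x, y, t, h1, h2⟩ := b
  exact fun hb => hb.2 _ h1

/-- The graph of the thick pairs is triangle-free. -/
theorem thick_triangle (h : IsACFree T) {x p q : V} (h1 : Thick T x p) (h2 : Thick T x q) :
    ¬ Thick T p q := by
  intro ht
  obtain ⟨z, hz, tz⟩ := ht.exists_ne x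
  exact hz (h.apex_unique h1 h2 tz)

/-- The two ends of a path of thick pairs form the base of a triple or a bare pair. -/
theorem base_or_bare (h : IsACFree T) {x p q : V} (h1 : Thick T x p) (h2 : Thick T x q)
    (hpq : p ≠ q) : (T x p q ∧ Base T p q) ∨ (¬ T x p q ∧ Bare T p q) := by
  by_cases t : T x p q
  · exact Or.inl ⟨t, x, t, h1, h2⟩
  · refine Or.inr ⟨t, hpq, fun z tz => ?_⟩
    obtain rfl := h.apex_unique h1 h2 tz
    exact t (h.rot' tz)

/-- If the bases `p q` and `q y` have the apices `x` and `z`, and `x p y` is a triple, then the five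
vertices form a five-ring. -/
theorem ring_of_path (h : IsACFree T) {p q x y z : V} (t : T x p q) (h2 : Thick T x q)
    (s : T z q y) (k1 : Thick T z q) (k2 : Thick T z y) (hxz : x ≠ z) (hpz : p ≠ z)
    (hxy : T x p y) : Ring T x p y z q := by
  have hqx : T q x z := by
    obtain ⟨r, hr, tr⟩ := (h.thick_symm h2).exists_ne p
    by_cases hrz : r = z
    · exact hrz ▸ tr
    · refine (h.not_A tr (h.rot s) (h.swap' hxy) hrz hr hpz.symm ?_ hxz.symm (h.nes t).2.2).elim
      rintro rfl
      exact hxz (h.apex_unique k1 k2 (h.swap' tr))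
  have hzy : T z y p := by
    obtain ⟨r, hr, tr⟩ := k2.exists_ne q
    by_cases hrp : r = p
    · exact hrp ▸ tr
    · refine (h.not_A tr (h.rev hqx) (h.rot' hxy)
        hr hrp (h.nes t).2.2.symm ?_ (h.nes s).2.2 hpz).elim
      rintro rfl
      exact h.not_C (h.rot tr) (h.rev s) (h.swap hqx)
  exact ⟨hxy, h.rev hzy, h.rot' s, h.rot' hqx, h.rot' t⟩

/-- The two ends of a path of two bases form a bare pair, outside five-rings. -/
theorem base_base (h : IsACFree T) {p q x y z : V} (t : T x p q) (h1 : Thick T x p)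
    (h2 : Thick T x q) (s : T z q y) (k1 : Thick T z q) (k2 : Thick T z y) (hpy : p ≠ y) :
    Bare T p y ∨ Ring T x p y z q := by
  by_contra hcon
  rw [not_or] at hcon
  obtain ⟨hb, hr⟩ := hcon
  simp only [Bare, not_and, not_forall, not_not] at hb
  obtain ⟨w, tw⟩ := hb hpy
  have hxz : x ≠ z := by
    rintro rfl
    obtain rfl := h.apex_unique h1 k2 tw
    exact h.not_C (h.rot t) (h.rot (h.rot' tw)) (h.rot s)
  have hpz : p ≠ z := by
    rintro rfl
    exact h.base_not_thick ⟨x, t, h1, h2⟩ k1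
  have hxy : x ≠ y := by
    rintro rfl
    exact h.base_not_thick ⟨z, s, k1, k2⟩ (h.thick_symm h2)
  have hwq : w ≠ q := by
    rintro rfl
    exact hpz (h.apex_unique k1 k2 (h.rev tw))
  by_cases hwx : w = x
  · subst hwx
    exact hr (h.ring_of_path t h2 s k1 k2 hxz hpz (h.rot' tw))
  by_cases hwz : w = z
  · subst hwz
    obtain ⟨r1, r2, r3, r4, r5⟩ := h.ring_of_path (h.swap' s) k1 (h.swap' t) h2 h1 hxz.symm
      hxy.symm (h.rev tw)
    exact hr ⟨h.rev r2, h.rev r1, h.rev r5, h.rev r4, h.rev r3⟩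
  · exact h.not_A (h.rot t) tw (h.rot s) (Ne.symm hwx) hxz hwz hxy hwq hpz.symm

/-- Outside five-rings, an end of a base is not in a triple with a thick neighbour, other than the
apex, of the other end. -/
theorem base_thick (h : IsACFree T) {p q x a : V} (t : T x p q) (h1 : Thick T x p)
    (h2 : Thick T x q) (k : Thick T a q) (hax : a ≠ x) :
    Bare T a p ∨ ∃ w, Ring T a q x p w := by
  by_contra hcon
  rw [not_or] at hcon
  obtain ⟨hb, hr⟩ := hcon
  have hap : a ≠ p := by
    rintro rfl
    exact h.base_not_thick ⟨x, t, h1, h2⟩ k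
  simp only [Bare, not_and, not_forall, not_not] at hb
  obtain ⟨w, tw⟩ := hb hap
  have hwx : w ≠ x := by
    rintro rfl
    have := h.apex_unique (h.thick_symm k) (h.thick_symm h2) (h.swap' tw)
    exact (h.nes t).2.2 this
  have hpq : ∀ z, T p q z → z = x := fun z => h.apex_unique h1 h2
  have key : ∀ r, T a q r → r ≠ w → r = x := by
    intro r tr hrw
    by_contra hrx
    refine h.not_A tr tw (h.rot (h.swap' t)) hrw hrx hwx ?_ ?_ hax.symm
    · rintro rfl
      exact hax (hpq _ (h.rot' (h.rot' (h.rev (h.rot tr)))))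
    · rintro rfl
      exact hax (hpq _ (h.rot tw))
  have haqx : T a q x := by
    obtain ⟨r, hr, tr⟩ := k.exists_ne w
    exact key r tr hr ▸ tr
  have haqw : T a q w := by
    obtain ⟨r, hr, tr⟩ := k.exists_ne x
    by_cases hrw : r = w
    · exact hrw ▸ tr
    · exact absurd (key r tr hrw) hr
  have hxpw : T x p w := by
    obtain ⟨r, hr, tr⟩ := h1.exists_ne q
    by_cases hrw : r = w
    · exact hrw ▸ tr
    · refine (h.not_A (h.swap' haqx) tw tr (h.nes haqw).2.2 hr.symm (Ne.symm hrw)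
        (h.nes t).2.2.symm hwx ?_).elim
      rintro rfl
      exact h.not_C (h.swap' (h.rot' tr)) haqx (h.rot t)
  exact hr ⟨w, haqx, h.rot' t, hxpw, h.rot tw, h.rot' haqw⟩

end IsACFree

namespace Ring

variable {a b c d e : V}

theorem rotate (r : Ring T a b c d e) : Ring T b c d e a :=
  ⟨r.2.1, r.2.2.1, r.2.2.2.1, r.2.2.2.2, r.1⟩

theorem reverse (h : IsACFree T) (r : Ring T a b c d e) : Ring T e d c b a :=
  ⟨h.rev r.2.2.1, h.rev r.2.1, h.rev r.1, h.rev r.2.2.2.2, h.rev r.2.2.2.1⟩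

theorem exists_start (r : Ring T a b c d e) {v : V} (hv : v ∈ ({a, b, c, d, e} : Set V)) :
    ∃ b' c' d' e', Ring T v b' c' d' e' ∧ ({v, b', c', d', e'} : Set V) = {a, b, c, d, e} := by
  simp only [Set.mem_insert_iff, Set.mem_singleton_iff] at hv
  rcases hv with rfl | rfl | rfl | rfl | rfl
  · exact ⟨_, _, _, _, r, rfl⟩
  · exact ⟨_, _, _, _, r.rotate, by grind⟩
  · exact ⟨_, _, _, _, r.rotate.rotate, by grind⟩
  · exact ⟨_, _, _, _, r.rotate.rotate.rotate, by grind⟩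
  · exact ⟨_, _, _, _, r.rotate.rotate.rotate.rotate, by grind⟩

theorem thick (h : IsACFree T) (r : Ring T a b c d e) : Thick T a b :=
  ⟨c, e, (h.nes r.2.2.1).2.1, r.1, h.rot r.2.2.2.2⟩

theorem thick' (h : IsACFree T) (r : Ring T a b c d e) : Thick T a e :=
  h.thick_symm (r.rotate.rotate.rotate.rotate.thick h)

theorem distinct (h : IsACFree T) (r : Ring T a b c d e) :
    a ≠ b ∧ a ≠ c ∧ a ≠ d ∧ a ≠ e ∧ b ≠ c ∧ b ≠ d ∧ b ≠ e ∧ c ≠ d ∧ c ≠ e ∧ d ≠ e := by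
  obtain ⟨r1, r2, r3, r4, r5⟩ := r
  have := h.nes r1
  have := h.nes r2
  have := h.nes r3
  have := h.nes r4
  have := h.nes r5
  grind

theorem third_long (h : IsACFree T) (r : Ring T a b c d e) {z : V} (t : T a c z) : z = b :=
  h.apex_unique (h.thick_symm (r.thick h)) (r.rotate.thick h) t

theorem third_short (h : IsACFree T) (r : Ring T a b c d e) {z : V} (t : T a b z) :
    z = c ∨ z = e := by
  by_contra hz
  rw [not_or] at hz
  have hd := r.distinct h
  refine h.not_A t (h.rev r.2.2.2.1 |> h.swap') (h.swap' r.2.1) hz.2 hz.1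
    hd.2.2.2.2.2.2.2.2.1.symm ?_ hd.2.2.2.2.2.2.1.symm hd.2.1.symm
  rintro rfl
  exact hd.2.1 (r.rotate.third_long h (h.rot t))

/-- No triple meets a five-ring in exactly two vertices. By rotation and reflection, only the pairs
`a b` and `a c` have to be considered. -/
theorem closed (h : IsACFree T) (r : Ring T a b c d e) {u v w : V}
    (hu : u ∈ ({a, b, c, d, e} : Set V)) (hw : w ∈ ({a, b, c, d, e} : Set V)) (t : T u w v) :
    v ∈ ({a, b, c, d, e} : Set V) := by
  obtain ⟨b', c', d', e', r', hs⟩ := r.exists_start hu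
  rw [← hs] at hw ⊢
  have huw := h.ne t
  have r'' := (r'.reverse h).rotate.rotate.rotate.rotate
  simp only [Set.mem_insert_iff, Set.mem_singleton_iff] at hw ⊢
  rcases hw with rfl | rfl | rfl | rfl | rfl
  · exact absurd rfl huw
  · have := r'.third_short h t
    tauto
  · have := r'.third_long h t
    tauto
  · have := r''.third_long h t
    tauto
  · have := r''.third_short h t
    tauto

/-- The case of two vertices of the ring on one side of the vertex `a` of the thick pair. -/
theorem bare_aux (h : IsACFree T) (r : Ring T a b c d e) {w : V} (k : Thick T a w)
    (hw : w ∉ ({a, b, c, d, e} : Set V)) : Bare T w b ∧ Bare T w c := by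
  have hab : ¬ T a b w := fun t => hw (r.closed h (by simp) (by simp) t)
  constructor
  · rcases h.base_or_bare k (r.thick h) (by rintro rfl; simp at hw) with hh | hh
    · exact absurd (h.swap' hh.1) hab
    · exact hh.2
  · rcases h.base_thick (h.swap' (h.swap r.1)) (r.rotate.thick h) (h.thick_symm (r.thick h))
      (h.thick_symm k) (by rintro rfl; simp at hw) with hh | ⟨w', hh⟩
    · exact hh
    · exact absurd (h.rot hh.1) hab

/-- A vertex outside a five-ring that forms a thick pair with a vertex of the ring forms bare pairs
with the others. -/
theorem bare_of_thick (h : IsACFree T) (r : Ring T a b c d e) {u w v : V}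
    (hu : u ∈ ({a, b, c, d, e} : Set V)) (k : Thick T u w)
    (hw : w ∉ ({a, b, c, d, e} : Set V)) (hv : v ∈ ({a, b, c, d, e} : Set V)) (hvu : v ≠ u) :
    Bare T w v := by
  obtain ⟨b', c', d', e', r', hs⟩ := r.exists_start hu
  rw [← hs] at hw hv
  have r'' := (r'.reverse h).rotate.rotate.rotate.rotate
  have h1 := r'.bare_aux h k hw
  have h2 := r''.bare_aux h k (by simp at hw ⊢; tauto)
  simp only [Set.mem_insert_iff, Set.mem_singleton_iff] at hv
  rcases hv with rfl | rfl | rfl | rfl | rfl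
  · exact absurd rfl hvu
  · exact h1.1
  · exact h1.2
  · exact h2.2
  · exact h2.1

end Ring

end

/-! ### Components of the graph of thick pairs, and bare pairs at bases -/

section

variable {V : Type*} {T : V → V → V → Prop}

/-- The vertices `u` and `v` are joined by a path of thick pairs. -/
def Conn (T : V → V → V → Prop) : V → V → Prop := Relation.ReflTransGen (Thick T)

namespace Conn

theorem refl (u : V) : Conn T u u := Relation.ReflTransGen.refl

theorem of_thick {u v : V} (t : Thick T u v) : Conn T u v := Relation.ReflTransGen.single t

theorem trans {u v w : V} (h1 : Conn T u v) (h2 : Conn T v w) : Conn T u w :=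
  Relation.ReflTransGen.trans h1 h2

theorem symm (h : IsACFree T) {u v : V} (h1 : Conn T u v) : Conn T v u := by
  induction h1 with
  | refl => exact refl _
  | tail _ h2 ih => exact (of_thick (h.thick_symm h2)).trans ih

theorem of_base (h : IsACFree T) {u v : V} (t : Base T u v) : Conn T u v := by
  obtain ⟨x, t, h1, h2⟩ := t
  exact (of_thick (h.thick_symm h1)).trans (of_thick h2)

/-- A property that is inherited along thick pairs holds on whole components. -/
theorem induct {u v : V} (h1 : Conn T u v) (P : V → Prop) (hP : ∀ x y, P x → Thick T x y → P y)
    (hu : P u) : P v := by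
  induction h1 with
  | refl => exact hu
  | tail _ h2 ih => exact hP _ _ ih h2

end Conn

/-- The pair `u v` is bare and lies inside a component of the graph of thick pairs. -/
def BareIn (T : V → V → V → Prop) (u v : V) : Prop := Bare T u v ∧ Conn T u v

/-- The pair `u v` is bare and joins two components of the graph of thick pairs. -/
def BareOut (T : V → V → V → Prop) (u v : V) : Prop := Bare T u v ∧ ¬ Conn T u v

variable [Fintype V]

open scoped Classical in
/-- The finite set of the vertices in relation `R` to `v`. -/
noncomputable def nbrs (R : V → V → Prop) (v : V) : Finset V := Finset.univ.filter (R v)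

/-- The number of vertices in relation `R` to `v`. -/
noncomputable def deg (R : V → V → Prop) (v : V) : ℕ := (nbrs R v).card

@[simp] theorem mem_nbrs {R : V → V → Prop} {v w : V} : w ∈ nbrs R v ↔ R v w := by simp [nbrs]

theorem deg_pos {R : V → V → Prop} {v w : V} (hw : R v w) : 0 < deg R v :=
  Finset.card_pos.2 ⟨w, mem_nbrs.2 hw⟩

theorem exists_of_deg_pos {R : V → V → Prop} {v : V} (hv : 0 < deg R v) : ∃ w, R v w := by
  obtain ⟨w, hw⟩ := Finset.card_pos.1 hv
  exact ⟨w, mem_nbrs.1 hw⟩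

theorem deg_eq_one {R : V → V → Prop} {v w u : V} (hv : deg R v ≤ 1) (hw : R v w) (hu : R v u) :
    u = w := Finset.card_le_one.1 hv _ (mem_nbrs.2 hu) _ (mem_nbrs.2 hw)

open scoped Classical in
theorem card_le_deg {R : V → V → Prop} {v : V} (Y : Finset V) (hY : ∀ y ∈ Y, R v y) :
    Y.card ≤ deg R v := Finset.card_le_card fun y hy => mem_nbrs.2 (hY y hy)

namespace IsACFree

open scoped Classical in
/-- The neighbours of `q` other than `p` and `x`, for the graphs of the bases and of the thick
pairs. If `x` is the apex of the base `p q`, then they form bare pairs with `p`. -/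
noncomputable def around (T : V → V → V → Prop) (p q x : V) : Finset V :=
  (nbrs (Base T) q).erase p ∪ (nbrs (Thick T) q).erase x

open scoped Classical in
theorem mem_around {p q x y : V} :
    y ∈ around T p q x ↔ (y ≠ p ∧ Base T q y) ∨ (y ≠ x ∧ Thick T q y) := by
  simp [around]

open scoped Classical in
theorem card_around (h : IsACFree T) {p q x : V} (t : T x p q) (h1 : Thick T x p)
    (h2 : Thick T x q) : (around T p q x).card + 2 = deg (Base T) q + deg (Thick T) q := by
  have b : Base T q p := h.base_symm ⟨x, t, h1, h2⟩
  have e1 := Finset.card_erase_add_one (mem_nbrs.2 b)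
  have e2 := Finset.card_erase_add_one (mem_nbrs.2 (h.thick_symm h2))
  rw [around, Finset.card_union_of_disjoint]
  · unfold deg
    omega
  · rw [Finset.disjoint_left]
    intro y hy hy'
    simp only [Finset.mem_erase, mem_nbrs] at hy hy'
    exact h.base_not_thick hy.2 hy'.2

/-- A vertex next to `q` forms a bare pair with `p`, unless both are in a common five-ring with `q`
and the apex. -/
theorem bareIn_of_mem_around (h : IsACFree T) {p q x : V} (t : T x p q) (h1 : Thick T x p)
    (h2 : Thick T x q) {y : V} (hy : y ∈ around T p q x) :
    BareIn T p y ∨ ∃ a w, Ring T a q x p w ∧ (y = a ∨ y = w) := by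
  have hpq : Conn T p q := Conn.of_base h ⟨x, t, h1, h2⟩
  rcases mem_around.1 hy with ⟨hyp, z, s, k1, k2⟩ | ⟨hyx, k⟩
  · rcases h.base_base t h1 h2 s k1 k2 hyp.symm with hb | hr
    · exact Or.inl ⟨hb, hpq.trans (Conn.of_base h ⟨z, s, k1, k2⟩)⟩
    · exact Or.inr ⟨z, y, hr.rotate.rotate.rotate, Or.inr rfl⟩
  · rcases h.base_thick t h1 h2 (h.thick_symm k) hyx with hb | ⟨w, hr⟩
    · exact Or.inl ⟨h.bare_symm hb, hpq.trans (Conn.of_thick k)⟩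
    · exact Or.inr ⟨y, w, hr, Or.inl rfl⟩

open scoped Classical in
/-- Lower bound for the number of bare pairs at an end `p` of a base `p q`, outside five-rings. The
set `Y` is a reserve of further vertices that form bare pairs with `p`. -/
theorem le_bareIn (h : IsACFree T) {p q x : V} (t : T x p q) (h1 : Thick T x p)
    (h2 : Thick T x q) (hr : ∀ a w, ¬ Ring T a q x p w) (Y : Finset V)
    (hY : ∀ y ∈ Y, BareIn T p y ∧ y ∉ around T p q x) :
    deg (Base T) q + deg (Thick T) q + Y.card ≤ deg (BareIn T) p + 2 := by
  have := h.card_around t h1 h2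
  have := card_le_deg (R := BareIn T) (v := p) (around T p q x ∪ Y) (by
    intro y hy
    rcases Finset.mem_union.1 hy with hy | hy
    · rcases h.bareIn_of_mem_around t h1 h2 hy with hh | ⟨a, w, hh, -⟩
      · exact hh
      · exact absurd hh (hr a w)
    · exact (hY y hy).1)
  rw [Finset.card_union_of_disjoint (Finset.disjoint_right.2 fun y hy => (hY y hy).2)] at this
  omega

open scoped Classical in
/-- Lower bound for the number of bare pairs at an end `p` of a base `p q` in a five-ring: two of
the vertices next to `q` lie in the ring, and may fail to form bare pairs with `p`. -/
theorem le_bareIn_ring (h : IsACFree T) {p q x a w : V} (hr : Ring T a q x p w) (Y : Finset V)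
    (hY : ∀ y ∈ Y, BareIn T p y ∧ y ∉ around T p q x) :
    deg (Base T) q + deg (Thick T) q + Y.card ≤ deg (BareIn T) p + 4 := by
  have t : T x p q := h.rot hr.2.1
  have h1 : Thick T x p := hr.rotate.rotate.thick h
  have h2 : Thick T x q := h.thick_symm (hr.rotate.thick h)
  have := h.card_around t h1 h2
  have hs : ∀ y ∈ around T p q x \ {a, w}, BareIn T p y := by
    intro y hy
    simp only [Finset.mem_sdiff, Finset.mem_insert, Finset.mem_singleton, not_or] at hy
    rcases h.bareIn_of_mem_around t h1 h2 hy.1 with hh | ⟨a', w', hh, hc⟩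
    · exact hh
    · have d1 := hr.distinct h
      have d2 := hh.distinct h
      have e1 := hr.rotate.third_short h (h.rot hh.1)
      have e2 := hr.rotate.rotate.third_short h hh.2.2.1
      grind
  have := card_le_deg (R := BareIn T) (v := p) (around T p q x \ {a, w} ∪ Y) (by
    intro y hy
    rcases Finset.mem_union.1 hy with hy | hy
    · exact hs y hy
    · exact (hY y hy).1)
  rw [Finset.card_union_of_disjoint (Finset.disjoint_right.2 fun y hy hy' =>
    (hY y hy).2 (Finset.mem_sdiff.1 hy').1)] at this
  have := Finset.card_le_card_sdiff_add_card (s := around T p q x) (t := {a, w})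
  have : ({a, w} : Finset V).card ≤ 2 := Finset.card_le_two
  omega

end IsACFree

/-- For a symmetric relation, replacing each degree by the largest degree of a neighbour does not
decrease the sum of the degrees. -/
theorem sum_deg_le_sum_sup {R : V → V → Prop} (hR : ∀ u v, R u v → R v u) (S : Finset V)
    (hS : ∀ u v, R u v → u ∈ S → v ∈ S) :
    ∑ v ∈ S, deg R v ≤ ∑ v ∈ S, (nbrs R v).sup (deg R) := by
  classical
  have hpos : ∀ {u v}, R u v → (0 : ℚ) < deg R u := fun hh => by exact_mod_cast deg_pos hh
  -- Averaging over the neighbours bounds the sum of the largest degrees below by the sum of the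
  -- quotients of the degrees along all pairs, in which a quotient and its inverse add up to at
  -- least two.
  have e1 : ∑ v ∈ S, ∑ w ∈ nbrs R v, ((deg R w : ℚ) / deg R v) ≤
      ∑ v ∈ S, ((nbrs R v).sup (deg R) : ℕ) := by
    push_cast
    refine Finset.sum_le_sum fun v hv => ?_
    rcases Finset.eq_empty_or_nonempty (nbrs R v) with he | ⟨w, hw⟩
    · simp [he]
    · have h0 : (0 : ℚ) < deg R v := hpos (mem_nbrs.1 hw)
      calc ∑ w ∈ nbrs R v, ((deg R w : ℚ) / deg R v)
          ≤ ∑ w ∈ nbrs R v, (((nbrs R v).sup (deg R) : ℕ) : ℚ) / deg R v := by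
            refine Finset.sum_le_sum fun w hw => ?_
            gcongr
            exact Finset.le_sup (f := deg R) hw
        _ = _ := by
            rw [Finset.sum_const, nsmul_eq_mul]
            change (deg R v : ℚ) * _ = _
            field_simp
  have e2 : ∑ v ∈ S, ∑ w ∈ nbrs R v, ((deg R w : ℚ) / deg R v) =
      ∑ v ∈ S, ∑ w ∈ nbrs R v, ((deg R v : ℚ) / deg R w) := by
    rw [Finset.sum_comm' (s' := nbrs R) (t' := S)]
    intro v w
    simp only [mem_nbrs]
    exact ⟨fun ⟨h1, h2⟩ => ⟨hR _ _ h2, hS _ _ h2 h1⟩, fun ⟨h1, h2⟩ => ⟨hS _ _ h1 h2, hR _ _ h1⟩⟩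
  have e3 : (∑ v ∈ S, (deg R v : ℚ)) * 2 ≤ ∑ v ∈ S, ∑ w ∈ nbrs R v, ((deg R w : ℚ) / deg R v) +
      ∑ v ∈ S, ∑ w ∈ nbrs R v, ((deg R v : ℚ) / deg R w) := by
    rw [← Finset.sum_add_distrib, Finset.sum_mul]
    refine Finset.sum_le_sum fun v hv => ?_
    rw [← Finset.sum_add_distrib]
    calc (deg R v : ℚ) * 2 = ∑ w ∈ nbrs R v, (2 : ℚ) := by
          rw [Finset.sum_const, nsmul_eq_mul]; rfl
      _ ≤ _ := by
          refine Finset.sum_le_sum fun w hw => ?_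
          have h1 := hpos (mem_nbrs.1 hw)
          have h2 := hpos (hR _ _ (mem_nbrs.1 hw))
          rw [div_add_div _ _ h1.ne' h2.ne', le_div_iff₀ (by positivity)]
          nlinarith [sq_nonneg ((deg R w : ℚ) - deg R v)]
  have : (∑ v ∈ S, deg R v : ℚ) ≤ (∑ v ∈ S, ((nbrs R v).sup (deg R) : ℕ) : ℚ) := by
    push_cast at e1 ⊢
    linarith
  exact_mod_cast this

end

/-! ### Smoothed weights of vertices -/

section

variable {V : Type*} {T : V → V → V → Prop}

theorem Ring.conn (h : IsACFree T) {a b c d e : V} (r : Ring T a b c d e) {u v : V}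
    (hu : u ∈ ({a, b, c, d, e} : Set V)) (hv : v ∈ ({a, b, c, d, e} : Set V)) : Conn T u v := by
  obtain ⟨b', c', d', e', r', hs⟩ := r.exists_start hu
  rw [← hs] at hv
  have k1 := Conn.of_thick (r'.thick h)
  have k2 := Conn.of_thick (r'.rotate.thick h)
  have k3 := Conn.of_thick (r'.rotate.rotate.thick h)
  have k4 := Conn.of_thick (r'.rotate.rotate.rotate.thick h)
  simp only [Set.mem_insert_iff, Set.mem_singleton_iff] at hv
  rcases hv with rfl | rfl | rfl | rfl | rfl
  · exact Conn.refl _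
  · exact k1
  · exact k1.trans k2
  · exact (k1.trans k2).trans k3
  · exact ((k1.trans k2).trans k3).trans k4

/-- The vertex `a` lies in a five-ring that is a whole component of the graph of thick pairs. The
first vertex of the ring may be taken to be `a`. -/
def InIsolatedRing (T : V → V → V → Prop) (a : V) : Prop :=
  ∃ b c d e, Ring T a b c d e ∧
    ∀ u ∈ ({a, b, c, d, e} : Set V), ∀ v, Thick T u v → v ∈ ({a, b, c, d, e} : Set V)

variable [Fintype V]

/-- The largest number of bases at a vertex that forms a base with `v`, or `0` if there is none. -/
noncomputable def maxBase (T : V → V → V → Prop) (v : V) : ℕ :=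
  (nbrs (Base T) v).sup (deg (Base T))

/-- The weight of a vertex within its component, with the number of bases at the vertex replaced by
the largest one at its neighbours. -/
noncomputable def smooth (T : V → V → V → Prop) (v : V) : ℤ :=
  deg (Thick T) v + deg (BareIn T) v - maxBase T v

theorem exists_maxBase {p : V} (hp : 0 < deg (Base T) p) :
    ∃ q, Base T p q ∧ maxBase T p = deg (Base T) q := by
  obtain ⟨q, hq, he⟩ := Finset.exists_mem_eq_sup _ (Finset.card_pos.1 hp) (deg (Base T))
  exact ⟨q, mem_nbrs.1 hq, he⟩

theorem maxBase_eq_zero {p : V} (hp : deg (Base T) p = 0) : maxBase T p = 0 := by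
  have : nbrs (Base T) p = ∅ := Finset.card_eq_zero.1 hp
  simp [maxBase, this]

namespace IsACFree

/-- The smoothed weight at the end `p` of a base `p q`, outside five-rings. Since `q` attains
`maxBase T p`, the bases at `q` cancel against the bare pairs that they force at `p`. -/
theorem le_smooth (h : IsACFree T) {p q x : V} (t : T x p q) (h1 : Thick T x p)
    (h2 : Thick T x q) (hr : ¬ ∃ a w, Ring T a q x p w) (hm : maxBase T p = deg (Base T) q)
    (Y : Finset V) (hY : ∀ y ∈ Y, BareIn T p y ∧ y ∉ around T p q x) :
    (deg (Thick T) p + deg (Thick T) q + Y.card : ℤ) ≤ smooth T p + 2 := by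
  have := h.le_bareIn t h1 h2 (fun a w hh => hr ⟨a, w, hh⟩) Y hY
  unfold smooth
  omega

/-- The smoothed weight at the end `p` of a base `p q` in a five-ring. -/
theorem le_smooth_ring (h : IsACFree T) {p q x a w : V} (hr : Ring T a q x p w)
    (hm : maxBase T p = deg (Base T) q)
    (Y : Finset V) (hY : ∀ y ∈ Y, BareIn T p y ∧ y ∉ around T p q x) :
    (deg (Thick T) p + deg (Thick T) q + Y.card : ℤ) ≤ smooth T p + 4 := by
  have := h.le_bareIn_ring hr Y hY
  unfold smooth
  omega

open scoped Classical in
theorem two_le_deg {R : V → V → Prop} {v x y : V} (hx : R v x) (hy : R v y) (hxy : x ≠ y) :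
    2 ≤ deg R v := by
  rw [← Finset.card_pair hxy]
  exact card_le_deg _ (by simp [hx, hy])

open scoped Classical in
theorem three_le_deg {R : V → V → Prop} {v x y z : V} (hx : R v x) (hy : R v y) (hz : R v z)
    (hxy : x ≠ y) (hxz : x ≠ z) (hyz : y ≠ z) : 3 ≤ deg R v := by
  rw [← Finset.card_eq_three.2 ⟨x, y, z, hxy, hxz, hyz, rfl⟩]
  exact card_le_deg _ (by simp [hx, hy, hz])

open scoped Classical in
/-- A vertex without bases that is not the centre of a star has weight enough for its pendant
neighbours. -/
theorem card_pendant_le (h : IsACFree T) {p y z : V} (hp : deg (Base T) p = 0)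
    (k1 : Thick T p y) (k2 : Thick T y z) (hz : z ≠ p) :
    (((nbrs (Thick T) p).filter fun q => deg (Thick T) q ≤ 1).card : ℤ) + 2 ≤ smooth T p := by
  have e : deg (BareIn T) p ≥ 1 := by
    refine deg_pos (w := z) ⟨?_, (Conn.of_thick k1).trans (Conn.of_thick k2)⟩
    rcases h.base_or_bare (h.thick_symm k1) k2 hz.symm with hh | hh
    · exact absurd (deg_pos hh.2) (by omega)
    · exact hh.2
  have : ((nbrs (Thick T) p).filter fun q => deg (Thick T) q ≤ 1).card < deg (Thick T) p := by
    refine Finset.card_lt_card (Finset.filter_ssubset.2 ⟨y, mem_nbrs.2 k1, ?_⟩)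
    have := two_le_deg k2 (h.thick_symm k1) hz
    omega
  have := maxBase_eq_zero hp
  unfold smooth
  omega

theorem ring_two_le (h : IsACFree T) {p q x a w : V} (hr : Ring T a q x p w) :
    2 ≤ deg (Thick T) p ∧ 2 ≤ deg (Thick T) q := by
  have hd := hr.distinct h
  exact ⟨two_le_deg (h.thick_symm (hr.rotate.rotate.thick h)) (hr.rotate.rotate.rotate.thick h)
    hd.2.2.2.2.2.2.2.2.1, two_le_deg (h.thick_symm (hr.thick h)) (hr.rotate.thick h) hd.2.1⟩

/-- Outside isolated five-rings, the smoothed weight is nonnegative at the ends of bases, and it is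
zero only at pendant vertices of the graph of thick pairs that are next to a vertex without bases.
-/
theorem smooth_nonneg (h : IsACFree T) {p : V} (hp : 0 < deg (Base T) p)
    (hiso : ¬ InIsolatedRing T p) :
    0 ≤ smooth T p ∧
      (smooth T p ≤ 0 → deg (Thick T) p ≤ 1 ∧ ∃ x, Thick T p x ∧ deg (Base T) x = 0) := by
  obtain ⟨q, hb, hm⟩ := exists_maxBase hp
  obtain ⟨x, t, h1, h2⟩ := id hb
  have tp : 0 < deg (Thick T) p := deg_pos (h.thick_symm h1)
  have tq : 0 < deg (Thick T) q := deg_pos (h.thick_symm h2)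
  by_cases hr : ∃ a w, Ring T a q x p w
  · obtain ⟨a, w, hr⟩ := hr
    have h2' := h.ring_two_le hr
    have hle := h.le_smooth_ring hr hm ∅ (by simp)
    simp only [Finset.card_empty] at hle
    refine ⟨by omega, fun h0 => (hiso ?_).elim⟩
    -- a thick pair that leaves the ring would yield a further thick or bare pair at `p` or `q`
    have r' := hr.rotate.rotate.rotate
    refine ⟨w, a, q, x, r', fun u hu v k => ?_⟩
    by_contra hv
    have hxw : x ≠ w := (hr.distinct h).2.2.2.2.2.2.2.2.1
    have hax : a ≠ x := (hr.distinct h).2.1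
    have hup : u ≠ p := by
      rintro rfl
      have := three_le_deg (h.thick_symm h1) (r'.thick h) k hxw (by rintro rfl; simp at hv)
        (by rintro rfl; simp at hv)
      omega
    have huq : u ≠ q := by
      rintro rfl
      have := three_le_deg (h.thick_symm (hr.thick h)) (hr.rotate.thick h) k hax
        (by rintro rfl; simp at hv) (by rintro rfl; simp at hv)
      omega
    have bp : Bare T v p := r'.bare_of_thick h hu k hv (by simp) hup.symm
    have bq : Bare T v q := r'.bare_of_thick h hu k hv (by simp) huq.symm
    have := h.le_smooth_ring hr hm {v} (by
      intro y hy
      obtain rfl := Finset.mem_singleton.1 hy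
      refine ⟨⟨h.bare_symm bp, (r'.conn h (by simp) hu).trans (Conn.of_thick k)⟩, ?_⟩
      rw [mem_around]
      rintro (⟨-, hh⟩ | ⟨-, hh⟩)
      · exact h.base_not_bare hh (h.bare_symm bq)
      · exact thick_not_bare hh (h.bare_symm bq))
    simp only [Finset.card_singleton] at this
    omega
  · have hle := h.le_smooth t h1 h2 hr hm ∅ (by simp)
    simp only [Finset.card_empty] at hle
    refine ⟨by omega, fun h0 => ⟨by omega, x, h.thick_symm h1, ?_⟩⟩
    -- a base `x z` would yield the further bare pair `p z`
    by_contra hx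
    obtain ⟨z, hz⟩ := exists_of_deg_pos (Nat.pos_of_ne_zero hx)
    obtain ⟨y, s, k1, k2⟩ := id hz
    have t1 : ∀ v, Thick T p v → v = x := fun v hv =>
      deg_eq_one (by omega) (h.thick_symm h1) hv
    have t2 : ∀ v, Thick T q v → v = x := fun v hv =>
      deg_eq_one (by omega) (h.thick_symm h2) hv
    have hpy : p ≠ y := by
      rintro rfl
      exact h.base_ne hz (t1 _ k2).symm
    have bpz : Bare T p z := by
      rcases h.base_thick (h.swap' s) k2 k1 (h.thick_symm h1) hpy with hh | ⟨w, hh⟩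
      · exact hh
      · have := t1 w (hh.thick' h)
        have := hh.distinct h
        grind
    have := h.le_smooth t h1 h2 hr hm {z} (by
      intro y hy
      obtain rfl := Finset.mem_singleton.1 hy
      refine ⟨⟨bpz, (Conn.of_thick (h.thick_symm h1)).trans (Conn.of_base h hz)⟩, ?_⟩
      rw [mem_around]
      rintro (⟨-, c, -, l1, l2⟩ | ⟨hzx, hh⟩)
      · obtain rfl := t2 c (h.thick_symm l1)
        exact h.base_not_thick hz l2
      · exact hzx (t2 _ hh))
    simp only [Finset.card_singleton] at this
    omega

open scoped Classical in
/-- A vertex that is joined by a thick pair to a five-ring outside has large weight. -/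
theorem two_le_smooth_of_ring (h : IsACFree T) {a b c d e w : V} (r : Ring T a b c d e)
    (k : Thick T a w) (hw : w ∉ ({a, b, c, d, e} : Set V)) (hp : 0 < deg (Base T) w) :
    2 ≤ smooth T w := by
  obtain ⟨u, hb, hm⟩ := exists_maxBase hp
  obtain ⟨y, t, h1, h2⟩ := id hb
  have bare : ∀ v ∈ ({b, c, d, e} : Set V), Bare T w v := by
    intro v hv
    have hd := r.distinct h
    refine r.bare_of_thick h (u := a) (by simp) k hw (by simp at hv ⊢; tauto) ?_
    simp only [Set.mem_insert_iff, Set.mem_singleton_iff] at hv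
    grind
  have hu : u ∉ ({a, b, c, d, e} : Set V) := by
    intro hu
    rw [Set.mem_insert_iff] at hu
    rcases hu with rfl | hu
    · exact h.base_not_thick hb (h.thick_symm k)
    · exact h.base_not_bare hb (bare u hu)
  -- neighbours on the ring cannot both be around `u`
  have step : ∀ {p q f g i : V}, Ring T p q f g i → ({p, q, f, g, i} : Set V) = {a, b, c, d, e} →
      p ∈ around T w u y → q ∉ around T w u y := by
    intro p q f g i r' hs hpu hqu
    have hu' := hu
    rw [← hs] at hu'
    have hqb : Bare T u q := by
      rcases mem_around.1 hpu with ⟨-, c', s, l1, l2⟩ | ⟨-, l⟩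
      · have hc : c' ∉ ({p, q, f, g, i} : Set V) := fun hc =>
          hu' (r'.closed h (by simp) hc (h.rot' s))
        rcases h.base_thick s l1 l2 (h.thick_symm (r'.thick h))
          (by rintro rfl; simp at hc) with hh | ⟨w', hh⟩
        · exact h.bare_symm hh
        · exact absurd (r'.closed h (by simp) (by simp) hh.1) hc
      · exact r'.bare_of_thick h (u := p) (by simp) (h.thick_symm l) hu' (by simp)
          (r'.distinct h).1.symm
    rcases mem_around.1 hqu with ⟨-, l⟩ | ⟨-, l⟩
    · exact h.base_not_bare l hqb
    · exact thick_not_bare l hqb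
  -- so one of `b`, `c` and one of `d`, `e` form bare pairs with `w` that have not been counted yet
  have ex : ∃ v1 v2, v1 ≠ v2 ∧ (v1 ∈ ({b, c, d, e} : Set V) ∧ v1 ∉ around T w u y) ∧
      (v2 ∈ ({b, c, d, e} : Set V) ∧ v2 ∉ around T w u y) := by
    have s1 := step r.rotate (by grind)
    have s2 := step r.rotate.rotate.rotate (by grind)
    have hd := r.distinct h
    have m1 : ∃ v, (v = b ∨ v = c) ∧ v ∉ around T w u y := by
      by_cases hb : b ∈ around T w u y
      · exact ⟨c, Or.inr rfl, s1 hb⟩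
      · exact ⟨b, Or.inl rfl, hb⟩
    have m2 : ∃ v, (v = d ∨ v = e) ∧ v ∉ around T w u y := by
      by_cases hb : d ∈ around T w u y
      · exact ⟨e, Or.inr rfl, s2 hb⟩
      · exact ⟨d, Or.inl rfl, hb⟩
    obtain ⟨v1, g1, g1'⟩ := m1
    obtain ⟨v2, g2, g2'⟩ := m2
    refine ⟨v1, v2, by grind, ⟨by grind, g1'⟩, ⟨by grind, g2'⟩⟩
  obtain ⟨v1, v2, hne, ⟨g1, g1'⟩, g2, g2'⟩ := ex
  have hY : ∀ v ∈ ({v1, v2} : Finset V), BareIn T w v ∧ v ∉ around T w u y := by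
    have cn : ∀ v ∈ ({b, c, d, e} : Set V), Conn T w v := fun v hv =>
      (Conn.of_thick (h.thick_symm k)).trans
        (r.conn h (by simp) (by simp at hv ⊢; tauto))
    intro v hv
    simp only [Finset.mem_insert, Finset.mem_singleton] at hv
    rcases hv with rfl | rfl
    · exact ⟨⟨bare _ g1, cn _ g1⟩, g1'⟩
    · exact ⟨⟨bare _ g2, cn _ g2⟩, g2'⟩
  have tp : 0 < deg (Thick T) w := deg_pos (h.thick_symm h1)
  have tq : 0 < deg (Thick T) u := deg_pos (h.thick_symm h2)
  by_cases hr : ∃ a w', Ring T a u y w w'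
  · obtain ⟨a', w', hr⟩ := hr
    have h2' := h.ring_two_le hr
    have := h.le_smooth_ring hr hm _ hY
    rw [Finset.card_pair hne] at this
    push_cast at this
    omega
  · have := h.le_smooth t h1 h2 hr hm _ hY
    rw [Finset.card_pair hne] at this
    push_cast at this
    omega

end IsACFree

end

/-! ### Components with small smoothed weight -/

section

variable {V : Type*} {T : V → V → V → Prop}

/-- The thick pairs `a b`, `b c`, `c d` form a whole component of the graph of thick pairs, and both
`a b c` and `b c d` are triples. -/
def IsPath (T : V → V → V → Prop) (a b c d : V) : Prop :=
  T a b c ∧ T b c d ∧ Thick T a b ∧ Thick T b c ∧ Thick T c d ∧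
    (∀ v, Thick T a v → v = b) ∧ (∀ v, Thick T b v → v = a ∨ v = c) ∧
    (∀ v, Thick T c v → v = b ∨ v = d) ∧ (∀ v, Thick T d v → v = c)

/-- The vertex `x` is the centre of a star that is a whole component of the graph of thick pairs (an
isolated vertex counts as such). -/
def IsCentre (T : V → V → V → Prop) (x : V) : Prop :=
  ∀ y, Thick T x y → ∀ z, Thick T y z → z = x

variable [Fintype V]

namespace IsACFree

open scoped Classical in
theorem deg_le_two {R : V → V → Prop} {v x y z : V} (hv : deg R v ≤ 2) (hx : R v x) (hy : R v y)
    (hxy : x ≠ y) (hz : R v z) : z = x ∨ z = y := by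
  by_contra hh
  rw [not_or] at hh
  have := three_le_deg hx hy hz hxy (Ne.symm hh.1) (Ne.symm hh.2)
  omega

/-- If each vertex of a component has a base and its smoothed weight is at most one, then the
component is a path with four vertices. -/
theorem path_of_smooth_le (h : IsACFree T) {r : V}
    (hS : ∀ v, Conn T r v → 0 < deg (Base T) v ∧ ¬ InIsolatedRing T v ∧ smooth T v ≤ 1) :
    ∃ a b c d, Conn T r a ∧ IsPath T a b c d := by
  have noRing : ∀ v, Conn T r v → ∀ b c d e, ¬ Ring T v b c d e := by
    intro v hv b c d e hr
    apply (hS v hv).2.1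
    refine ⟨b, c, d, e, hr, fun u hu w k => ?_⟩
    by_contra hw
    obtain ⟨b', c', d', e', hr', hs⟩ := hr.exists_start hu
    have hcw : Conn T r w := (hv.trans (hr.conn h (by simp) hu)).trans (Conn.of_thick k)
    have := h.two_le_smooth_of_ring hr' k (hs ▸ hw) (hS w hcw).1
    have := (hS w hcw).2.2
    omega
  -- a base `p q` at `p`, with the thick degrees forced by the weight at `p`
  have pre : ∀ p, Conn T r p → ∃ q x, T x p q ∧ Thick T x p ∧ Thick T x q ∧
      deg (Thick T) p + deg (Thick T) q ≤ 3 := by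
    intro p hp
    obtain ⟨q, ⟨x, t, h1, h2⟩, hm⟩ := exists_maxBase (hS p hp).1
    have hr : ¬ ∃ a w, Ring T a q x p w := by
      rintro ⟨a, w, hr⟩
      exact noRing p hp _ _ _ _ hr.rotate.rotate.rotate
    have := h.le_smooth t h1 h2 hr hm ∅ (by simp)
    simp only [Finset.card_empty] at this
    have := (hS p hp).2.2
    exact ⟨q, x, t, h1, h2, by omega⟩
  -- if both ends `p`, `q` were pendant, then a base at `x` would give `x` a third thick pair, which
  -- is more than the bound at `x` allows
  have key : ∀ p, Conn T r p → ∃ q x, T x p q ∧ Thick T x p ∧ Thick T x q ∧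
      deg (Thick T) p + deg (Thick T) q = 3 := by
    intro p hp
    obtain ⟨q, x, t, h1, h2, h3⟩ := pre p hp
    refine ⟨q, x, t, h1, h2, ?_⟩
    have tp : 0 < deg (Thick T) p := deg_pos (h.thick_symm h1)
    have tq : 0 < deg (Thick T) q := deg_pos (h.thick_symm h2)
    by_contra h4
    obtain ⟨q', y, t', k1, k2, k3⟩ := pre x (hp.trans (Conn.of_thick (h.thick_symm h1)))
    have hxq' : x ≠ q' := (h.nes t').2.2
    have hyp : y ≠ p := by
      rintro rfl
      exact hxq' (deg_eq_one (by omega) k2 k1)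
    have hyq : y ≠ q := by
      rintro rfl
      exact hxq' (deg_eq_one (by omega) k2 k1)
    have := three_le_deg h1 h2 (h.thick_symm k1) (h.nes t).2.2 hyp.symm hyq.symm
    have : 0 < deg (Thick T) q' := deg_pos (h.thick_symm k2)
    omega
  have hb : ∃ b, Conn T r b ∧ deg (Thick T) b = 2 := by
    obtain ⟨q, x, t, h1, h2, h3⟩ := key r (Conn.refl r)
    have tp : 0 < deg (Thick T) r := deg_pos (h.thick_symm h1)
    have tq : 0 < deg (Thick T) q := deg_pos (h.thick_symm h2)
    by_cases hh : deg (Thick T) r = 2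
    · exact ⟨r, Conn.refl r, hh⟩
    · exact ⟨q, Conn.of_base h ⟨x, t, h1, h2⟩, by omega⟩
  -- The base `b d` has the apex `c`, and the base at `c` leads to the other end `a` of the path.
  obtain ⟨b, hb, hb2⟩ := hb
  obtain ⟨d, c, t, h1, h2, h3⟩ := key b hb
  have hbc : Conn T b c := Conn.of_thick (h.thick_symm h1)
  obtain ⟨a, x, t', k1, k2, k3⟩ := key c (hb.trans hbc)
  have hbd := (h.nes t).2.2
  have c2 := two_le_deg h1 h2 hbd
  have ta : 0 < deg (Thick T) a := deg_pos (h.thick_symm k2)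
  have hxb : x = b := by
    rcases deg_le_two (by omega) h1 h2 hbd (h.thick_symm k1) with rfl | rfl
    · rfl
    · exact absurd (deg_eq_one (by omega) k2 k1) (h.nes t').2.2
  subst hxb
  have hca := (h.nes t').2.2
  refine ⟨a, x, c, d, hb.trans (Conn.of_thick k2), h.rot' t', h.swap t, h.thick_symm k2,
    k1, h2, fun v hv => deg_eq_one (by omega) (h.thick_symm k2) hv,
    fun v hv => deg_le_two (by omega) k2 k1 hca.symm hv,
    fun v hv => deg_le_two (by omega) h1 h2 hbd hv,
    fun v hv => deg_eq_one (by omega) (h.thick_symm h2) hv⟩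

open scoped Classical in
/-- The sum of the smoothed weights over a component other than a star or an isolated five-ring is
at least the size of the component, and equality holds only for a path. -/
theorem card_comp_le (h : IsACFree T) {r : V}
    (hS : ∀ v, Conn T r v → ¬ IsCentre T v ∧ ¬ InIsolatedRing T v) :
    ((nbrs (Conn T) r).card : ℤ) ≤ ∑ v ∈ nbrs (Conn T) r, smooth T v ∧
    (((nbrs (Conn T) r).card : ℤ) = ∑ v ∈ nbrs (Conn T) r, smooth T v →
      ∃ a b c d, Conn T r a ∧ IsPath T a b c d) := by
  set S := nbrs (Conn T) r with hSdef
  have memS : ∀ {v}, v ∈ S ↔ Conn T r v := fun {v} => mem_nbrs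
  set S0 := S.filter fun v => deg (Base T) v = 0 with hS0
  set D := S.filter fun v => 0 < deg (Base T) v ∧ smooth T v ≤ 0 with hD
  let pend : V → Finset V := fun x => (nbrs (Thick T) x).filter fun q => deg (Thick T) q ≤ 1
  -- a vertex with a base but without weight is paid for by its only neighbour, which has no base
  have hDsub : D ⊆ S0.biUnion pend := by
    intro p hp
    rw [hD, Finset.mem_filter, memS] at hp
    obtain ⟨h1, x, hx, hx0⟩ := (h.smooth_nonneg hp.2.1 (hS p hp.1).2).2 hp.2.2
    rw [Finset.mem_biUnion]
    refine ⟨x, ?_, ?_⟩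
    · rw [hS0, Finset.mem_filter, memS]
      exact ⟨hp.1.trans (Conn.of_thick hx), hx0⟩
    · rw [Finset.mem_filter, mem_nbrs]
      exact ⟨h.thick_symm hx, h1⟩
  have hDcard : (D.card : ℤ) ≤ ∑ x ∈ S0, ((pend x).card : ℤ) := by
    exact_mod_cast (Finset.card_le_card hDsub).trans Finset.card_biUnion_le
  have h0 : ∀ x ∈ S0, ((pend x).card : ℤ) + 2 ≤ smooth T x := by
    intro x hx
    rw [hS0, Finset.mem_filter, memS] at hx
    have := (hS x hx.1).1
    simp only [IsCentre, not_forall] at this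
    obtain ⟨y, k1, z, k2, hz⟩ := this
    exact h.card_pendant_le hx.2 k1 k2 hz
  have h1 : ∀ x ∈ S.filter (fun v => ¬ deg (Base T) v = 0),
      (1 : ℤ) - (if smooth T x ≤ 0 then 1 else 0) ≤ smooth T x := by
    intro x hx
    rw [Finset.mem_filter, memS] at hx
    have := (h.smooth_nonneg (by omega) (hS x hx.1).2).1
    split_ifs <;> omega
  have e1 : ∑ v ∈ S, smooth T v = ∑ v ∈ S0, smooth T v +
      ∑ v ∈ S.filter (fun v => ¬ deg (Base T) v = 0), smooth T v :=
    (Finset.sum_filter_add_sum_filter_not _ _ _).symm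
  have e2 : (S.card : ℤ) = S0.card + (S.filter (fun v => ¬ deg (Base T) v = 0)).card := by
    exact_mod_cast (Finset.card_filter_add_card_filter_not _).symm
  have e3 : ∑ x ∈ S.filter (fun v => ¬ deg (Base T) v = 0),
      ((1 : ℤ) - (if smooth T x ≤ 0 then 1 else 0)) =
      (S.filter (fun v => ¬ deg (Base T) v = 0)).card - D.card := by
    rw [Finset.sum_sub_distrib, Finset.sum_const, nsmul_eq_mul, mul_one, ← Finset.sum_filter,
      Finset.filter_filter, Finset.sum_const, nsmul_eq_mul, mul_one, hD]
    have : S.filter (fun v => ¬ deg (Base T) v = 0 ∧ smooth T v ≤ 0) =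
        S.filter fun v => 0 < deg (Base T) v ∧ smooth T v ≤ 0 :=
      Finset.filter_congr fun v _ => by omega
    rw [this]
  have s0 := Finset.sum_le_sum h0
  have s1 := Finset.sum_le_sum h1
  rw [e3] at s1
  rw [Finset.sum_add_distrib, Finset.sum_const, nsmul_eq_mul] at s0
  refine ⟨by omega, fun heq => ?_⟩
  have z0 : S0.card = 0 := by omega
  have z1 : D = ∅ := by
    rw [Finset.card_eq_zero.1 z0, Finset.biUnion_empty] at hDsub
    exact Finset.subset_empty.1 hDsub
  have hpos : ∀ v, Conn T r v → 0 < deg (Base T) v := by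
    intro v hv
    by_contra hh
    have : v ∈ S0 := by
      rw [hS0, Finset.mem_filter, memS]
      exact ⟨hv, by omega⟩
    exact Finset.notMem_empty v (Finset.card_eq_zero.1 z0 ▸ this)
  have hge : ∀ v ∈ S, (1 : ℤ) ≤ smooth T v := by
    intro v hv
    by_contra hh
    have : v ∈ D := by
      rw [hD, Finset.mem_filter]
      exact ⟨hv, hpos v (memS.1 hv), by omega⟩
    simp [z1] at this
  have heq' : ∑ v ∈ S, (1 : ℤ) = ∑ v ∈ S, smooth T v := by simpa using heq
  have := (Finset.sum_eq_sum_iff_of_le hge).1 heq'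
  exact h.path_of_smooth_le fun v hv => ⟨hpos v hv, (hS v hv).2, (this v (memS.2 hv)).ge⟩

end IsACFree

end

/-! ### Weights of components -/

section

variable {V : Type*} {T : V → V → V → Prop}

/-- No triple meets the component of `r` in exactly two vertices. -/
def IsClosed (T : V → V → V → Prop) (r : V) : Prop :=
  ∀ u v w, Conn T r u → Conn T r w → T u w v → Conn T r v

namespace IsACFree

variable {x : V}

/-- A star component consists of its centre and the leaves. -/
theorem conn_centre (hx : IsCentre T x) {v : V} : Conn T x v ↔ v = x ∨ Thick T x v := by
  constructor
  · intro hv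
    refine hv.induct (fun v => v = x ∨ Thick T x v) ?_ (Or.inl rfl)
    rintro u w (rfl | hu) hw
    · exact Or.inr hw
    · exact Or.inl (hx u hu w hw)
  · rintro (rfl | hv)
    · exact Conn.refl _
    · exact Conn.of_thick hv

theorem base_leaf (h : IsACFree T) (hx : IsCentre T x) {p q : V} (hp : Thick T x p)
    (b : Base T p q) : Thick T x q ∧ T x p q := by
  obtain ⟨y, t, h1, h2⟩ := b
  obtain rfl := hx p hp y (h.thick_symm h1)
  exact ⟨h2, t⟩

end IsACFree

variable [Fintype V]

/-- The weight of a vertex within its component, which disregards the bare pairs to other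
components. -/
noncomputable def inner (T : V → V → V → Prop) (v : V) : ℤ :=
  deg (Thick T) v + deg (BareIn T) v - deg (Base T) v

/-- The finite set of the vertices of the component of `r`. -/
noncomputable abbrev comp (T : V → V → V → Prop) (r : V) : Finset V := nbrs (Conn T) r

/-- The number of the bare pairs that leave the component of `r`. The weights `inner` disregard
them. -/
noncomputable def compOut (T : V → V → V → Prop) (r : V) : ℕ := ∑ v ∈ comp T r, deg (BareOut T) v

namespace IsACFree

open scoped Classical in
/-- In a closed component, each vertex forms slim pairs with an even number of vertices outside:
these are matched by the triples at the vertex. -/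
theorem parity (h : IsACFree T) {r u : V} (hc : IsClosed T r) (hu : Conn T r u) :
    Even (Fintype.card V + (comp T r).card + deg (BareOut T) u) := by
  set A := Finset.univ.filter fun v => ¬ Conn T r v ∧ ¬ Bare T u v with hA
  have conn : ∀ v, Conn T u v ↔ Conn T r v := fun v =>
    ⟨fun hh => hu.trans hh, fun hh => (Conn.symm h hu).trans hh⟩
  have ex : ∀ v ∈ A, ∃ w, T u v w := by
    intro v hv
    rw [hA, Finset.mem_filter] at hv
    by_contra hh
    push Not at hh
    exact hv.2.2 ⟨by rintro rfl; exact hv.2.1 hu, hh⟩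
  choose! g hg using ex
  have out : ∀ v ∈ A, ¬ Conn T r v := fun v hv => (Finset.mem_filter.1 hv).2.1
  have uniq : ∀ v ∈ A, ∀ w, T u v w → w = g v := by
    intro v hv w hw
    by_contra hne
    exact out v hv (hu.trans (Conn.of_thick ⟨w, g v, hne, hw, hg v hv⟩))
  have gA : ∀ v ∈ A, g v ∈ A := by
    intro v hv
    rw [hA, Finset.mem_filter]
    refine ⟨Finset.mem_univ _, fun hh => ?_, fun hh => hh.2 _ (h.swap' (hg v hv))⟩
    exact out v hv (hc _ _ _ hu hh (h.swap' (hg v hv)))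
  have hev : ∑ v ∈ A, (1 : ZMod 2) = 0 := by
    refine Finset.sum_involution (fun v _ => g v) (fun _ _ => by decide) ?_ gA ?_
    · intro v hv _ he
      exact (h.nes (hg v hv)).2.2 he.symm
    · intro v hv
      exact (uniq _ (gA v hv) _ (h.swap' (hg v hv))).symm
  have hev' : Even A.card := by
    rw [Finset.sum_const, nsmul_eq_mul, mul_one] at hev
    exact (ZMod.natCast_eq_zero_iff_even).1 hev
  have h1 : Fintype.card V = (comp T r).card + (deg (BareOut T) u + A.card) := by
    rw [← Finset.card_univ, ← Finset.card_filter_add_card_filter_not (Conn T r)]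
    congr 1
    rw [← Finset.card_filter_add_card_filter_not (Bare T u), Finset.filter_filter,
      Finset.filter_filter]
    congr 1
    unfold deg nbrs BareOut
    congr 1
    ext v
    simp only [Finset.mem_filter, conn]
    tauto
  have : Fintype.card V + (comp T r).card + deg (BareOut T) u =
      2 * ((comp T r).card + deg (BareOut T) u) + A.card := by omega
  rw [this]
  exact (even_two_mul _).add hev'

section Star

variable {x : V}

theorem deg_base_centre (h : IsACFree T) (hx : IsCentre T x) : deg (Base T) x = 0 := by
  by_contra hh
  obtain ⟨q, y, t, h1, h2⟩ := exists_of_deg_pos (Nat.pos_of_ne_zero hh)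
  exact (h.nes t).2.2 (hx y (h.thick_symm h1) q h2).symm

theorem deg_bareIn_centre (hx : IsCentre T x) : deg (BareIn T) x = 0 := by
  by_contra hh
  obtain ⟨q, h1, h2⟩ := exists_of_deg_pos (Nat.pos_of_ne_zero hh)
  rcases (conn_centre hx).1 h2 with rfl | h3
  · exact h1.1 rfl
  · exact thick_not_bare h3 h1

theorem deg_thick_leaf (h : IsACFree T) (hx : IsCentre T x) {p : V} (hp : Thick T x p) :
    deg (Thick T) p = 1 := by
  have h1 := deg_pos (h.thick_symm hp)
  have h2 : deg (Thick T) p ≤ 1 := Finset.card_le_one.2 fun a ha b hb =>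
    (hx p hp a (mem_nbrs.1 ha)).trans (hx p hp b (mem_nbrs.1 hb)).symm
  omega

open scoped Classical in
theorem deg_bareIn_leaf (h : IsACFree T) (hx : IsCentre T x) {p : V} (hp : Thick T x p) :
    deg (BareIn T) p + deg (Base T) p + 1 = deg (Thick T) x := by
  have hpx := Conn.of_thick (h.thick_symm hp)
  have hunion : nbrs (BareIn T) p ∪ nbrs (Base T) p = (nbrs (Thick T) x).erase p := by
    ext v
    simp only [Finset.mem_union, mem_nbrs, Finset.mem_erase]
    constructor
    · rintro (hv | hv)
      · refine ⟨hv.1.1.symm, ?_⟩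
        rcases (conn_centre hx).1 ((Conn.of_thick hp).trans hv.2) with rfl | h3
        · exact absurd hv.1 (thick_not_bare (h.thick_symm hp))
        · exact h3
      · exact ⟨(h.base_ne hv).symm, (h.base_leaf hx hp hv).1⟩
    · rintro ⟨h1, h2⟩
      rcases h.base_or_bare hp h2 (Ne.symm h1) with hh | hh
      · exact Or.inr hh.2
      · exact Or.inl ⟨hh.2, hpx.trans (Conn.of_thick h2)⟩
  have hdisj : Disjoint (nbrs (BareIn T) p) (nbrs (Base T) p) := by
    rw [Finset.disjoint_left]
    intro v h1 h2
    exact h.base_not_bare (mem_nbrs.1 h2) (mem_nbrs.1 h1).1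
  have := Finset.card_erase_add_one (mem_nbrs.2 hp)
  rw [← hunion, Finset.card_union_of_disjoint hdisj] at this
  exact this

open scoped Classical in
theorem sum_comp_centre (hx : IsCentre T x) (h : IsACFree T) (f : V → ℤ) :
    ∑ v ∈ comp T x, f v = f x + ∑ v ∈ nbrs (Thick T) x, f v := by
  have : comp T x = insert x (nbrs (Thick T) x) := by
    ext v
    simp [conn_centre hx]
  rw [this, Finset.sum_insert]
  rw [mem_nbrs]
  exact fun hh => h.thick_ne hh rfl

theorem card_comp_centre (hx : IsCentre T x) (h : IsACFree T) :
    (comp T x).card = deg (Thick T) x + 1 := by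
  have := sum_comp_centre hx h fun _ => 1
  simp only [Finset.sum_const, nsmul_eq_mul, mul_one] at this
  unfold deg
  omega

theorem sum_inner_centre (hx : IsCentre T x) (h : IsACFree T) :
    ∑ v ∈ comp T x, inner T v = deg (Thick T) x +
      ((deg (Thick T) x : ℤ) ^ 2 - 2 * ∑ p ∈ nbrs (Thick T) x, (deg (Base T) p : ℤ)) := by
  rw [sum_comp_centre hx h]
  have e1 : inner T x = deg (Thick T) x := by
    simp [inner, h.deg_base_centre hx, deg_bareIn_centre hx]
  have e2 : ∀ p ∈ nbrs (Thick T) x, inner T p = deg (Thick T) x - 2 * (deg (Base T) p : ℤ) := by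
    intro p hp
    have hp := mem_nbrs.1 hp
    have := h.deg_bareIn_leaf hx hp
    have := h.deg_thick_leaf hx hp
    unfold inner
    omega
  rw [e1, Finset.sum_congr rfl e2, Finset.sum_sub_distrib, Finset.sum_const, nsmul_eq_mul,
    Finset.mul_sum, pow_two]
  rfl

open scoped Classical in
/-- Mantel's bound for the bases in a star. Since there is no copy of `C`, the ends of a base have
no common neighbour in the graph of the bases. -/
theorem sum_base_le (hx : IsCentre T x) (h : IsACFree T) :
    2 * ∑ p ∈ nbrs (Thick T) x, (deg (Base T) p : ℤ) ≤ (deg (Thick T) x : ℤ) ^ 2 := by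
  have h1 := sum_deg_le_sum_sup (R := Base T) (fun _ _ => h.base_symm) (nbrs (Thick T) x)
    fun u v b hu => mem_nbrs.2 (h.base_leaf hx (mem_nbrs.1 hu) b).1
  have h2 : ∀ p ∈ nbrs (Thick T) x,
      deg (Base T) p + (nbrs (Base T) p).sup (deg (Base T)) ≤ deg (Thick T) x := by
    intro p hp
    have hp := mem_nbrs.1 hp
    rcases Nat.eq_zero_or_pos (deg (Base T) p) with h0 | h0
    · rw [h0, ← maxBase, maxBase_eq_zero h0]
      simp
    · obtain ⟨q, hq, he⟩ := exists_maxBase h0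
      rw [← maxBase, he]
      have tq := h.base_leaf hx hp hq
      rw [deg, deg, ← Finset.card_union_of_disjoint]
      · refine card_le_deg _ fun y hy => ?_
        rcases Finset.mem_union.1 hy with hy | hy
        · exact (h.base_leaf hx hp (mem_nbrs.1 hy)).1
        · exact (h.base_leaf hx tq.1 (mem_nbrs.1 hy)).1
      · rw [Finset.disjoint_left]
        intro y hy hy'
        exact h.not_C (h.rot tq.2) (h.rot (h.base_leaf hx hp (mem_nbrs.1 hy)).2)
          (h.rot (h.base_leaf hx tq.1 (mem_nbrs.1 hy')).2)
  have h3 := Finset.sum_le_sum h2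
  rw [Finset.sum_add_distrib, Finset.sum_const, smul_eq_mul] at h3
  have h4 : 2 * ∑ p ∈ nbrs (Thick T) x, deg (Base T) p ≤ deg (Thick T) x ^ 2 := by
    have : (nbrs (Thick T) x).card = deg (Thick T) x := rfl
    rw [this] at h3
    rw [pow_two]
    omega
  exact_mod_cast h4

open scoped Classical in
/-- The handshaking lemma for the bases in a star. -/
theorem even_sum_base (hx : IsCentre T x) (h : IsACFree T) :
    Even (∑ p ∈ nbrs (Thick T) x, (deg (Base T) p : ℤ)) := by
  let G : SimpleGraph V :=
    { Adj := fun u v => Base T u v ∧ Thick T x u ∧ Thick T x v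
      symm := ⟨fun u v hh => ⟨h.base_symm hh.1, hh.2.2, hh.2.1⟩⟩
      loopless := ⟨fun u hh => h.base_ne hh.1 rfl⟩ }
  have h1 := G.sum_degrees_eq_twice_card_edges
  have h2 : ∑ v, G.degree v = ∑ p ∈ nbrs (Thick T) x, deg (Base T) p := by
    rw [← Finset.sum_subset (Finset.subset_univ (nbrs (Thick T) x))]
    · refine Finset.sum_congr rfl fun p hp => ?_
      rw [← SimpleGraph.card_neighborFinset_eq_degree, deg]
      congr 1
      ext v
      rw [SimpleGraph.mem_neighborFinset, mem_nbrs]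
      have hp := mem_nbrs.1 hp
      exact ⟨fun hh => hh.1, fun hh => ⟨hh, hp, (h.base_leaf hx hp hh).1⟩⟩
    · intro v _ hv
      rw [← SimpleGraph.card_neighborFinset_eq_degree, Finset.card_eq_zero,
        Finset.eq_empty_iff_forall_notMem]
      intro w hw
      rw [SimpleGraph.mem_neighborFinset] at hw
      exact hv (mem_nbrs.2 hw.2.1)
  rw [h2] at h1
  exact ⟨G.edgeFinset.card, by exact_mod_cast h1.trans (two_mul _)⟩

open scoped Classical in
/-- If some triple meets a star in exactly two vertices, then at least two bare pairs leave the
star. -/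
theorem two_le_compOut (hx : IsCentre T x) (h : IsACFree T) (hc : ¬ IsClosed T x)
    (hd : 2 ≤ deg (Thick T) x) : 2 ≤ compOut T x := by
  -- a triple that leaves the star contains the centre and a leaf
  have ex : ∃ p v, Thick T x p ∧ T x p v ∧ ¬ Conn T x v := by
    simp only [IsClosed, not_forall] at hc
    obtain ⟨u, v, w, hu, hw, t, hv⟩ := hc
    rw [conn_centre hx] at hu hw
    rcases hu with rfl | hu
    · rcases hw with rfl | hw
      · exact absurd rfl (h.ne t)
      · exact ⟨w, v, hw, t, hv⟩
    · rcases hw with rfl | hw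
      · exact ⟨u, v, hu, h.swap t, hv⟩
      · exact absurd (h.apex_unique hu hw t) fun e => hv (e ▸ Conn.refl _)
  -- the vertex outside forms bare pairs with all other leaves
  have bare : ∀ p v, Thick T x p → T x p v → ¬ Conn T x v → ∀ q, Thick T x q → q ≠ p →
      BareOut T q v := by
    intro p v hp t hv q hq hqp
    refine ⟨⟨?_, fun w tw => ?_⟩, fun hh => hv ((Conn.of_thick hq).trans hh)⟩
    · rintro rfl
      exact hv (Conn.of_thick hq)
    · have hwp : w ≠ p := by
        rintro rfl
        exact hv ((Conn.of_thick hp).trans (Conn.of_thick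
          ⟨x, q, (h.thick_ne hq), h.rot t, h.rev tw⟩))
      have hwx : w ≠ x := by
        rintro rfl
        exact hv (Conn.of_thick ⟨p, q, hqp.symm, h.swap' t, h.rev tw⟩)
      obtain ⟨r, hr, tr⟩ := hq.exists_ne p
      refine h.not_A tr (h.swap' t) tw hr ?_ hwp.symm ?_ hqp.symm hwx
      · rintro rfl
        have k : Thick T q r := ⟨x, v, fun e => hv (e ▸ Conn.refl _), h.rot tr, h.swap' tw⟩
        exact hwx (hx q hq r k)
      · rintro rfl
        exact hv (Conn.of_thick ⟨p, q, hqp.symm, h.swap' t, h.swap' tr⟩)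
  have two : ∀ u w, Thick T x u → Thick T x w → u ≠ w → 0 < deg (BareOut T) u →
      0 < deg (BareOut T) w → 2 ≤ compOut T x := by
    intro u w hu hw huw h1 h2
    have : ∑ v ∈ {u, w}, deg (BareOut T) v ≤ compOut T x :=
      Finset.sum_le_sum_of_subset fun v hv => by
        simp only [Finset.mem_insert, Finset.mem_singleton] at hv
        rcases hv with rfl | rfl
        · exact mem_nbrs.2 (Conn.of_thick hu)
        · exact mem_nbrs.2 (Conn.of_thick hw)
    rw [Finset.sum_pair huw] at this
    omega
  obtain ⟨p, v, hp, t, hv⟩ := ex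
  obtain ⟨q, hq, hqp⟩ := Finset.exists_mem_ne (s := nbrs (Thick T) x) hd p
  have hq := mem_nbrs.1 hq
  have b1 := bare p v hp t hv q hq hqp
  obtain ⟨r, hr, tr⟩ := hq.exists_ne p
  by_cases hxr : Conn T x r
  · have hr' : Thick T x r := ((conn_centre hx).1 hxr).resolve_left (h.nes tr).2.1.symm
    exact two q r hq hr' (h.nes tr).2.2 (deg_pos b1) (deg_pos (bare p v hp t hv r hr' hr))
  · exact two q p hq hp hqp (deg_pos b1) (deg_pos (bare q r hq tr hxr p hp hqp.symm))

end Star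

/-- The weight of a component whose graph of thick pairs is a star. Either it exceeds the size, or
it equals the size and the number of the leaves is odd, or it is one below the size; the last case
occurs only for closed stars with an even number of leaves. -/
theorem star_weight (h : IsACFree T) {x : V} (hx : IsCentre T x) :
    (((comp T x).card : ℤ) + 1 ≤ ∑ v ∈ comp T x, inner T v + compOut T x) ∨
    (∑ v ∈ comp T x, inner T v = (comp T x).card ∧ compOut T x = 0 ∧ Odd (deg (Thick T) x) ∧
      2 * ∑ p ∈ nbrs (Thick T) x, (deg (Base T) p : ℤ) + 1 = (deg (Thick T) x : ℤ) ^ 2) ∨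
    (IsClosed T x ∧ ∑ v ∈ comp T x, inner T v + 1 = (comp T x).card ∧
      Even (deg (Thick T) x)) := by
  rw [sum_inner_centre hx h, card_comp_centre hx h]
  have h1 := sum_base_le hx h
  obtain ⟨k, hk⟩ := even_sum_base hx h
  rw [hk] at h1 ⊢
  push_cast
  set t : ℕ := deg (Thick T) x with ht
  rcases Nat.even_or_odd' t with ⟨m, hm | hm⟩
  · have e : (t : ℤ) ^ 2 = 4 * (m : ℤ) ^ 2 := by rw [hm]; push_cast; ring
    rw [e] at h1 ⊢
    by_cases hkm : (m : ℤ) ^ 2 = k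
    · by_cases hc : IsClosed T x
      · exact Or.inr (Or.inr ⟨hc, by omega, ⟨m, by omega⟩⟩)
      · left
        rcases Nat.eq_zero_or_pos m with h0 | h0
        · refine (hc fun u v w hu hw tt => ?_).elim
          have ht0 : ∀ y, ¬ Thick T x y := fun y hy => by
            have := deg_pos hy
            omega
          rw [conn_centre hx] at hu hw
          have hu := hu.resolve_right (ht0 _)
          have hw := hw.resolve_right (ht0 _)
          exact absurd (hu.trans hw.symm) (h.ne tt)
        · have := two_le_compOut hx h hc (by omega)
          omega
    · left
      omega
  · have e : (t : ℤ) ^ 2 = 4 * ((m : ℤ) ^ 2 + m) + 1 := by rw [hm]; push_cast; ring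
    rw [e] at h1 ⊢
    by_cases hkm : (m : ℤ) ^ 2 + m = k ∧ compOut T x = 0
    · exact Or.inr (Or.inl ⟨by omega, hkm.2, ⟨m, hm⟩, by omega⟩)
    · left
      omega

open scoped Classical in
/-- An isolated five-ring is a closed component of weight zero. -/
theorem ring_weight (h : IsACFree T) {a : V} (ha : InIsolatedRing T a) :
    IsClosed T a ∧ (comp T a).card = 5 ∧ (∀ v ∈ comp T a, inner T v = 0) ∧
      ∀ v ∈ comp T a, InIsolatedRing T v := by
  obtain ⟨b, c, d, e, r, hiso⟩ := ha
  have hconn : ∀ v, Conn T a v ↔ v ∈ ({a, b, c, d, e} : Set V) := fun v =>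
    ⟨fun hv => hv.induct (· ∈ ({a, b, c, d, e} : Set V)) (fun u w hu k => hiso u hu w k)
      (by simp), fun hv => r.conn h (by simp) hv⟩
  refine ⟨?_, ?_, ?_, ?_⟩
  · intro u v w hu hw t
    rw [hconn] at hu hw ⊢
    exact r.closed h hu hw t
  · have : comp T a = {a, b, c, d, e} := by
      ext v
      rw [mem_nbrs, hconn]
      simp
    rw [this]
    have := r.distinct h
    rw [Finset.card_insert_of_notMem (by simp; tauto),
      Finset.card_insert_of_notMem (by simp; tauto),
      Finset.card_insert_of_notMem (by simp; tauto), Finset.card_pair (by tauto)]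
  · intro v hv
    rw [mem_nbrs, hconn] at hv
    obtain ⟨b', c', d', e', r', hs⟩ := r.exists_start hv
    rw [← hs] at hiso
    have hd := r'.distinct h
    have r'' := (r'.reverse h).rotate.rotate.rotate.rotate
    have k1 := r'.thick h
    have k2 := r'.thick' h
    have b1 : Base T v c' := ⟨b', h.swap r'.1, h.thick_symm k1, r'.rotate.thick h⟩
    have b2 : Base T v d' := ⟨e', h.swap r''.1, h.thick_symm k2, r''.rotate.thick h⟩
    have hb : ∀ w ∈ ({v, b', c', d', e'} : Set V), ¬ Bare T v w := by
      intro w hw hb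
      simp only [Set.mem_insert_iff, Set.mem_singleton_iff] at hw
      rcases hw with rfl | rfl | rfl | rfl | rfl
      · exact hb.1 rfl
      · exact thick_not_bare k1 hb
      · exact h.base_not_bare b1 hb
      · exact h.base_not_bare b2 hb
      · exact thick_not_bare k2 hb
    have cl : ∀ w, Conn T v w → w ∈ ({v, b', c', d', e'} : Set V) := fun w hw =>
      hw.induct (· ∈ ({v, b', c', d', e'} : Set V)) (fun u w hu k => hiso u hu w k) (by simp)
    have e1 : nbrs (Thick T) v = {b', e'} := by
      ext w
      simp only [mem_nbrs, Finset.mem_insert, Finset.mem_singleton]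
      constructor
      · intro k
        have hw := hiso v (by simp) w k
        simp only [Set.mem_insert_iff, Set.mem_singleton_iff] at hw
        rcases hw with rfl | rfl | rfl | rfl | rfl
        · exact absurd rfl (h.thick_ne k)
        · exact Or.inl rfl
        · exact absurd k (h.base_not_thick b1)
        · exact absurd k (h.base_not_thick b2)
        · exact Or.inr rfl
      · rintro (rfl | rfl)
        · exact k1
        · exact k2
    have e2 : nbrs (Base T) v = {c', d'} := by
      ext w
      simp only [mem_nbrs, Finset.mem_insert, Finset.mem_singleton]
      constructor
      · intro k
        have hw := cl w (Conn.of_base h k)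
        simp only [Set.mem_insert_iff, Set.mem_singleton_iff] at hw
        rcases hw with rfl | rfl | rfl | rfl | rfl
        · exact absurd rfl (h.base_ne k)
        · exact absurd k1 (h.base_not_thick k)
        · exact Or.inl rfl
        · exact Or.inr rfl
        · exact absurd k2 (h.base_not_thick k)
      · rintro (rfl | rfl)
        · exact b1
        · exact b2
    have e3 : nbrs (BareIn T) v = ∅ := by
      rw [Finset.eq_empty_iff_forall_notMem]
      intro w hw
      have hw := mem_nbrs.1 hw
      exact hb w (cl w hw.2) hw.1
    simp only [inner, deg, e1, e2, e3]
    rw [Finset.card_pair (by tauto), Finset.card_pair (by tauto)]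
    simp
  · intro v hv
    rw [mem_nbrs, hconn] at hv
    obtain ⟨b', c', d', e', r', hs⟩ := r.exists_start hv
    exact ⟨b', c', d', e', r', hs ▸ hiso⟩

/-- The weight of a component that is neither a star nor an isolated five-ring. -/
theorem other_weight (h : IsACFree T) {r : V}
    (hS : ∀ v, Conn T r v → ¬ IsCentre T v ∧ ¬ InIsolatedRing T v) :
    ((comp T r).card : ℤ) ≤ ∑ v ∈ comp T r, inner T v ∧
    (((comp T r).card : ℤ) = ∑ v ∈ comp T r, inner T v →
      ∃ a b c d, Conn T r a ∧ IsPath T a b c d) := by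
  obtain ⟨h1, h2⟩ := h.card_comp_le hS
  have h3 := sum_deg_le_sum_sup (R := Base T) (fun _ _ => h.base_symm) (comp T r)
    fun u v b hu => mem_nbrs.2 ((mem_nbrs.1 hu).trans (Conn.of_base h b))
  have h4 : ∑ v ∈ comp T r, smooth T v ≤ ∑ v ∈ comp T r, inner T v := by
    simp only [smooth, inner, Finset.sum_sub_distrib]
    have : ((∑ v ∈ comp T r, deg (Base T) v : ℕ) : ℤ) ≤ (∑ v ∈ comp T r, maxBase T v : ℕ) := by
      exact_mod_cast h3
    push_cast at this
    omega
  exact ⟨h1.trans h4, fun heq => h2 (le_antisymm h1 (h4.trans heq.ge))⟩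

end IsACFree

end

/-! ### Double counting of the triples -/

section

variable {V : Type*} {T : V → V → V → Prop}

/-- The pair `u v` is contained in exactly one triple. -/
def Slim (T : V → V → V → Prop) (u v : V) : Prop := (∃ w, T u v w) ∧ ¬ Thick T u v

/-- The triple `u v w` contains no thick pair. -/
def Loose (T : V → V → V → Prop) (u v w : V) : Prop :=
  T u v w ∧ ¬ Thick T u v ∧ ¬ Thick T v w ∧ ¬ Thick T w u

namespace IsACFree

/-- In a star component, no vertex lies in a five-ring. -/
theorem not_ring_of_centre (h : IsACFree T) {x v : V} (hx : IsCentre T x) (hv : Conn T x v) :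
    ¬ InIsolatedRing T v := by
  rintro ⟨b, c, d, e, r, -⟩
  have hd := r.distinct h
  rcases (conn_centre hx).1 hv with rfl | hv
  · exact hd.2.1 (hx b (r.thick h) c (r.rotate.thick h)).symm
  · exact hd.2.2.2.2.2.2.1 ((hx v hv b (r.thick h)).trans (hx v hv e (r.thick' h)).symm)

end IsACFree

variable [Fintype V]

open scoped Classical in
/-- The number of ordered triples that satisfy `T`, so that each triple of a triple system counts
six times. -/
noncomputable def count (T : V → V → V → Prop) : ℤ := ∑ u, ∑ v, ∑ w, if T u v w then 1 else 0

/-- The weight of a vertex: the number of thick pairs plus the number of bare pairs minus the number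
of bases at it. -/
noncomputable def weight (T : V → V → V → Prop) (v : V) : ℤ := inner T v + deg (BareOut T) v

open scoped Classical in
theorem deg_eq_sum (R : V → V → Prop) (u : V) : (deg R u : ℤ) = ∑ v, if R u v then 1 else 0 := by
  rw [deg, nbrs, Finset.card_filter]
  push_cast
  rfl

theorem sum_rot (f : V → V → V → ℤ) : ∑ u, ∑ v, ∑ w, f v w u = ∑ u, ∑ v, ∑ w, f u v w := by
  rw [Finset.sum_comm]
  refine Finset.sum_congr rfl fun v _ => ?_
  rw [Finset.sum_comm]

theorem count_nonneg : 0 ≤ count T :=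
  Finset.sum_nonneg fun _ _ => Finset.sum_nonneg fun _ _ => Finset.sum_nonneg fun _ _ => by
    split_ifs <;> norm_num

theorem eq_zero_of_count (hT : count T = 0) (u v w : V) : ¬ T u v w := by
  classical
  have n0 : ∀ u v w, (0 : ℤ) ≤ if T u v w then 1 else 0 := fun u v w => by
    split_ifs <;> norm_num
  have n1 : ∀ u v, (0 : ℤ) ≤ ∑ w, if T u v w then 1 else 0 := fun u v =>
    Finset.sum_nonneg fun w _ => n0 u v w
  have n2 : ∀ u, (0 : ℤ) ≤ ∑ v, ∑ w, if T u v w then 1 else 0 := fun u =>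
    Finset.sum_nonneg fun v _ => n1 u v
  have e1 := (Finset.sum_eq_zero_iff_of_nonneg fun u _ => n2 u).1 hT u (Finset.mem_univ _)
  have e2 := (Finset.sum_eq_zero_iff_of_nonneg fun v _ => n1 u v).1 e1 v (Finset.mem_univ _)
  have e3 := (Finset.sum_eq_zero_iff_of_nonneg fun w _ => n0 u v w).1 e2 w (Finset.mem_univ _)
  intro t
  simp [t] at e3

namespace IsACFree

theorem sum_unique {P : V → Prop} [DecidablePred P] {Q : Prop} [Decidable Q]
    (hu : ∀ v w, P v → P w → v = w) (hQ : Q ↔ ∃ v, P v) :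
    (∑ v, if P v then (1 : ℤ) else 0) = if Q then 1 else 0 := by
  by_cases hq : Q
  · obtain ⟨v, hv⟩ := hQ.1 hq
    rw [Finset.sum_eq_single v]
    · simp [hq, hv]
    · exact fun w _ hw => if_neg fun hh => hw (hu w v hh hv)
    · exact fun hh => absurd (Finset.mem_univ v) hh
  · have : ∀ w, ¬ P w := fun w hw => hq (hQ.2 ⟨w, hw⟩)
    simp [hq, this]

open scoped Classical in
/-- Double counting: a triple contains two pairs that are slim or the base of the triple, or three
if it is loose. Both sides count ordered objects. -/
theorem count_identity (h : IsACFree T) :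
    3 * (∑ v, ((deg (Slim T) v : ℤ) + deg (Base T) v)) = 2 * count T + count (Loose T) := by
  have e1 : ∑ u, (deg (Slim T) u : ℤ) =
      ∑ u, ∑ v, ∑ w, if T u v w ∧ ¬ Thick T u v then 1 else 0 := by
    refine Finset.sum_congr rfl fun u _ => ?_
    rw [deg_eq_sum]
    refine Finset.sum_congr rfl fun v _ => ?_
    refine (sum_unique (P := fun w => T u v w ∧ ¬ Thick T u v) ?_ ?_).symm
    · intro w w' hw hw'
      by_contra hne
      exact hw.2 ⟨w, w', hne, hw.1, hw'.1⟩
    · simp [Slim]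
  have e2 : ∑ u, (deg (Base T) u : ℤ) =
      ∑ u, ∑ v, ∑ w, if T u v w ∧ Thick T w u ∧ Thick T w v then 1 else 0 := by
    refine Finset.sum_congr rfl fun u _ => ?_
    rw [deg_eq_sum]
    refine Finset.sum_congr rfl fun v _ => ?_
    refine (sum_unique (P := fun w => T u v w ∧ Thick T w u ∧ Thick T w v) ?_ ?_).symm
    · intro w w' hw hw'
      exact (h.apex_unique hw.2.1 hw.2.2 hw'.1).symm
    · exact ⟨fun ⟨x, t, h1, h2⟩ => ⟨x, h.rot t, h1, h2⟩,
        fun ⟨x, t, h1, h2⟩ => ⟨x, h.rot' t, h1, h2⟩⟩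
  let g : V → V → V → ℤ := fun u v w => (if T u v w ∧ ¬ Thick T u v then 1 else 0) +
    (if T u v w ∧ Thick T w u ∧ Thick T w v then 1 else 0)
  have e3 : ∑ v, ((deg (Slim T) v : ℤ) + deg (Base T) v) = ∑ u, ∑ v, ∑ w, g u v w := by
    rw [Finset.sum_add_distrib, e1, e2]
    simp only [g, Finset.sum_add_distrib]
  have e4 : ∀ u v w, g u v w + g v w u + g w u v =
      2 * (if T u v w then 1 else 0) + (if Loose T u v w then 1 else 0) := by
    intro u v w
    by_cases t : T u v w
    · have t1 : T v w u := h.rot t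
      have t2 : T w u v := h.rot' t
      have s1 : Thick T v u ↔ Thick T u v := ⟨h.thick_symm, h.thick_symm⟩
      have s2 : Thick T w v ↔ Thick T v w := ⟨h.thick_symm, h.thick_symm⟩
      have s3 : Thick T u w ↔ Thick T w u := ⟨h.thick_symm, h.thick_symm⟩
      have nt : Thick T u v → Thick T w u → ¬ Thick T v w := fun k1 k2 =>
        h.thick_triangle k1 (s3.2 k2)
      simp only [g, t, t1, t2, Loose, s1, s2, s3, true_and]
      by_cases k1 : Thick T u v <;> by_cases k2 : Thick T v w <;> by_cases k3 : Thick T w u <;>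
        simp_all
    · have t1 : ¬ T v w u := fun hh => t (h.rot' hh)
      have t2 : ¬ T w u v := fun hh => t (h.rot hh)
      simp [g, t, t1, t2, Loose]
  rw [e3]
  have r1 := sum_rot g
  have r2 : ∑ u, ∑ v, ∑ w, g w u v = ∑ u, ∑ v, ∑ w, g v w u := sum_rot fun u v w => g v w u
  calc 3 * ∑ u, ∑ v, ∑ w, g u v w
      = ∑ u, ∑ v, ∑ w, g u v w + ∑ u, ∑ v, ∑ w, g v w u + ∑ u, ∑ v, ∑ w, g w u v := by
        rw [r2, r1]
        ring
    _ = ∑ u, ∑ v, ∑ w, (g u v w + g v w u + g w u v) := by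
        simp only [Finset.sum_add_distrib]
    _ = _ := by
        simp only [e4, Finset.sum_add_distrib, ← Finset.mul_sum]
        rfl

open scoped Classical in
/-- Each pair is thick, slim or bare. -/
theorem card_eq_degs (h : IsACFree T) (u : V) :
    (Fintype.card V : ℤ) - 1 = deg (Thick T) u + deg (Slim T) u + deg (BareIn T) u +
      deg (BareOut T) u := by
  have e : ∀ v, (if u = v then (0 : ℤ) else 1) = (if Thick T u v then 1 else 0) +
      (if Slim T u v then 1 else 0) + (if BareIn T u v then 1 else 0) +
      (if BareOut T u v then 1 else 0) := by
    intro v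
    by_cases huv : u = v
    · subst huv
      have h1 : ∀ w, ¬ T u u w := fun w hw => h.ne hw rfl
      simp [Thick, Slim, BareIn, BareOut, Bare, h1]
    · by_cases k : Thick T u v
      · obtain ⟨c, d, hcd, hc, hd⟩ := id k
        have : ¬ Bare T u v := fun hb => hb.2 _ hc
        simp [huv, k, Slim, BareIn, BareOut, this]
      · by_cases s : ∃ w, T u v w
        · have : ¬ Bare T u v := fun hb => by
            obtain ⟨w, hw⟩ := s
            exact hb.2 _ hw
          simp only [huv, k, Slim, BareIn, BareOut, this, s]
          simp
        · have : Bare T u v := ⟨huv, fun w hw => s ⟨w, hw⟩⟩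
          simp only [huv, k, Slim, BareIn, BareOut, this, s]
          by_cases c : Conn T u v <;> simp [c]
  have := Finset.sum_congr rfl fun v (_ : v ∈ Finset.univ) => e v
  simp only [Finset.sum_add_distrib, ← deg_eq_sum] at this
  rw [← this]
  have : ∀ v, (if u = v then (0 : ℤ) else 1) = 1 - if u = v then 1 else 0 := fun v => by
    split_ifs <;> norm_num
  simp only [this, Finset.sum_sub_distrib]
  simp

/-- The number of triples in terms of the weights of the vertices. -/
theorem count_eq (h : IsACFree T) :
    2 * count T + count (Loose T) + 3 * ∑ v, weight T v =
      3 * (Fintype.card V * (Fintype.card V - 1)) := by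
  rw [← h.count_identity, ← mul_add, ← Finset.sum_add_distrib]
  congr 1
  have : ∀ v ∈ Finset.univ, ((deg (Slim T) v : ℤ) + deg (Base T) v) + weight T v =
      (Fintype.card V : ℤ) - 1 := by
    intro v _
    rw [h.card_eq_degs v]
    unfold weight inner
    ring
  rw [Finset.sum_congr rfl this]
  simp
  ring

open scoped Classical in
/-- Inequalities between sums over the components add up. -/
theorem sum_le_sum_of_comp (h : IsACFree T) (f g : V → ℤ)
    (H : ∀ r, ∑ v ∈ comp T r, g v ≤ ∑ v ∈ comp T r, f v) :
    ∑ v, g v ≤ ∑ v, f v ∧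
      (∑ v, g v = ∑ v, f v → ∀ r, ∑ v ∈ comp T r, g v = ∑ v ∈ comp T r, f v) := by
  let s : Setoid V := ⟨Conn T, Conn.refl, Conn.symm h, Conn.trans⟩
  have hc : ∀ r, Finset.univ.filter (fun v => (Quotient.mk s v) = Quotient.mk s r) = comp T r := by
    intro r
    ext v
    simp only [Finset.mem_filter, Finset.mem_univ, true_and, mem_nbrs, Quotient.eq]
    exact ⟨Conn.symm h, Conn.symm h⟩
  have key : ∀ f : V → ℤ, ∑ v, f v = ∑ q : Quotient s,
      ∑ v ∈ Finset.univ.filter (fun v => Quotient.mk s v = q), f v := fun f =>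
    (Finset.sum_fiberwise Finset.univ (fun v => Quotient.mk s v) f).symm
  have H' : ∀ q ∈ (Finset.univ : Finset (Quotient s)),
      ∑ v ∈ Finset.univ.filter (fun v => Quotient.mk s v = q), g v ≤
      ∑ v ∈ Finset.univ.filter (fun v => Quotient.mk s v = q), f v := by
    intro q _
    induction q using Quotient.inductionOn with
    | h r => rw [hc]; exact H r
  rw [key f, key g]
  refine ⟨Finset.sum_le_sum H', fun he r => ?_⟩
  have := (Finset.sum_eq_sum_iff_of_le H').1 he (Quotient.mk s r) (Finset.mem_univ _)
  rwa [hc] at this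

theorem comp_congr (h : IsACFree T) {r x : V} (hx : Conn T r x) : comp T r = comp T x := by
  ext v
  simp only [mem_nbrs]
  exact ⟨fun hv => (Conn.symm h hx).trans hv, fun hv => hx.trans hv⟩

theorem sum_weight (T : V → V → V → Prop) (r : V) :
    ∑ v ∈ comp T r, weight T v = ∑ v ∈ comp T r, inner T v + compOut T r := by
  simp only [weight, Finset.sum_add_distrib, compOut]
  push_cast
  rfl

end IsACFree

/-- The component of `r` is a star with an odd number of leaves and as many bases as possible. -/
def IsOddStar (T : V → V → V → Prop) (r : V) : Prop :=
  ∃ x, Conn T r x ∧ IsCentre T x ∧ Odd (deg (Thick T) x) ∧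
    2 * ∑ p ∈ nbrs (Thick T) x, (deg (Base T) p : ℤ) + 1 = (deg (Thick T) x : ℤ) ^ 2

/-- The component of `r` is a path with four vertices as in `IsPath`. -/
def OnPath (T : V → V → V → Prop) (r : V) : Prop :=
  ∃ a b c d, Conn T r a ∧ IsPath T a b c d

namespace IsACFree

/-- The possible components: those with excess weight, the balanced ones, the five-rings, and the
stars with a deficit. -/
theorem component_cases (h : IsACFree T) (r : V) :
    (((comp T r).card : ℤ) + 1 ≤ ∑ v ∈ comp T r, weight T v ∧
      ∀ v, Conn T r v → ¬ InIsolatedRing T v) ∨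
    (∑ v ∈ comp T r, weight T v = (comp T r).card ∧ compOut T r = 0 ∧
      (∀ v, Conn T r v → ¬ InIsolatedRing T v ∧ (IsCentre T v → Odd (deg (Thick T) v))) ∧
      (IsOddStar T r ∨ OnPath T r)) ∨
    (InIsolatedRing T r ∧ ∑ v ∈ comp T r, weight T v = compOut T r) ∨
    (∃ x, Conn T r x ∧ IsCentre T x ∧ IsClosed T x ∧ Even (deg (Thick T) x) ∧
      ∑ v ∈ comp T r, weight T v + 1 = (comp T r).card + compOut T r) := by
  rw [sum_weight]
  by_cases hc : ∃ x, Conn T r x ∧ IsCentre T x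
  · obtain ⟨x, hrx, hx⟩ := hc
    have hnr : ∀ v, Conn T r v → ¬ InIsolatedRing T v := fun v hv =>
      h.not_ring_of_centre hx ((Conn.symm h hrx).trans hv)
    have e := h.comp_congr hrx
    have e' : compOut T r = compOut T x := by rw [compOut, compOut, e]
    rw [e, e']
    rcases h.star_weight hx with hs | ⟨hs, h0, ho, hb⟩ | ⟨hcl, hs, he⟩
    · exact Or.inl ⟨hs, hnr⟩
    · refine Or.inr (Or.inl ⟨by omega, h0, fun v hv => ⟨hnr v hv, fun hvc => ?_⟩,
        Or.inl ⟨x, hrx, hx, ho, hb⟩⟩)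
      rcases (conn_centre hx).1 ((Conn.symm h hrx).trans hv) with rfl | hxv
      · exact ho
      · rw [h.deg_thick_leaf hx hxv]
        exact odd_one
    · exact Or.inr (Or.inr (Or.inr ⟨x, hrx, hx, hcl, he, by omega⟩))
  · push Not at hc
    by_cases hr : ∃ v, Conn T r v ∧ InIsolatedRing T v
    · obtain ⟨v, hrv, hv⟩ := hr
      have hw := h.ring_weight hv
      have hr : InIsolatedRing T r := hw.2.2.2 r (mem_nbrs.2 (Conn.symm h hrv))
      refine Or.inr (Or.inr (Or.inl ⟨hr, ?_⟩))
      rw [Finset.sum_eq_zero (h.ring_weight hr).2.2.1, zero_add]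
    · push Not at hr
      obtain ⟨h1, h2⟩ := h.other_weight fun v hv => ⟨hc v hv, hr v hv⟩
      by_cases he : ((comp T r).card : ℤ) = ∑ v ∈ comp T r, inner T v ∧ compOut T r = 0
      · exact Or.inr (Or.inl ⟨by omega, he.2,
          fun v hv => ⟨hr v hv, fun hvc => absurd hvc (hc v hv)⟩, Or.inr (h2 he.1)⟩)
      · refine Or.inl ⟨?_, hr⟩
        omega

end IsACFree

end

/-! ### The upper bounds and tight systems -/

section

variable {V : Type*} {T : V → V → V → Prop}

namespace IsACFree

/-- Two vertices in different closed components form a bare pair or lie in a triple without thick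
pairs. -/
theorem loose_of_closed (h : IsACFree T) {u v w : V} (hu : IsClosed T u) (hv : IsClosed T v)
    (huv : ¬ Conn T u v) (t : T u v w) : Loose T u v w := by
  refine ⟨t, fun k => huv (Conn.of_thick k), fun k => huv (Conn.symm h ?_), fun k => huv ?_⟩
  · exact hv v u w (Conn.refl v) (Conn.of_thick k) (h.rot t)
  · exact hu u v w (Conn.refl u) (Conn.of_thick (h.thick_symm k)) (h.swap' t)

theorem isClosed_congr (h : IsACFree T) {r x : V} (hx : Conn T r x) (hr : IsClosed T r) :
    IsClosed T x := fun u v w hu hw t =>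
  (Conn.symm h hx).trans (hr u v w (hx.trans hu) (hx.trans hw) t)

theorem bareOut_symm (h : IsACFree T) {u v : V} (b : BareOut T u v) : BareOut T v u :=
  ⟨h.bare_symm b.1, fun hh => b.2 (Conn.symm h hh)⟩

end IsACFree

variable [Fintype V]

/-- The structure of an extremal system: each triple contains a thick pair, only isolated vertices
of the graph of thick pairs form bare pairs with vertices of other components, and the components
are isolated vertices, stars with an odd number of leaves, paths with four vertices and five-rings.
-/
def IsTight (T : V → V → V → Prop) : Prop :=
  (∀ u v w, ¬ Loose T u v w) ∧
  (∀ u v, BareOut T u v → (∀ w, ¬ Thick T u w) ∧ ∀ w, ¬ Thick T v w) ∧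
  ∀ r, IsOddStar T r ∨ OnPath T r ∨ InIsolatedRing T r ∨ ∀ w, ¬ Thick T r w

theorem deg_le_compOut {r v : V} (hv : Conn T r v) : deg (BareOut T) v ≤ compOut T r :=
  Finset.single_le_sum (f := deg (BareOut T)) (fun _ _ => Nat.zero_le _) (mem_nbrs.2 hv)

namespace IsACFree

/-- The bound for an even number of vertices. By `parity`, each vertex of a component with a deficit
forms a bare pair with a vertex outside, which makes up for the deficit. -/
theorem even_bound (h : IsACFree T) (hn : Even (Fintype.card V)) :
    2 * count T ≤ 3 * (Fintype.card V * (Fintype.card V - 2)) ∧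
    (2 * count T = 3 * (Fintype.card V * (Fintype.card V - 2)) →
      IsTight T ∧ (4 ≤ Fintype.card V → ∃ u v, Thick T u v)) := by
  have odd : ∀ r, IsClosed T r → Odd (comp T r).card → ∀ v ∈ comp T r,
      1 ≤ deg (BareOut T) v := by
    intro r hr ho v hv
    have := h.parity hr (mem_nbrs.1 hv)
    by_contra h0
    have h0 : deg (BareOut T) v = 0 := by omega
    rw [h0, add_zero] at this
    exact (Nat.not_even_iff_odd.2 (hn.add_odd ho)) this
  have le_out : ∀ r, IsClosed T r → Odd (comp T r).card → (comp T r).card ≤ compOut T r := by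
    intro r hr ho
    have := Finset.sum_le_sum (odd r hr ho)
    simpa [compOut] using this
  have oddStar : ∀ r x, Conn T r x → IsCentre T x → Even (deg (Thick T) x) →
      Odd (comp T r).card := by
    intro r x hrx hx he
    rw [h.comp_congr hrx, card_comp_centre hx h]
    exact he.add_one
  have key : ∀ r, ∑ v ∈ comp T r, (1 : ℤ) ≤ ∑ v ∈ comp T r, weight T v := by
    intro r
    rw [Finset.sum_const, nsmul_eq_mul, mul_one]
    rcases h.component_cases r with ⟨hc, -⟩ | ⟨hc, -⟩ | ⟨hr, hc⟩ | ⟨x, hrx, hx, hcl, he, hc⟩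
    · omega
    · omega
    · have hw := h.ring_weight hr
      have := le_out r hw.1 (by rw [hw.2.1]; decide)
      omega
    · have ho := oddStar r x hrx hx he
      have := le_out r (h.isClosed_congr (Conn.symm h hrx) hcl) ho
      have := ho.pos
      omega
  obtain ⟨h1, h2⟩ := h.sum_le_sum_of_comp _ _ key
  simp only [Finset.sum_const, nsmul_eq_mul, mul_one] at h1 h2
  rw [Finset.card_univ] at h1 h2
  have hcount := h.count_eq
  have hl := count_nonneg (T := Loose T)
  set n : ℤ := (Fintype.card V : ℤ) with hndef
  refine ⟨by nlinarith, fun heq => ?_⟩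
  have hL : count (Loose T) = 0 := by nlinarith
  have hW : n = ∑ v, weight T v := by nlinarith
  have hcomp := h2 hW
  have cases : ∀ r, (compOut T r = 0 ∧ (IsOddStar T r ∨ OnPath T r)) ∨
      (IsClosed T r ∧ (∀ v ∈ comp T r, deg (BareOut T) v ≤ 1) ∧
        (InIsolatedRing T r ∨ ∀ w, ¬ Thick T r w)) := by
    intro r
    have hr := hcomp r
    rcases h.component_cases r with ⟨hc, -⟩ | ⟨hc, h0, -, hs⟩ | ⟨hri, hc⟩ |
      ⟨x, hrx, hx, hcl, he, hc⟩
    · omega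
    · exact Or.inl ⟨h0, hs⟩
    · have hw := h.ring_weight hri
      have ho := odd r hw.1 (by rw [hw.2.1]; decide)
      have e : ∑ v ∈ comp T r, 1 = ∑ v ∈ comp T r, deg (BareOut T) v := by
        rw [Finset.sum_const, smul_eq_mul, mul_one]
        unfold compOut at hc
        omega
      exact Or.inr ⟨hw.1, fun v hv => ((Finset.sum_eq_sum_iff_of_le ho).1 e v hv).ge, Or.inl hri⟩
    · have hcl' := h.isClosed_congr (Conn.symm h hrx) hcl
      have ho := le_out r hcl' (oddStar r x hrx hx he)
      have hc1 : (comp T r).card ≤ 1 := by omega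
      refine Or.inr ⟨hcl', fun v hv => ?_, Or.inr fun w k => ?_⟩
      · have := deg_le_compOut (mem_nbrs.1 hv)
        omega
      · exact h.thick_ne k (Finset.card_le_one.1 hc1 _ (mem_nbrs.2 (Conn.refl r)) _
          (mem_nbrs.2 (Conn.of_thick k)))
  have noLoose := eq_zero_of_count hL
  have single : ∀ u v, BareOut T u v → ∀ w, ¬ Thick T u w := by
    intro u v b
    have pu : 0 < deg (BareOut T) u := deg_pos b
    have pv : 0 < deg (BareOut T) v := deg_pos (h.bareOut_symm b)
    have du := deg_le_compOut (Conn.refl (T := T) u)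
    have dv := deg_le_compOut (Conn.refl (T := T) v)
    rcases cases u with ⟨h0, -⟩ | ⟨clu, -, hu⟩
    · omega
    rcases cases v with ⟨h0, -⟩ | ⟨clv, hv, -⟩
    · omega
    rcases hu with hu | hu
    · -- all vertices of a five-ring would form bare pairs with the vertex `v`
      have hle : (comp T u).card ≤ deg (BareOut T) v := by
        refine card_le_deg _ fun u' hu' => h.bareOut_symm ?_
        have hu' := mem_nbrs.1 hu'
        have hn : ¬ Conn T u' v := fun hh => b.2 (hu'.trans hh)
        refine ⟨⟨?_, fun w t => ?_⟩, hn⟩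
        · rintro rfl
          exact hn (Conn.refl _)
        · exact noLoose _ _ _ (h.loose_of_closed (h.isClosed_congr hu' clu) clv hn t)
      have := hv v (mem_nbrs.2 (Conn.refl v))
      have := (h.ring_weight hu).2.1
      omega
    · exact hu
  refine ⟨⟨noLoose, fun u v b => ⟨single u v b, single v u (h.bareOut_symm b)⟩, fun r => ?_⟩, ?_⟩
  · rcases cases r with ⟨-, hh | hh⟩ | ⟨-, -, hh | hh⟩
    · exact Or.inl hh
    · exact Or.inr (Or.inl hh)
    · exact Or.inr (Or.inr (Or.inl hh))
    · exact Or.inr (Or.inr (Or.inr hh))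
  · intro h4
    -- without thick pairs, all pairs would be bare, which is more than the weight allows
    by_contra hno
    push Not at hno
    have : Nonempty V := Fintype.card_pos_iff.1 (by omega)
    obtain ⟨v⟩ := this
    have hle : Fintype.card V ≤ deg (BareOut T) v + 1 := by
      classical
      rw [← Finset.card_univ, ← Finset.card_erase_add_one (Finset.mem_univ v)]
      refine Nat.add_le_add_right (card_le_deg _ fun w hw => ?_) 1
      have hw := Finset.ne_of_mem_erase hw
      refine ⟨⟨hw.symm, fun z t => noLoose _ _ _ ⟨t, hno _ _, hno _ _, hno _ _⟩⟩, fun hc => ?_⟩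
      exact hw (hc.induct (· = v) (fun a b _ k => absurd k (hno a b)) rfl)
    have := deg_le_compOut (Conn.refl (T := T) v)
    rcases cases v with ⟨h0, -⟩ | ⟨-, hv, -⟩
    · omega
    · have := hv v (mem_nbrs.2 (Conn.refl v))
      omega

open scoped Classical in
/-- The bound for an odd number of vertices. The only components with a deficit are the isolated
five-rings and the closed stars with an even number of leaves and no bare pairs to the outside. Let
`r` be the number of vertices in such rings, and `s` the number of such stars, represented by their
centres. The total deficit is `r + s`, but any two of these `r + s` vertices in different components
form a bare pair or lie in a loose triple, which turns the bound into the inequality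
`(r + s) ^ 2 - 8 * r - 4 * s ≥ -15`, where `r = 0` or `r ≥ 5`. Equality forces `r = 5` and `s = 0`.
-/
theorem odd_bound (h : IsACFree T) (hn : Odd (Fintype.card V)) :
    2 * count T ≤ 3 * (((Fintype.card V : ℤ) - 1) ^ 2 + 4) ∧
    (2 * count T = 3 * (((Fintype.card V : ℤ) - 1) ^ 2 + 4) →
      IsTight T ∧ ∃ u v, Thick T u v) := by
  set Zr := Finset.univ.filter (InIsolatedRing T) with hZr
  set Zs := Finset.univ.filter (fun x => IsCentre T x ∧ IsClosed T x ∧ Even (deg (Thick T) x) ∧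
    compOut T x = 0) with hZs
  have mr : ∀ {v}, v ∈ Zr ↔ InIsolatedRing T v := fun {v} => by simp [hZr]
  have ms : ∀ {v}, v ∈ Zs ↔ IsCentre T v ∧ IsClosed T v ∧ Even (deg (Thick T) v) ∧
    compOut T v = 0 := fun {v} => by simp [hZs]
  have hdisj : Disjoint Zr Zs := Finset.disjoint_left.2 fun v h1 h2 =>
    not_ring_of_centre h (ms.1 h2).1 (Conn.refl v) (mr.1 h1)
  have bs : ∀ v ∈ Zs, deg (BareOut T) v = 0 := fun v hv => by
    have := deg_le_compOut (Conn.refl (T := T) v)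
    have := (ms.1 hv).2.2.2
    omega
  -- the lower bound for the weight, distributed over the vertices: a ring counts only its bare
  -- pairs to the outside, and the deficit of a star is charged to its centre
  let g : V → ℤ := fun v => 1 - (if v ∈ Zr then 1 else 0) - (if v ∈ Zs then 1 else 0) +
    (if v ∈ Zr then (deg (BareOut T) v : ℤ) else 0)
  have g_le : ∀ v, ¬ InIsolatedRing T v → g v ≤ 1 := by
    intro v hv
    have : v ∉ Zr := fun hh => hv (mr.1 hh)
    simp only [g, this, if_false]
    split_ifs <;> omega
  have sum_le : ∀ r, (∀ v, Conn T r v → ¬ InIsolatedRing T v) →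
      ∑ v ∈ comp T r, g v ≤ (comp T r).card := by
    intro r hr
    have := Finset.sum_le_sum fun v hv => g_le v (hr v (mem_nbrs.1 hv))
    simpa using this
  have key : ∀ r, ∑ v ∈ comp T r, g v ≤ ∑ v ∈ comp T r, weight T v ∧
      (∑ v ∈ comp T r, g v = ∑ v ∈ comp T r, weight T v →
        (compOut T r = 0 ∧ (IsOddStar T r ∨ OnPath T r)) ∨ r ∈ Zr ∨ Zs.Nonempty) := by
    intro r
    rcases h.component_cases r with ⟨hc, hr⟩ | ⟨hc, h0, hr, hs⟩ | ⟨hri, hc⟩ |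
      ⟨x, hrx, hx, hcl, he, hc⟩
    · have := sum_le r hr
      exact ⟨by omega, fun _ => by omega⟩
    · have := sum_le r fun v hv => (hr v hv).1
      exact ⟨by omega, fun _ => Or.inl ⟨h0, hs⟩⟩
    · refine ⟨le_of_eq ?_, fun _ => Or.inr (Or.inl (mr.2 hri))⟩
      rw [hc, compOut]
      push_cast
      refine Finset.sum_congr rfl fun v hv => ?_
      have hv := mr.2 ((h.ring_weight hri).2.2.2 v hv)
      simp [g, hv, Finset.disjoint_left.1 hdisj hv]
    · have hnr : ∀ v, Conn T r v → ¬ InIsolatedRing T v := fun v hv =>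
        not_ring_of_centre h hx ((Conn.symm h hrx).trans hv)
      have hle := sum_le r hnr
      by_cases h0 : compOut T r = 0
      · have hxs : x ∈ Zs := ms.2 ⟨hx, hcl, he, by
          rw [compOut, ← h.comp_congr hrx]; exact h0⟩
        refine ⟨?_, fun _ => Or.inr (Or.inr ⟨x, hxs⟩)⟩
        have : ∑ v ∈ comp T r, g v < ∑ v ∈ comp T r, (1 : ℤ) := by
          refine Finset.sum_lt_sum (fun v hv => g_le v (hnr v (mem_nbrs.1 hv)))
            ⟨x, mem_nbrs.2 hrx, ?_⟩
          simp [g, hxs, Finset.disjoint_right.1 hdisj hxs]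
        simp only [Finset.sum_const, nsmul_eq_mul, mul_one] at this
        omega
      · obtain ⟨v, hv, hv0⟩ := Finset.exists_ne_zero_of_sum_ne_zero h0
        have hcl' := h.isClosed_congr (Conn.symm h hrx) hcl
        have hp := h.parity hcl' (mem_nbrs.1 hv)
        have ho : Odd (comp T r).card := by
          rw [h.comp_congr hrx, card_comp_centre hx h]
          exact he.add_one
        have hev : Even (deg (BareOut T) v) := by
          rw [Nat.even_add] at hp
          exact hp.1 (hn.add_odd ho)
        obtain ⟨m, hm⟩ := hev
        have := deg_le_compOut (mem_nbrs.1 hv)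
        exact ⟨by omega, fun _ => by omega⟩
  obtain ⟨h1, h2⟩ := h.sum_le_sum_of_comp _ _ fun r => (key r).1
  have hg : ∑ v, g v = Fintype.card V - Zr.card - Zs.card + ∑ v ∈ Zr, (deg (BareOut T) v : ℤ) := by
    simp only [g, Finset.sum_add_distrib, Finset.sum_sub_distrib]
    simp
  -- the pairs of deficient vertices in different components
  have cross : ∑ z ∈ Zr ∪ Zs, ((((Zr ∪ Zs).filter fun v => ¬ Conn T z v).card : ℕ) : ℤ) ≤
      ∑ z ∈ Zr, (deg (BareOut T) z : ℤ) + count (Loose T) := by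
    have closed : ∀ z ∈ Zr ∪ Zs, IsClosed T z := by
      intro z hz
      rcases Finset.mem_union.1 hz with hz | hz
      · exact (h.ring_weight (mr.1 hz)).1
      · exact (ms.1 hz).2.1
    have e : ∑ z ∈ Zr, (deg (BareOut T) z : ℤ) = ∑ z ∈ Zr ∪ Zs, (deg (BareOut T) z : ℤ) := by
      rw [Finset.sum_union hdisj, Finset.sum_eq_zero (s := Zs), add_zero]
      intro z hz
      rw [bs z hz]
      rfl
    have nn : ∀ z v w, (0 : ℤ) ≤ if Loose T z v w then 1 else 0 := fun z v w => by
      split_ifs <;> norm_num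
    have e2 : ∑ z ∈ Zr ∪ Zs, ∑ v, ∑ w, (if Loose T z v w then (1 : ℤ) else 0) ≤
        count (Loose T) :=
      Finset.sum_le_sum_of_subset_of_nonneg (Finset.subset_univ _) fun z _ _ =>
        Finset.sum_nonneg fun v _ => Finset.sum_nonneg fun w _ => nn z v w
    refine le_trans ?_ (add_le_add e.ge e2)
    rw [← Finset.sum_add_distrib]
    refine Finset.sum_le_sum fun z hz => ?_
    rw [deg_eq_sum, ← Finset.sum_add_distrib, Finset.card_eq_sum_ones]
    push_cast
    refine le_trans (Finset.sum_le_sum (g := fun v => (if BareOut T z v then (1 : ℤ) else 0) +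
      ∑ w, if Loose T z v w then 1 else 0) fun v hv => ?_)
      (Finset.sum_le_sum_of_subset_of_nonneg (Finset.subset_univ _) fun v _ _ =>
        add_nonneg (by split_ifs <;> norm_num) (Finset.sum_nonneg fun w _ => nn z v w))
    obtain ⟨hv, hzv⟩ := Finset.mem_filter.1 hv
    by_cases hb : BareOut T z v
    · rw [if_pos hb]
      have : (0 : ℤ) ≤ ∑ w, if Loose T z v w then 1 else 0 :=
        Finset.sum_nonneg fun w _ => nn z v w
      omega
    · have : ∃ w, T z v w := by
        by_contra hh
        push Not at hh
        exact hb ⟨⟨by rintro rfl; exact hzv (Conn.refl _), hh⟩, hzv⟩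
      obtain ⟨w, t⟩ := this
      have hl := h.loose_of_closed (closed z hz) (closed v hv) hzv t
      have := Finset.single_le_sum (f := fun w => if Loose T z v w then (1 : ℤ) else 0)
        (fun w _ => nn z v w) (Finset.mem_univ w)
      simp only [hl, if_true] at this
      rw [if_neg hb, zero_add]
      exact this
  have split : ∀ z, ((Zr ∪ Zs).filter fun v => Conn T z v).card +
      ((Zr ∪ Zs).filter fun v => ¬ Conn T z v).card = Zr.card + Zs.card := fun z => by
    rw [Finset.card_filter_add_card_filter_not, Finset.card_union_of_disjoint hdisj]
  -- a component contains at most five of the deficient vertices if it is a ring, and one if it is a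
  -- star
  have cr : ∀ z ∈ Zr, ((Zr.card : ℤ) + Zs.card - 5) ≤
      ((((Zr ∪ Zs).filter fun v => ¬ Conn T z v).card : ℕ) : ℤ) := by
    intro z hz
    have h5 := (h.ring_weight (mr.1 hz)).2.1
    have : ((Zr ∪ Zs).filter fun v => Conn T z v).card ≤ (comp T z).card :=
      Finset.card_le_card fun v hv => mem_nbrs.2 (Finset.mem_filter.1 hv).2
    have := split z
    omega
  have cs : ∀ z ∈ Zs, ((Zr.card : ℤ) + Zs.card - 1) ≤
      ((((Zr ∪ Zs).filter fun v => ¬ Conn T z v).card : ℕ) : ℤ) := by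
    intro z hz
    have : ((Zr ∪ Zs).filter fun v => Conn T z v).card ≤ 1 := by
      rw [← Finset.card_singleton z]
      refine Finset.card_le_card fun v hv => ?_
      obtain ⟨hv, hc⟩ := Finset.mem_filter.1 hv
      rw [Finset.mem_singleton]
      rcases Finset.mem_union.1 hv with hv | hv
      · exact absurd (mr.1 hv) (not_ring_of_centre h (ms.1 hz).1 hc)
      · rcases (conn_centre (ms.1 hz).1).1 hc with rfl | k
        · rfl
        · have := (ms.1 hv).2.2.1
          rw [h.deg_thick_leaf (ms.1 hz).1 k] at this
          exact absurd this (by decide)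
    have := split z
    omega
  have cross' := add_le_add (Finset.sum_le_sum cr) (Finset.sum_le_sum cs)
  rw [← Finset.sum_union hdisj] at cross'
  simp only [Finset.sum_const, nsmul_eq_mul] at cross'
  have hr5 : 0 < Zr.card → 5 ≤ Zr.card := by
    intro hp
    obtain ⟨z, hz⟩ := Finset.card_pos.1 hp
    have hw := h.ring_weight (mr.1 hz)
    rw [← hw.2.1]
    exact Finset.card_le_card fun v hv => mr.2 (hw.2.2.2 v hv)
  have hB : (0 : ℤ) ≤ ∑ z ∈ Zr, (deg (BareOut T) z : ℤ) :=
    Finset.sum_nonneg fun _ _ => by positivity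
  have hL := count_nonneg (T := Loose T)
  have hcount := h.count_eq
  have hcr := cross'.trans cross
  rw [hg] at h1 h2
  clear cross cross' split cr cs sum_le g_le
  have hs0 : (0 : ℤ) ≤ (Zs.card : ℤ) := by positivity
  have cases : Zr.card = 0 ∨ Zr.card = 5 ∨ 6 ≤ Zr.card := by omega
  have main : -15 ≤ (((Zr.card : ℤ) + Zs.card) ^ 2 - 8 * Zr.card - 4 * Zs.card) ∧
      ((((Zr.card : ℤ) + Zs.card) ^ 2 - 8 * Zr.card - 4 * Zs.card) ≤ -15 →
        Zr.card = 5 ∧ Zs.card = 0) := by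
    rcases cases with h0 | h0 | h0
    · rw [h0]
      push_cast
      constructor
      · nlinarith [sq_nonneg ((Zs.card : ℤ) - 2)]
      · intro hh
        nlinarith [sq_nonneg ((Zs.card : ℤ) - 2)]
    · rw [h0]
      push_cast
      constructor
      · nlinarith
      · intro hh
        refine ⟨trivial, ?_⟩
        have : (Zs.card : ℤ) ≤ 0 := by nlinarith
        omega
    · have h6 : (6 : ℤ) ≤ Zr.card := by exact_mod_cast h0
      have : -12 ≤ (((Zr.card : ℤ) + Zs.card) ^ 2 - 8 * Zr.card - 4 * Zs.card) := by nlinarith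
      exact ⟨by omega, fun hh => by omega⟩
  set n : ℤ := (Fintype.card V : ℤ)
  set B : ℤ := ∑ z ∈ Zr, (deg (BareOut T) z : ℤ)
  set a : ℤ := (Zr.card : ℤ)
  set b : ℤ := (Zs.card : ℤ)
  refine ⟨by nlinarith, fun heq => ?_⟩
  obtain ⟨r5, s0⟩ := main.2 (by nlinarith)
  have ha : a = 5 := congrArg Nat.cast r5
  have hb : b = 0 := congrArg Nat.cast s0
  rw [ha, hb] at h1 h2 hcr
  have hL0 : count (Loose T) = 0 := by nlinarith
  have hB0 : B = 0 := by nlinarith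
  have hcomp := h2 (by nlinarith)
  have ringOut : ∀ v ∈ Zr, deg (BareOut T) v = 0 := by
    intro v hv
    exact_mod_cast (Finset.sum_eq_zero_iff_of_nonneg fun _ _ => by positivity).1 hB0 v hv
  have sE : Zs = ∅ := Finset.card_eq_zero.1 s0
  have cases : ∀ r, (compOut T r = 0 ∧ (IsOddStar T r ∨ OnPath T r)) ∨ r ∈ Zr := by
    intro r
    rcases (key r).2 (hcomp r) with hh | hh | hh
    · exact Or.inl hh
    · exact Or.inr hh
    · exact absurd sE hh.ne_empty
  refine ⟨⟨eq_zero_of_count hL0, fun u v hb => ?_, fun r => ?_⟩, ?_⟩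
  · have hp := deg_pos hb
    have := deg_le_compOut (Conn.refl (T := T) u)
    rcases cases u with hh | hh
    · omega
    · have := ringOut u hh
      omega
  · rcases cases r with ⟨-, hh | hh⟩ | hh
    · exact Or.inl hh
    · exact Or.inr (Or.inl hh)
    · exact Or.inr (Or.inr (Or.inl (mr.1 hh)))
  · obtain ⟨z, hz⟩ := Finset.card_pos.1 (by omega : 0 < Zr.card)
    obtain ⟨p, q, c, d, r, -⟩ := mr.1 hz
    exact ⟨z, p, r.thick h⟩

end IsACFree

end

/-! ### Domination between components -/

section

variable {V : Type*} {T : V → V → V → Prop}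

/-- The vertex `u` dominates the vertex `v` of another component: some triple consists of `v` and a
thick pair at `u`. -/
def Dominates (T : V → V → V → Prop) (u v : V) : Prop :=
  ¬ Conn T u v ∧ ∃ w, Thick T u w ∧ T u w v

/-- The triples at `a` or `b` are all triples that contain both. -/
def IsTwoTop (T : V → V → V → Prop) (a b : V) : Prop :=
  a ≠ b ∧ (∀ v, v ≠ a → v ≠ b → T a b v) ∧ (∀ v w, T a v w → v = b ∨ w = b) ∧
    ∀ v w, T b v w → v = a ∨ w = a

/-- The triples at `a`, `b`, `c`, `d` are those added by a 4-extension with these vertices. -/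
def IsFourTop (T : V → V → V → Prop) (a b c d : V) : Prop :=
  T a b c ∧ T b c d ∧ ¬ T a b d ∧ ¬ T a c d ∧
  (∃ v, v ≠ a ∧ v ≠ b ∧ v ≠ c ∧ v ≠ d) ∧
  (∀ v, v ≠ a → v ≠ b → v ≠ c → v ≠ d → T a b v ∧ T c d v) ∧
  (∀ v w, T a v w → v = b ∨ w = b) ∧
  (∀ v w, T b v w → v = a ∨ w = a ∨ (v = c ∧ w = d) ∨ (v = d ∧ w = c)) ∧
  (∀ v w, T c v w → v = d ∨ w = d ∨ (v = a ∧ w = b) ∨ (v = b ∧ w = a)) ∧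
  ∀ v w, T d v w → v = c ∨ w = c

namespace IsACFree

/-- A pair of vertices in different components lies in at most one triple. -/
theorem third_unique {u v w w' : V} (huv : ¬ Conn T u v) (t : T u v w)
    (t' : T u v w') : w = w' := by
  by_contra hne
  exact huv (Conn.of_thick ⟨w, w', hne, t, t'⟩)

theorem dominates_asymm (h : IsACFree T) {u v : V} (h1 : Dominates T u v) :
    ¬ Dominates T v u := by
  rintro ⟨-, w', k', t'⟩
  obtain ⟨hc, w, k, t⟩ := h1
  obtain rfl := third_unique hc (h.swap' t) (h.rot' t')
  exact hc ((Conn.of_thick k).trans (Conn.of_thick (h.thick_symm k')))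

variable [Fintype V]

/-- Of two components, at least one of which contains a thick pair, one dominates the other. -/
theorem dominates_or (h : IsACFree T) (hT : IsTight T) {u v x : V} (huv : ¬ Conn T u v)
    (hx : Thick T u x) : Dominates T u v ∨ Dominates T v u := by
  have hb : ¬ BareOut T u v := fun hb => (hT.2.1 u v hb).1 x hx
  have : ∃ w, T u v w := by
    by_contra hh
    push Not at hh
    exact hb ⟨⟨by rintro rfl; exact huv (Conn.refl _), hh⟩, huv⟩
  obtain ⟨w, t⟩ := this
  by_cases k1 : Thick T v w
  · exact Or.inr ⟨fun hh => huv (Conn.symm h hh), w, k1, h.rot t⟩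
  by_cases k2 : Thick T w u
  · exact Or.inl ⟨huv, w, h.thick_symm k2, h.swap' t⟩
  exact absurd ⟨t, fun k => huv (Conn.of_thick k), k1, k2⟩ (hT.1 u v w)

/-- The vertices of a component dominate the same vertices. -/
theorem dominates_left (h : IsACFree T) (hT : IsTight T) {u u' v : V} (hu : Conn T u u')
    (h1 : Dominates T u v) : Dominates T u' v := by
  refine hu.induct (fun u' => Dominates T u' v) ?_ h1
  rintro a b ⟨hav, w, k, t⟩ kab
  have hbv : ¬ Conn T b v := fun hh => hav ((Conn.of_thick kab).trans hh)
  by_cases hbw : b = w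
  · subst hbw
    exact ⟨hbv, a, h.thick_symm kab, h.swap t⟩
  rcases h.dominates_or hT hbv (h.thick_symm kab) with hd | ⟨-, w', k', t'⟩
  · exact hd
  exfalso
  -- a triple `a b z` forms a copy of `A` with the triples `a v w` and `b v w'`
  obtain ⟨z, hz, tz⟩ := kab.exists_ne w
  refine h.not_A tz (h.swap' t) (h.rot' t') hz ?_ ?_ ?_ (Ne.symm hbw) ?_
  · rintro rfl
    have hav' : a ≠ v := fun e => hav (e ▸ Conn.refl a)
    exact hbv ((Conn.of_thick ⟨a, v, hav', h.rot tz, h.rev t'⟩).trans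
      (Conn.of_thick (h.thick_symm k')))
  · rintro rfl
    exact hav ((Conn.of_thick k).trans (Conn.of_thick (h.thick_symm k')))
  · rintro rfl
    exact hbw (third_unique hav (h.swap' tz) (h.swap' t))
  · rintro rfl
    exact hav (Conn.of_thick (h.thick_symm k'))

theorem dominates_trans (h : IsACFree T) (hT : IsTight T) {a b c : V} (h1 : Dominates T a b)
    (h2 : Dominates T b c) : Dominates T a c := by
  obtain ⟨hab, w, k, t⟩ := id h1
  obtain ⟨hbc, w', k', t'⟩ := id h2
  have hac : ¬ Conn T a c := fun hh => h.dominates_asymm h2 (h.dominates_left hT hh h1)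
  rcases h.dominates_or hT hac k with hd | ⟨-, w'', k'', t''⟩
  · exact hd
  exfalso
  -- the triples that witness a cyclic domination form a copy of `A`
  have ca := Conn.of_thick k
  have cb := Conn.of_thick k'
  have cc := Conn.of_thick k''
  refine h.not_A (h.swap' t) (h.rot' t'') (h.swap' t') ?_ ?_ ?_ ?_ ?_ ?_
  · rintro rfl
    exact hac (ca.trans (Conn.symm h cc))
  · rintro rfl
    exact hab (ca.trans (Conn.symm h cb))
  · rintro rfl
    exact hbc (cb.trans (Conn.symm h cc))
  · rintro rfl
    exact hac ca
  · rintro rfl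
    exact hbc (Conn.symm h cc)
  · rintro rfl
    exact hab (Conn.symm h cb)

open scoped Classical in
/-- Some component dominates all others: one that dominates as many vertices as possible. -/
theorem exists_top (h : IsACFree T) (hT : IsTight T) (hne : ∃ u v, Thick T u v) :
    ∃ u x, Thick T u x ∧ ∀ v, ¬ Conn T u v → Dominates T u v := by
  have : (Finset.univ.filter fun u => ∃ v, Thick T u v).Nonempty := by
    obtain ⟨u, v, k⟩ := hne
    exact ⟨u, by simpa using ⟨v, k⟩⟩
  obtain ⟨u, hu, hmax⟩ := Finset.exists_max_image _ (deg (Dominates T)) this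
  obtain ⟨x, hx⟩ := (Finset.mem_filter.1 hu).2
  refine ⟨u, x, hx, fun v hv => ?_⟩
  rcases h.dominates_or hT hv hx with hd | hd
  · exact hd
  exfalso
  obtain ⟨-, w, k, -⟩ := id hd
  have h1 := hmax v (by simpa using ⟨w, k⟩)
  have h2 : deg (Dominates T) u < deg (Dominates T) v := by
    refine Finset.card_lt_card (Finset.ssubset_iff_subset_ne.2 ⟨fun z hz => ?_, fun he => ?_⟩)
    · exact mem_nbrs.2 (h.dominates_trans hT hd (mem_nbrs.1 hz))
    · have : u ∈ nbrs (Dominates T) u := he ▸ mem_nbrs.2 hd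
      exact (mem_nbrs.1 this).1 (Conn.refl u)
  omega

open scoped Classical in
/-- The uniqueness part of Mantel's theorem for the bases of a star. A vertex `p` with as many bases
as possible determines one part, namely its neighbourhood. -/
theorem bipartite_of_star (h : IsACFree T) {x : V} (hx : IsCentre T x)
    (ho : Odd (deg (Thick T) x))
    (hs : 2 * ∑ p ∈ nbrs (Thick T) x, (deg (Base T) p : ℤ) + 1 = (deg (Thick T) x : ℤ) ^ 2) :
    ∃ P Q : Finset V, Disjoint P Q ∧ P ∪ Q = nbrs (Thick T) x ∧
      P.card = deg (Thick T) x / 2 ∧ Q.card = (deg (Thick T) x + 1) / 2 ∧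
      ∀ u v, T x u v ∧ Thick T x u ∧ Thick T x v ↔ (u ∈ P ∧ v ∈ Q) ∨ (u ∈ Q ∧ v ∈ P) := by
  set L := nbrs (Thick T) x with hL
  set t := deg (Thick T) x with ht
  have mL : ∀ {v}, v ∈ L ↔ Thick T x v := fun {v} => mem_nbrs
  have baseL : ∀ {u v}, u ∈ L → Base T u v → v ∈ L := fun hu b =>
    mL.2 (h.base_leaf hx (mL.1 hu) b).1
  have hLne : L.Nonempty := Finset.card_pos.1 ho.pos
  obtain ⟨p, hp, hmax⟩ := Finset.exists_max_image L (deg (Base T)) hLne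
  set A := nbrs (Base T) p with hA
  have hAL : A ⊆ L := fun v hv => baseL hp (mem_nbrs.1 hv)
  set B := L \ A with hB
  have hcard : B.card + A.card = t := Finset.card_sdiff_add_card_eq_card hAL
  have indep : ∀ {u v}, u ∈ A → Base T u v → v ∈ B := by
    intro u v hu b
    rw [hB, Finset.mem_sdiff]
    refine ⟨baseL (hAL hu) b, fun hv => ?_⟩
    exact h.not_C (h.rot (h.base_leaf hx (mL.1 hp) (mem_nbrs.1 hu)).2)
      (h.rot (h.base_leaf hx (mL.1 hp) (mem_nbrs.1 hv)).2)
      (h.rot (h.base_leaf hx (mL.1 (hAL hu)) b).2)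
  have e1 : ∑ v ∈ A, deg (Base T) v = ∑ w ∈ B, (A.filter fun v => Base T v w).card := by
    have := Finset.sum_card_bipartiteAbove_eq_sum_card_bipartiteBelow (s := A) (t := B) (Base T)
    simp only [Finset.bipartiteAbove, Finset.bipartiteBelow] at this
    rw [← this]
    refine Finset.sum_congr rfl fun v hv => ?_
    rw [deg]
    congr 1
    ext w
    rw [mem_nbrs, Finset.mem_filter]
    exact ⟨fun b => ⟨indep hv b, b⟩, fun b => b.2⟩
  have e2 : ∀ w ∈ B, (A.filter fun v => Base T v w).card ≤ A.card := fun w _ =>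
    Finset.card_filter_le _ _
  have e3 : ∀ w ∈ B, deg (Base T) w ≤ A.card := fun w hw =>
    hmax w (Finset.mem_sdiff.1 hw).1
  have e4 : ∑ v ∈ L, deg (Base T) v = ∑ v ∈ B, deg (Base T) v + ∑ v ∈ A, deg (Base T) v :=
    (Finset.sum_sdiff hAL).symm
  have s2 := Finset.sum_le_sum e2
  have s3 := Finset.sum_le_sum e3
  have hs' : 2 * ∑ p ∈ L, deg (Base T) p + 1 = t ^ 2 := by exact_mod_cast hs
  obtain ⟨m, hm⟩ := ho
  -- this uses that the sizes of the two sets have an odd sum, hence differ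
  have hmant : 4 * (B.card * A.card) + 1 ≤ t ^ 2 := by
    have hne : A.card ≠ B.card := by omega
    rw [← hcard]
    rcases Nat.lt_or_gt_of_ne hne with hlt | hlt
    · obtain ⟨k, hk⟩ := Nat.exists_eq_add_of_lt hlt
      rw [hk]
      nlinarith
    · obtain ⟨k, hk⟩ := Nat.exists_eq_add_of_lt hlt
      rw [hk]
      nlinarith
  simp only [Finset.sum_const, smul_eq_mul] at s2 s3
  -- equality holds everywhere
  have full : ∀ w ∈ B, (A.filter fun v => Base T v w).card = A.card := by
    refine (Finset.sum_eq_sum_iff_of_le e2).1 ?_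
    simp only [Finset.sum_const, smul_eq_mul]
    omega
  have full' : ∀ w ∈ B, ∀ v ∈ A, Base T v w := by
    intro w hw v hv
    have := Finset.eq_of_subset_of_card_le (Finset.filter_subset _ _) (full w hw).ge
    rw [← this] at hv
    exact (Finset.mem_filter.1 hv).2
  have onlyA : ∀ w ∈ B, ∀ v, Base T w v → v ∈ A := by
    intro w hw v b
    have hsub : A ⊆ nbrs (Base T) w := fun v hv => mem_nbrs.2 (h.base_symm (full' w hw v hv))
    have := Finset.eq_of_subset_of_card_le hsub (e3 w hw)
    rw [this]
    exact mem_nbrs.2 b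
  have iff : ∀ u v, T x u v ∧ Thick T x u ∧ Thick T x v ↔ (u ∈ A ∧ v ∈ B) ∨ (u ∈ B ∧ v ∈ A) := by
    intro u v
    constructor
    · rintro ⟨tt, k1, k2⟩
      have b : Base T u v := ⟨x, tt, k1, k2⟩
      by_cases hu : u ∈ A
      · exact Or.inl ⟨hu, indep hu b⟩
      · have hu' : u ∈ B := Finset.mem_sdiff.2 ⟨mL.2 k1, hu⟩
        exact Or.inr ⟨hu', onlyA u hu' v b⟩
    · rintro (⟨hu, hv⟩ | ⟨hu, hv⟩)
      · have := h.base_leaf hx (mL.1 (hAL hu)) (full' v hv u hu)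
        exact ⟨this.2, mL.1 (hAL hu), this.1⟩
      · have := h.base_leaf hx (mL.1 (hAL hv)) (full' u hu v hv)
        exact ⟨h.swap' this.2, this.1, mL.1 (hAL hv)⟩
  have hsq : 4 * (B.card * A.card) + 1 = t ^ 2 := by omega
  have hdiff : B.card = m ∧ A.card = m + 1 ∨ B.card = m + 1 ∧ A.card = m := by
    have hab : B.card + A.card = 2 * m + 1 := by omega
    have hsq' : B.card * A.card = m * m + m := by
      rw [hm] at hsq
      nlinarith
    have hz : ((B.card : ℤ) - m) * ((B.card : ℤ) - (m + 1)) = 0 := by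
      have h1 : (A.card : ℤ) = 2 * m + 1 - B.card := by omega
      have h2 : (B.card : ℤ) * A.card = m * m + m := by exact_mod_cast hsq'
      rw [h1] at h2
      linarith
    rcases mul_eq_zero.1 hz with hh | hh
    · left; omega
    · right; omega
  have hunion : B ∪ A = L := Finset.sdiff_union_of_subset hAL
  rcases hdiff with ⟨h1, h2⟩ | ⟨h1, h2⟩
  · refine ⟨B, A, Finset.sdiff_disjoint, hunion, by omega, by omega, fun u v => ?_⟩
    rw [iff]
    tauto
  · refine ⟨A, B, Finset.disjoint_sdiff, by rw [Finset.union_comm, hunion], by omega, by omega,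
      fun u v => iff u v⟩

end IsACFree

end

/-! ### The structure of tight systems -/

section

variable {V : Type*} {T : V → V → V → Prop}

/-- All triples consist of `x` and an edge of the complete bipartite graph with parts `P` and `Q` on
the other vertices. -/
def IsStar (T : V → V → V → Prop) (x : V) (P Q : Finset V) : Prop :=
  Disjoint P Q ∧ (∀ v, v ∈ P ∨ v ∈ Q ↔ v ≠ x) ∧ (∀ u v w, T u v w → u = x ∨ v = x ∨ w = x) ∧
    ∀ u v, T x u v ↔ (u ∈ P ∧ v ∈ Q) ∨ (u ∈ Q ∧ v ∈ P)

namespace IsPath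

variable {a b c d : V}

theorem reverse (h : IsACFree T) (p : IsPath T a b c d) : IsPath T d c b a := by
  obtain ⟨t1, t2, k1, k2, k3, n1, n2, n3, n4⟩ := p
  exact ⟨h.rev t2, h.rev t1, h.thick_symm k3, h.thick_symm k2, h.thick_symm k1, n4,
    fun v k => (n3 v k).symm, fun v k => (n2 v k).symm, n1⟩

theorem distinct (h : IsACFree T) (p : IsPath T a b c d) :
    a ≠ b ∧ a ≠ c ∧ a ≠ d ∧ b ≠ c ∧ b ≠ d ∧ c ≠ d := by
  obtain ⟨t1, t2, k1, k2, k3, n1, n2, n3, n4⟩ := p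
  have h1 := h.nes t1
  have h2 := h.nes t2
  refine ⟨h1.1, h1.2.1, ?_, h1.2.2, h2.2.1, h2.2.2⟩
  rintro rfl
  exact h1.2.2 (n4 _ k1)

theorem conn_iff (p : IsPath T a b c d) {v : V} :
    Conn T a v ↔ v = a ∨ v = b ∨ v = c ∨ v = d := by
  obtain ⟨t1, t2, k1, k2, k3, n1, n2, n3, n4⟩ := p
  constructor
  · intro hv
    refine hv.induct (fun v => v = a ∨ v = b ∨ v = c ∨ v = d) ?_ (Or.inl rfl)
    rintro x y (rfl | rfl | rfl | rfl) k
    · exact Or.inr (Or.inl (n1 y k))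
    · rcases n2 y k with rfl | rfl <;> simp
    · rcases n3 y k with rfl | rfl <;> simp
    · exact Or.inr (Or.inr (Or.inl (n4 y k)))
  · rintro (rfl | rfl | rfl | rfl)
    · exact Conn.refl _
    · exact Conn.of_thick k1
    · exact (Conn.of_thick k1).trans (Conn.of_thick k2)
    · exact ((Conn.of_thick k1).trans (Conn.of_thick k2)).trans (Conn.of_thick k3)

/-- The base `b d` has the apex `c`, so no other triple contains it. -/
theorem not_left (h : IsACFree T) (p : IsPath T a b c d) : ¬ T a b d := fun t =>
  (p.distinct h).2.1 (h.apex_unique (h.thick_symm p.2.2.2.1) p.2.2.2.2.1 (h.rot t))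

/-- The triples at the first vertex of a path component that dominates all other vertices. -/
theorem triple_left (h : IsACFree T) (p : IsPath T a b c d)
    (hd : ∀ v, ¬ Conn T a v → T a b v) {v w : V} (t : T a v w) : v = b ∨ w = b := by
  have hp := p.distinct h
  by_cases hv : Conn T a v
  · by_cases hw : Conn T a w
    · rcases (p.conn_iff).1 hv with rfl | rfl | rfl | rfl
      · exact absurd rfl (h.ne t)
      · exact Or.inl rfl
      · exact Or.inr (h.apex_unique (h.thick_symm p.2.2.1) p.2.2.2.1 t)
      · rcases (p.conn_iff).1 hw with rfl | rfl | rfl | rfl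
        · exact absurd rfl (h.nes t).2.1
        · exact Or.inr rfl
        · exact Or.inr (absurd (h.apex_unique (h.thick_symm p.2.2.1) p.2.2.2.1 (h.swap' t))
            hp.2.2.2.2.1.symm)
        · exact absurd rfl (h.nes t).2.2
    · exact Or.inl (IsACFree.third_unique hw (h.swap' t) (h.swap' (hd w hw)))
  · exact Or.inr (IsACFree.third_unique hv t (h.swap' (hd v hv)))

/-- The triples at the second vertex of a path component that dominates all other vertices. -/
theorem triple_right (h : IsACFree T) (p : IsPath T a b c d)
    (hd : ∀ v, ¬ Conn T a v → T a b v) {v w : V} (t : T b v w) :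
    v = a ∨ w = a ∨ (v = c ∧ w = d) ∨ (v = d ∧ w = c) := by
  have hab : Conn T a b := Conn.of_thick p.2.2.1
  by_cases hv : Conn T a v
  · by_cases hw : Conn T a w
    · have ht := h.nes t
      rcases (p.conn_iff).1 hv with rfl | rfl | rfl | rfl <;>
      rcases (p.conn_iff).1 hw with rfl | rfl | rfl | rfl <;> tauto
    · exact Or.inl (IsACFree.third_unique (fun k => hw (hab.trans k)) (h.swap' t) (h.rot (hd w hw)))
  · exact Or.inr (Or.inl (IsACFree.third_unique (fun k => hv (hab.trans k)) t (h.rot (hd v hv))))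

end IsPath

namespace IsACFree

/-- A dominating path component gives a 4-extension. -/
theorem fourTop_of_path (h : IsACFree T) {a b c d v₀ : V} (p : IsPath T a b c d)
    (h0 : ¬ Conn T a v₀) (hd : ∀ u v, Conn T a u → ¬ Conn T a v → Dominates T u v) :
    IsFourTop T a b c d := by
  have cad : Conn T a d := (p.conn_iff).2 (by simp)
  have p' := p.reverse h
  have e1 : ∀ v, ¬ Conn T a v → T a b v := by
    intro v hv
    obtain ⟨-, w, k, t⟩ := hd a v (Conn.refl a) hv
    obtain rfl := p.2.2.2.2.2.1 w k
    exact t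
  have e2 : ∀ v, ¬ Conn T d v → T d c v := by
    intro v hv
    obtain ⟨-, w, k, t⟩ := hd d v cad fun hh => hv ((Conn.symm h cad).trans hh)
    obtain rfl := p'.2.2.2.2.2.1 w k
    exact t
  have out : ∀ v, v ≠ a → v ≠ b → v ≠ c → v ≠ d → ¬ Conn T a v := by
    intro v n1 n2 n3 n4 hc
    rcases (p.conn_iff).1 hc with hh | hh | hh | hh <;> contradiction
  refine ⟨p.1, p.2.1, p.not_left h, fun t => p'.not_left h (h.rev t), ⟨v₀, ?_⟩, ?_,
    fun v w t => p.triple_left h e1 t, fun v w t => p.triple_right h e1 t, ?_,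
    fun v w t => p'.triple_left h e2 t⟩
  · have := mt (p.conn_iff).2 h0
    tauto
  · intro v n1 n2 n3 n4
    have hc := out v n1 n2 n3 n4
    exact ⟨e1 v hc, h.swap (e2 v fun hh => hc (cad.trans hh))⟩
  · intro v w t
    have := p'.triple_right h e2 t
    tauto

variable [Fintype V]

/-- A star component that dominates a vertex `v₀` is a single thick pair: each leaf forms a triple
with the centre and `v₀`, but only one triple contains the centre and `v₀`. -/
theorem twoTop_of_star (h : IsACFree T) {x v₀ : V} (hx : IsCentre T x)
    (ho : 0 < deg (Thick T) x) (h0 : ¬ Conn T x v₀)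
    (hd : ∀ u v, Conn T x u → ¬ Conn T x v → Dominates T u v) : ∃ p, IsTwoTop T x p := by
  obtain ⟨p, hp⟩ := exists_of_deg_pos ho
  have leaf : ∀ q, Thick T x q → ∀ v, ¬ Conn T x v → T x q v := by
    intro q hq v hv
    obtain ⟨-, w, k, t⟩ := hd q v (Conn.of_thick hq) hv
    obtain rfl := hx q hq w k
    exact h.swap t
  have uniq : ∀ q, Thick T x q → q = p := fun q hq =>
    IsACFree.third_unique h0 (h.swap' (leaf q hq _ h0)) (h.swap' (leaf p hp _ h0))
  have out : ∀ v, v ≠ x → v ≠ p → ¬ Conn T x v := by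
    intro v h1 h2 hc
    rcases (conn_centre hx).1 hc with hh | hh
    · exact h1 hh
    · exact h2 (uniq v hh)
  refine ⟨p, h.thick_ne hp, fun v h1 h2 => leaf p hp v (out v h1 h2), fun v w t => ?_,
    fun v w t => ?_⟩
  · by_cases hv : v = p
    · exact Or.inl hv
    · have hc := out v (h.ne t).symm hv
      exact Or.inr (IsACFree.third_unique hc t (h.swap' (leaf p hp v hc)))
  · by_cases hv : v = x
    · exact Or.inl hv
    · have hc := out v hv (h.ne t).symm
      exact Or.inr (IsACFree.third_unique (fun k => hc ((Conn.of_thick hp).trans k)) t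
        (h.rot (leaf p hp v hc)))

open scoped Classical in
/-- A tight system is a 2-extension, a 4-extension, a star or a five-ring. -/
theorem structure_of_tight (h : IsACFree T) (hT : IsTight T) (hne : ∃ u v, Thick T u v) :
    (∃ a b, IsTwoTop T a b) ∨ (∃ a b c d, IsFourTop T a b c d) ∨
    (∃ x P Q, IsStar T x P Q ∧ P.card = (Fintype.card V - 1) / 2 ∧
      Q.card = Fintype.card V / 2 ∧ Even (Fintype.card V)) ∨
    ∃ a b c d e, Ring T a b c d e ∧ ∀ v, v ∈ ({a, b, c, d, e} : Set V) := by
  obtain ⟨u, y, hy, hu⟩ := h.exists_top hT hne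
  by_cases hall : ∃ v₀, ¬ Conn T u v₀
  · obtain ⟨v₀, h0⟩ := hall
    have hd : ∀ r, Conn T u r → ¬ Conn T r v₀ ∧
        ∀ u' v, Conn T r u' → ¬ Conn T r v → Dominates T u' v := by
      intro r hr
      refine ⟨fun k => h0 (hr.trans k), fun u' v k1 k2 => ?_⟩
      exact h.dominates_left hT (hr.trans k1)
        (hu v fun k => k2 ((Conn.symm h hr).trans k))
    rcases hT.2.2 u with ⟨x, hc, hx, ho, -⟩ | ⟨a, b, c, d, hc, p⟩ | hr | hs
    · obtain ⟨p, hp⟩ := h.twoTop_of_star hx ho.pos (hd x hc).1 (hd x hc).2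
      exact Or.inl ⟨x, p, hp⟩
    · exact Or.inr (Or.inl ⟨a, b, c, d, h.fourTop_of_path p (hd a hc).1 (hd a hc).2⟩)
    · obtain ⟨-, w, k, t⟩ := hu v₀ h0
      exact absurd ((h.ring_weight hr).1 u v₀ w (Conn.refl u) (Conn.of_thick k) t) h0
    · exact absurd hy (hs y)
  · push Not at hall
    rcases hT.2.2 u with ⟨x, hc, hx, ho, hs⟩ | ⟨a, b, c, d, hc, p⟩ | ⟨b, c, d, e, r, hr⟩ | hs
    · right; right; left
      obtain ⟨P, Q, h1, h2, h3, h4, h5⟩ := h.bipartite_of_star hx ho hs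
      have conn : ∀ v, Conn T x v := fun v => (Conn.symm h hc).trans (hall v)
      have leaf : ∀ v, v ≠ x → Thick T x v := fun v hv =>
        ((conn_centre hx).1 (conn v)).resolve_left hv
      have hcard : deg (Thick T) x + 1 = Fintype.card V := by
        rw [← h.card_comp_centre hx, ← Finset.card_univ]
        congr 1
        ext v
        simpa using conn v
      refine ⟨x, P, Q, ⟨h1, fun v => ?_, fun u v w t => ?_, fun u v => ?_⟩, ?_, ?_,
        hcard ▸ ho.add_one⟩
      · rw [← Finset.mem_union, h2, mem_nbrs]
        exact ⟨fun k => (h.thick_ne k).symm, leaf v⟩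
      · by_contra hcon
        push Not at hcon
        exact hcon.2.2 (h.apex_unique (leaf u hcon.1) (leaf v hcon.2.1) t)
      · rw [← h5]
        exact ⟨fun t => ⟨t, leaf u (h.nes t).1.symm, leaf v (h.nes t).2.1.symm⟩, fun k => k.1⟩
      · rw [h3]; omega
      · rw [h4]; omega
    -- a path that contains all vertices has no second triple with its first pair
    · exfalso
      obtain ⟨z, hz, tz⟩ := p.2.2.1.exists_ne c
      have hn := h.nes tz
      rcases (p.conn_iff).1 ((Conn.symm h hc).trans (hall z)) with rfl | rfl | rfl | rfl
      · exact hn.2.1 rfl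
      · exact hn.2.2 rfl
      · exact hz rfl
      · exact p.not_left h tz
    · right; right; right
      exact ⟨u, b, c, d, e, r, fun v => (hall v).induct _ (fun x y hx k => hr x hx y k) (by simp)⟩
    · exact absurd hy (hs y)

end IsACFree

end

/-! ### Triple systems as relations -/

section

variable {α : Type*} [DecidableEq α]

/-- The ternary relation that describes the triples of `F`. -/
def Tri (F : TripleSystem α) (u v w : α) : Prop := {u, v, w} ∈ F.edges

section Tri

variable {F : TripleSystem α} {u v w : α}

theorem Tri.rot (t : F.Tri u v w) : F.Tri v w u := by
  have : ({v, w, u} : Finset α) = {u, v, w} := by grind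
  rw [Tri, this]
  exact t

theorem Tri.swap (t : F.Tri u v w) : F.Tri v u w := by
  have : ({v, u, w} : Finset α) = {u, v, w} := by grind
  rw [Tri, this]
  exact t

theorem Tri.ne (t : F.Tri u v w) : u ≠ v := by
  have := (Finset.mem_powersetCard.1 (F.edges_subset t)).2
  rintro rfl
  rw [Finset.insert_idem] at this
  exact absurd (Finset.card_le_two (a := u) (b := w)) (by omega)

theorem Tri.mem (t : F.Tri u v w) : u ∈ F.verts :=
  (Finset.mem_powersetCard.1 (F.edges_subset t)).1 (by simp)

theorem exists_tri {e : Finset α} (he : e ∈ F.edges) : ∃ u v w, e = {u, v, w} ∧ F.Tri u v w := by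
  obtain ⟨u, v, w, -, -, -, rfl⟩ :=
    Finset.card_eq_three.1 (Finset.mem_powersetCard.1 (F.edges_subset he)).2
  exact ⟨u, v, w, rfl, he⟩

/-- Every triple through `u` can be written with `u` in front. -/
theorem exists_tri_of_mem {e : Finset α} (he : e ∈ F.edges) (hu : u ∈ e) :
    ∃ v w, e = {u, v, w} ∧ F.Tri u v w := by
  obtain ⟨a, b, c, rfl, t⟩ := exists_tri he
  simp only [Finset.mem_insert, Finset.mem_singleton] at hu
  rcases hu with rfl | rfl | rfl
  · exact ⟨_, _, rfl, t⟩
  · exact ⟨_, _, by grind, t.rot⟩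
  · exact ⟨_, _, by grind, t.rot.rot⟩

end Tri

/-- The conditions of `IsACFree` on the triples say exactly that there is no copy of `A` or `C`. -/
theorem isFree_iff {F : TripleSystem α} : F.IsFree {configA, configC} ↔ IsACFree F.Tri := by
  constructor
  · intro hF
    have hA := hF configA (by simp)
    have hC := hF configC (by simp)
    refine ⟨Tri.rot, Tri.swap, Tri.ne, fun {a b c d} t1 t2 t3 => hC ?_,
      fun {a b c d e f} t1 t2 t3 n1 n2 n3 n4 n5 n6 => hA ?_⟩
    · have := t1.ne
      have := t1.rot.ne
      have := t1.rot.rot.ne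
      have := t2.ne
      have := t2.rot.ne
      have := t3.ne
      have := t1.mem
      have := t1.rot.mem
      have := t1.rot.rot.mem
      have := t2.rot.mem
      refine ⟨fun i => if i = 1 then a else if i = 2 then b else if i = 3 then c else d,
        ?_, ?_, ?_⟩
      · intro i hi j hj
        simp only [configC, Finset.coe_insert, Finset.coe_singleton, Set.mem_insert_iff,
          Set.mem_singleton_iff] at hi hj
        rcases hi with rfl | rfl | rfl | rfl <;> rcases hj with rfl | rfl | rfl | rfl <;>
          simp <;> grind
      · intro i hi
        simp only [configC, Finset.coe_insert, Finset.coe_singleton, Set.mem_insert_iff,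
          Set.mem_singleton_iff] at hi
        rcases hi with rfl | rfl | rfl | rfl <;> simpa
      · intro e he
        simp only [configC, Finset.mem_insert, Finset.mem_singleton] at he
        rcases he with rfl | rfl | rfl <;> simpa [Finset.image_insert]
    · have := t1.ne
      have := t1.rot.ne
      have := t1.rot.rot.ne
      have := t2.ne
      have := t2.rot.ne
      have := t2.rot.rot.ne
      have := t3.ne
      have := t3.rot.ne
      have := t3.rot.rot.ne
      have := t1.mem
      have := t1.rot.mem
      have := t1.rot.rot.mem
      have := t2.rot.mem
      have := t2.rot.rot.mem
      have := t3.rot.rot.mem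
      refine ⟨fun i => if i = 1 then a else if i = 2 then b else if i = 3 then c else
        if i = 4 then d else if i = 5 then e else f, ?_, ?_, ?_⟩
      · intro i hi j hj
        simp only [configA, Finset.coe_insert, Finset.coe_singleton, Set.mem_insert_iff,
          Set.mem_singleton_iff] at hi hj
        rcases hi with rfl | rfl | rfl | rfl | rfl | rfl <;>
          rcases hj with rfl | rfl | rfl | rfl | rfl | rfl <;> simp <;> grind
      · intro i hi
        simp only [configA, Finset.coe_insert, Finset.coe_singleton, Set.mem_insert_iff,
          Set.mem_singleton_iff] at hi
        rcases hi with rfl | rfl | rfl | rfl | rfl | rfl <;> simpa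
      · intro e he
        simp only [configA, Finset.mem_insert, Finset.mem_singleton] at he
        rcases he with rfl | rfl | rfl <;> simpa [Finset.image_insert]
  · rintro h H (rfl | rfl) ⟨φ, hi, -, he⟩
    · have inj : ∀ i ∈ configA.verts, ∀ j ∈ configA.verts, i ≠ j → φ i ≠ φ j :=
        fun i h1 j h2 h3 h4 => h3 (hi h1 h2 h4)
      refine h.not_A (a := φ 1) (b := φ 2) (c := φ 3) (d := φ 4) (e := φ 5) (f := φ 6)
        (by simpa [Tri, Finset.image_insert] using he {1, 2, 4} (by simp [configA]))
        (by simpa [Tri, Finset.image_insert] using he {1, 3, 5} (by simp [configA]))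
        (by simpa [Tri, Finset.image_insert] using he {2, 3, 6} (by simp [configA]))
        ?_ ?_ ?_ ?_ ?_ ?_ <;> exact inj _ (by simp [configA]) _ (by simp [configA]) (by norm_num)
    · exact h.not_C (a := φ 1) (b := φ 2) (c := φ 3) (d := φ 4)
        (by simpa [Tri, Finset.image_insert] using he {1, 2, 4} (by simp [configC]))
        (by simpa [Tri, Finset.image_insert] using he {1, 3, 4} (by simp [configC]))
        (by simpa [Tri, Finset.image_insert] using he {2, 3, 4} (by simp [configC]))

theorem IsACFree.comap {U V : Type*} {T : V → V → V → Prop} (h : IsACFree T) {f : U → V}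
    (hf : f.Injective) : IsACFree fun u v w => T (f u) (f v) (f w) where
  rot := h.rot
  swap := h.swap
  ne t e := h.ne t (congrArg f e)
  not_C := h.not_C
  not_A t1 t2 t3 n1 n2 n3 n4 n5 n6 := h.not_A t1 t2 t3 (hf.ne n1) (hf.ne n2) (hf.ne n3) (hf.ne n4)
    (hf.ne n5) (hf.ne n6)

/-- The triples of `F` as a relation on its vertices. -/
def subTri (F : TripleSystem α) (u v w : F.verts) : Prop := F.Tri u v w

theorem subTri_free {F : TripleSystem α} (h : IsACFree F.Tri) : IsACFree F.subTri :=
  h.comap Subtype.val_injective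

theorem card_orderings {x y z : α} (hxy : x ≠ y) (hxz : x ≠ z) (hyz : y ≠ z) (S : Finset α)
    (hx : x ∈ S) (hy : y ∈ S) (hz : z ∈ S) :
    ((S ×ˢ S ×ˢ S).filter fun p => ({p.1, p.2.1, p.2.2} : Finset α) = {x, y, z}).card = 6 := by
  have : ((S ×ˢ S ×ˢ S).filter fun p => ({p.1, p.2.1, p.2.2} : Finset α) = {x, y, z}) =
      {(x, y, z), (x, z, y), (y, x, z), (y, z, x), (z, x, y), (z, y, x)} := by
    ext ⟨u, v, w⟩
    simp only [Finset.mem_filter, Finset.mem_product, Finset.mem_insert, Finset.mem_singleton,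
      Prod.mk.injEq]
    constructor
    · rintro ⟨-, he⟩
      have e1 : ∀ t, t ∈ ({u, v, w} : Finset α) ↔ t ∈ ({x, y, z} : Finset α) := by rw [he]; simp
      simp only [Finset.mem_insert, Finset.mem_singleton] at e1
      have := e1 x
      have := e1 y
      have := e1 z
      have := e1 u
      have := e1 v
      have := e1 w
      grind
    · rintro (⟨rfl, rfl, rfl⟩ | ⟨rfl, rfl, rfl⟩ | ⟨rfl, rfl, rfl⟩ | ⟨rfl, rfl, rfl⟩ |
        ⟨rfl, rfl, rfl⟩ | ⟨rfl, rfl, rfl⟩) <;>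
      refine ⟨⟨by assumption, by assumption, by assumption⟩, by grind⟩
  rw [this]
  simp [Finset.card_insert_of_notMem, hxy, hxz, hyz, hxy.symm, hxz.symm, hyz.symm]

/-- Each triple has six orderings. -/
theorem count_eq_card (F : TripleSystem α) : count F.subTri = 6 * F.edges.card := by
  classical
  have h1 : count F.subTri = ∑ u ∈ F.verts, ∑ v ∈ F.verts, ∑ w ∈ F.verts,
      if F.Tri u v w then (1 : ℤ) else 0 := by
    rw [count, ← Finset.sum_coe_sort F.verts]
    refine Finset.sum_congr rfl fun u _ => ?_
    rw [← Finset.sum_coe_sort F.verts]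
    refine Finset.sum_congr rfl fun v _ => ?_
    rw [← Finset.sum_coe_sort F.verts]
    exact Finset.sum_congr rfl fun w _ => if_congr Iff.rfl rfl rfl
  have h2 : (∑ u ∈ F.verts, ∑ v ∈ F.verts, ∑ w ∈ F.verts, if F.Tri u v w then (1 : ℤ) else 0) =
      ((F.verts ×ˢ F.verts ×ˢ F.verts).filter fun p => F.Tri p.1 p.2.1 p.2.2).card := by
    rw [Finset.card_filter]
    push_cast
    rw [Finset.sum_product]
    refine Finset.sum_congr rfl fun u _ => ?_
    rw [Finset.sum_product]
  have h3 : ((F.verts ×ˢ F.verts ×ˢ F.verts).filter fun p => F.Tri p.1 p.2.1 p.2.2).card =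
      F.edges.card * 6 := by
    have hmaps : Set.MapsTo (fun p : α × α × α => ({p.1, p.2.1, p.2.2} : Finset α))
        (((F.verts ×ˢ F.verts ×ˢ F.verts).filter fun p => F.Tri p.1 p.2.1 p.2.2 :
          Finset (α × α × α)) : Set (α × α × α)) (F.edges : Set (Finset α)) :=
      fun p hp => (Finset.mem_filter.1 hp).2
    rw [Finset.card_eq_sum_card_fiberwise hmaps]
    refine Finset.sum_const_nat fun e he => ?_
    obtain ⟨x, y, z, rfl, t⟩ := exists_tri he
    rw [← card_orderings t.ne t.rot.rot.ne.symm t.rot.ne F.verts t.mem t.rot.mem t.rot.rot.mem,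
      Finset.filter_filter]
    congr 1
    refine Finset.filter_congr fun p _ => ⟨fun hp => hp.2, fun hp => ⟨?_, hp⟩⟩
    rw [Tri, hp]
    exact he
  rw [h1, h2, h3]
  push_cast
  ring

end

/-! ### Extensions of relations without the forbidden configurations -/

section

variable {V : Type*} {S T : V → V → V → Prop} {a b c d : V}

/-- The triples `p q x`, `p r y`, `q r z` form a copy of the configuration `A`. -/
def IsA (T : V → V → V → Prop) (p q r x y z : V) : Prop :=
  T p q x ∧ T p r y ∧ T q r z ∧ x ≠ y ∧ x ≠ z ∧ y ≠ z ∧ x ≠ r ∧ y ≠ q ∧ z ≠ p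

/-- If no copy of a forbidden configuration meets `N`, then only the triples outside `N` matter. By
symmetry, it suffices to consider two vertices of each configuration. -/
theorem IsACFree.of_outside (hS : IsACFree S) (N : Set V) (rot : ∀ {u v w}, T u v w → T v w u)
    (swap : ∀ {u v w}, T u v w → T v u w) (ne : ∀ {u v w}, T u v w → u ≠ v)
    (hT : ∀ u v w, T u v w → u ∉ N → v ∉ N → w ∉ N → S u v w)
    (hC1 : ∀ p ∈ N, ∀ q r s, T p q s → T p r s → ¬ T q r s)
    (hC2 : ∀ s ∈ N, ∀ p q r, T p q s → T p r s → ¬ T q r s)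
    (hA1 : ∀ p ∈ N, ∀ q r x y z, ¬ IsA T p q r x y z)
    (hA2 : ∀ x ∈ N, ∀ p q r y z, ¬ IsA T p q r x y z) : IsACFree T := by
  have rev : ∀ {u v w}, T u v w → T w v u := fun t => swap (rot t)
  refine ⟨rot, swap, ne, fun {p q r s} t1 t2 t3 => ?_,
    fun {p q r x y z} t1 t2 t3 n1 n2 n3 n4 n5 n6 => ?_⟩
  · have hp : p ∉ N := fun hp => hC1 p hp q r s t1 t2 t3
    have hq : q ∉ N := fun hq => hC1 q hq p r s (swap t1) t3 t2
    have hr : r ∉ N := fun hr => hC1 r hr p q s (swap t2) (swap t3) t1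
    have hs : s ∉ N := fun hs => hC2 s hs p q r t1 t2 t3
    exact hS.not_C (hT _ _ _ t1 hp hq hs) (hT _ _ _ t2 hp hr hs) (hT _ _ _ t3 hq hr hs)
  · have e1 : IsA T p q r x y z := ⟨t1, t2, t3, n1, n2, n3, n4, n5, n6⟩
    have e2 : IsA T q p r x z y := ⟨swap t1, t3, t2, n2, n1, n3.symm, n4, n6, n5⟩
    have e3 : IsA T r p q y z x := ⟨swap t2, swap t3, t1, n3, n1.symm, n2.symm, n5, n6, n4⟩
    have e4 : IsA T p r q y x z := ⟨t2, t1, swap t3, n1.symm, n3, n2, n5, n4, n6⟩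
    have e5 : IsA T q r p z x y := ⟨t3, swap t1, swap t2, n2.symm, n3.symm, n1, n6, n4, n5⟩
    have hp : p ∉ N := fun hp => hA1 p hp _ _ _ _ _ e1
    have hq : q ∉ N := fun hq => hA1 q hq _ _ _ _ _ e2
    have hr : r ∉ N := fun hr => hA1 r hr _ _ _ _ _ e3
    have hx : x ∉ N := fun hx => hA2 x hx _ _ _ _ _ e1
    have hy : y ∉ N := fun hy => hA2 y hy _ _ _ _ _ e4
    have hz : z ∉ N := fun hz => hA2 z hz _ _ _ _ _ e5
    exact hS.not_A (hT _ _ _ t1 hp hq hx) (hT _ _ _ t2 hp hr hy) (hT _ _ _ t3 hq hr hz)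
      n1 n2 n3 n4 n5 n6

/-- A relation that behaves as the triples of a 2-extension at the new vertices `a` and `b` is
`AC`-free if its restriction to the other vertices is. A triple that contains one of `a`, `b`
contains both, but no pair of vertices of the forbidden configurations has this property. -/
theorem IsACFree.of_two (hS : IsACFree S) (rot : ∀ {u v w}, T u v w → T v w u)
    (swap : ∀ {u v w}, T u v w → T v u w) (ne : ∀ {u v w}, T u v w → u ≠ v)
    (ha : ∀ v w, T a v w → v = b ∨ w = b) (hb : ∀ v w, T b v w → v = a ∨ w = a)
    (hT : ∀ u v w, T u v w → u ∉ ({a, b} : Set V) → v ∉ ({a, b} : Set V) →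
      w ∉ ({a, b} : Set V) → S u v w) :
    IsACFree T := by
  have key : ∀ x ∈ ({a, b} : Set V), ∃ y ∈ ({a, b} : Set V), (∀ v w, T x v w → v = y ∨ w = y) ∧
      (∀ v w, T y v w → v = x ∨ w = x) := by
    rintro x (rfl | rfl)
    · exact ⟨b, by simp, ha, hb⟩
    · exact ⟨a, by simp, hb, ha⟩
  have rotl : ∀ {u v w}, T u v w → T w u v := fun t => rot (rot t)
  refine hS.of_outside {a, b} rot swap ne hT ?_ ?_ ?_ ?_
  · intro p hp q r s t1 t2 t3
    obtain ⟨p', -, h1, h2⟩ := key p hp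
    have := ne t1
    have := ne (rotl t1)
    have := ne (rot t1)
    have := ne t2
    have := ne t3
    grind
  · intro s hs p q r t1 t2 t3
    obtain ⟨s', -, h1, h2⟩ := key s hs
    have := ne t1
    have := ne t2
    have := ne t3
    have := h1 _ _ (rotl t1)
    have := h1 _ _ (rotl t2)
    have := h1 _ _ (rotl t3)
    grind
  · rintro p hp q r x y z ⟨t1, t2, t3, n1, n2, n3, n4, n5, n6⟩
    obtain ⟨p', -, h1, h2⟩ := key p hp
    have := ne t3
    have := h1 _ _ t1
    have := h1 _ _ t2
    grind
  · rintro x hx p q r y z ⟨t1, t2, t3, n1, n2, n3, n4, n5, n6⟩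
    obtain ⟨x', -, h1, h2⟩ := key x hx
    have := ne (rotl t1)
    have := ne (rot t1)
    rcases h1 _ _ (rotl t1) with rfl | rfl
    · have := h2 _ _ t2
      grind
    · have := h2 _ _ t3
      grind

/-- A relation that behaves as the triples of a 4-extension at the new vertices `a`, `b`, `c`, `d`
is `AC`-free if its restriction to the other vertices is. -/
theorem IsACFree.of_four (hS : IsACFree S) (rot : ∀ {u v w}, T u v w → T v w u)
    (swap : ∀ {u v w}, T u v w → T v u w) (ne : ∀ {u v w}, T u v w → u ≠ v)
    (habd : ¬ T a b d) (hacd : ¬ T a c d)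
    (ha : ∀ v w, T a v w → v = b ∨ w = b)
    (hb : ∀ v w, T b v w → v = a ∨ w = a ∨ (v = c ∧ w = d) ∨ (v = d ∧ w = c))
    (hc : ∀ v w, T c v w → v = d ∨ w = d ∨ (v = a ∧ w = b) ∨ (v = b ∧ w = a))
    (hd : ∀ v w, T d v w → v = c ∨ w = c)
    (hT : ∀ u v w, T u v w → u ∉ ({a, b, c, d} : Set V) → v ∉ ({a, b, c, d} : Set V) →
      w ∉ ({a, b, c, d} : Set V) → S u v w) :
    IsACFree T := by
  have rotl : ∀ {u v w}, T u v w → T w u v := fun t => rot (rot t)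
  -- the symmetry that reverses `a b c d` reduces the four new vertices to `a` and `b`
  have key : ∀ x ∈ ({a, b, c, d} : Set V), ∃ a' b' c' d' : V, (x = a' ∨ x = b') ∧
      ¬ T a' b' d' ∧ ¬ T a' c' d' ∧ (∀ v w, T a' v w → v = b' ∨ w = b') ∧
      (∀ v w, T b' v w → v = a' ∨ w = a' ∨ (v = c' ∧ w = d') ∨ (v = d' ∧ w = c')) ∧
      (∀ v w, T c' v w → v = d' ∨ w = d' ∨ (v = a' ∧ w = b') ∨ (v = b' ∧ w = a')) ∧
      (∀ v w, T d' v w → v = c' ∨ w = c') := by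
    have hr : ¬ T d c a := fun t => hacd (swap (rot t))
    have hr' : ¬ T d b a := fun t => habd (swap (rot t))
    have hb' : ∀ v w, T b v w → v = a ∨ w = a ∨ (v = d ∧ w = c) ∨ (v = c ∧ w = d) :=
      fun v w t => by have := hb v w t; tauto
    have hc' : ∀ v w, T c v w → v = d ∨ w = d ∨ (v = b ∧ w = a) ∨ (v = a ∧ w = b) :=
      fun v w t => by have := hc v w t; tauto
    rintro x (rfl | rfl | rfl | rfl)
    · exact ⟨x, b, c, d, Or.inl rfl, habd, hacd, ha, hb, hc, hd⟩
    · exact ⟨a, x, c, d, Or.inr rfl, habd, hacd, ha, hb, hc, hd⟩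
    · exact ⟨d, x, b, a, Or.inr rfl, hr, hr', hd, hc', hb', ha⟩
    · exact ⟨x, c, b, a, Or.inl rfl, hr, hr', hd, hc', hb', ha⟩
  clear ha hb hc hd habd hacd
  refine hS.of_outside {a, b, c, d} rot swap ne hT ?_ ?_ ?_ ?_ <;> clear hT
  · intro p hp q r s t1 t2 t3
    obtain ⟨a, b, c, d, hp, h1, h2, ha, hb, hc, hd⟩ := key p hp
    clear key
    have := ne t1
    have := ne (rotl t1)
    have := ne (rot t1)
    have := ne t2
    have := ne t3
    have := swap t3
    have := rotl t3
    rcases hp with rfl | rfl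
    · have := rot (swap t1)
      have := rot (swap t2)
      grind
    · grind
  · intro s hs p q r t1 t2 t3
    obtain ⟨a, b, c, d, hp, h1, h2, ha, hb, hc, hd⟩ := key s hs
    clear key
    have := ne t1
    have := ne t2
    have := ne t3
    rcases hp with rfl | rfl
    · have := ha _ _ (rotl t1)
      have := ha _ _ (rotl t2)
      have := ha _ _ (rotl t3)
      grind
    · have := hb _ _ (rotl t1)
      have := hb _ _ (rotl t2)
      have := hb _ _ (rotl t3)
      have := swap (rotl t1)
      have := swap (rotl t2)
      have := swap (rotl t3)
      have := rot t1
      have := rot t2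
      have := rot t3
      grind
  · rintro p hp q r x y z ⟨t1, t2, t3, n1, n2, n3, n4, n5, n6⟩
    obtain ⟨a, b, c, d, hp, h1, h2, ha, hb, hc, hd⟩ := key p hp
    clear key
    rcases hp with rfl | rfl
    · have := ne t3
      have := ha _ _ t1
      have := ha _ _ t2
      grind
    · have := ne t1
      have := ne t2
      have := ne t3
      have := swap t3
      have := hb _ _ t1
      have := hb _ _ t2
      grind
  · rintro x hx p q r y z ⟨t1, t2, t3, n1, n2, n3, n4, n5, n6⟩
    obtain ⟨a, b, c, d, hp, h1, h2, ha, hb, hc, hd⟩ := key x hx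
    clear key
    have := ne t1
    have := ne t2
    have := ne t3
    have := ne (rotl t1)
    have := ne (rot t1)
    have := swap t2
    have := swap t3
    rcases hp with rfl | rfl
    · have := ha _ _ (rotl t1)
      grind
    · have := hb _ _ (rotl t1)
      grind

end

/-! ### The extremal function and the extensions -/

section

variable {α : Type*} [DecidableEq α] {F G : TripleSystem α}

/-- The maximum number of triples in an `AC`-free triple system on `n` vertices: with `m = n / 2`,
it is `m * (m - 1)` for even `n` and `m ^ 2 + 1` for odd `n`, except that it is `m` for `n = 1, 3`.
-/
def bound (n : ℕ) : ℕ :=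
  if n % 2 = 0 then (n / 2) * (n / 2 - 1) else if n ≤ 3 then n / 2 else (n / 2) ^ 2 + 1

theorem bound_even (m : ℕ) : (bound (2 * m) : ℤ) = m * (m - 1) := by
  have h : 2 * m / 2 = m := by omega
  rw [bound, if_pos (by omega), h]
  cases m <;> simp

theorem bound_odd {m : ℕ} (hm : 2 ≤ m) : (bound (2 * m + 1) : ℤ) = m ^ 2 + 1 := by
  have h : (2 * m + 1) / 2 = m := by omega
  rw [bound, if_neg (by omega), if_neg (by omega), h]
  push_cast
  rfl

/-- The upper bound for the number of triples. Equality implies that the system is tight. -/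
theorem card_edges_le (h : IsACFree F.Tri) :
    F.edges.card ≤ bound F.verts.card ∧
      (4 ≤ F.verts.card → F.edges.card = bound F.verts.card →
        IsTight F.subTri ∧ ∃ u v, Thick F.subTri u v) := by
  have hc := count_eq_card F
  have hV : Fintype.card F.verts = F.verts.card := Fintype.card_coe _
  rcases Nat.even_or_odd' F.verts.card with ⟨m, hm | hm⟩
  · obtain ⟨h1, h2⟩ := (subTri_free h).even_bound (by rw [hV, hm]; exact even_two_mul m)
    have hb := bound_even m
    rw [hV, hm, hc] at h1 h2
    rw [hm]
    push_cast at h1 h2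
    refine ⟨?_, fun h4 he => ?_⟩
    · zify
      rw [hb]
      nlinarith
    · have := h2 (by rw [he, hb]; ring)
      exact ⟨this.1, this.2 h4⟩
  · obtain ⟨h1, h2⟩ := (subTri_free h).odd_bound (by rw [hV, hm]; exact odd_two_mul_add_one m)
    rw [hV, hm, hc] at h1 h2
    rw [hm]
    push_cast at h1 h2
    rcases lt_or_ge m 2 with h2m | h2m
    -- on one or three vertices, only `Nat.choose 3 3 = 1` triple at most is available
    · refine ⟨?_, by omega⟩
      have hle := Finset.card_le_card F.edges_subset
      rw [Finset.card_powersetCard, hm] at hle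
      interval_cases m
      · exact hle
      · exact hle
    · have hb := bound_odd h2m
      refine ⟨?_, fun h4 he => ?_⟩
      · zify
        rw [hb]
        nlinarith
      · exact h2 (by rw [he, hb]; ring)

/-- The effect of a 2-extension on the numbers of vertices and triples and on `AC`-freeness. -/
theorem IsTwoExtension.step (hG : IsTwoExtension F G) :
    G.verts.card = F.verts.card + 2 ∧ G.edges.card = F.edges.card + F.verts.card ∧
      (IsACFree F.Tri → IsACFree G.Tri) := by
  obtain ⟨a, b, hab, hd, hv, he⟩ := hG
  rw [Finset.disjoint_right] at hd
  have ha : a ∉ F.verts := hd (by simp)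
  have hb : b ∉ F.verts := hd (by simp)
  have hF : ∀ e ∈ F.edges, ∀ v ∈ e, v ∈ F.verts := fun e he v hv =>
    (Finset.mem_powersetCard.1 (F.edges_subset he)).1 hv
  refine ⟨?_, ?_, fun h => ?_⟩
  · rw [hv, Finset.card_union_of_disjoint (Finset.disjoint_right.2 hd), Finset.card_pair hab]
  · rw [he, Finset.card_union_of_disjoint, Finset.card_image_of_injOn]
    · intro v hv w hw hvw
      simp only [Finset.mem_coe] at hv hw
      have : v ∈ ({a, b, w} : Finset α) := by
        have := congrArg (fun s => v ∈ s) hvw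
        simpa using this
      grind
    · rw [Finset.disjoint_right]
      intro e he1 he2
      obtain ⟨v, -, rfl⟩ := Finset.mem_image.1 he1
      exact ha (hF _ he2 a (by simp))
  · have tri : ∀ u v w, G.Tri u v w → F.Tri u v w ∨
        ∃ z ∈ F.verts, ({a, b, z} : Finset α) = {u, v, w} := by
      intro u v w t
      rw [Tri, he, Finset.mem_union, Finset.mem_image] at t
      exact t
    have pair : ∀ u v w, G.Tri u v w → (u = a ∨ u = b) → (v = a ∨ v = b) ∨ (w = a ∨ w = b) := by
      intro u v w t hu
      rcases tri u v w t with t' | ⟨z, hz, e⟩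
      · have := t'.mem
        grind
      · have hn := t.ne
        have hn' := t.rot.rot.ne
        have := congrArg (fun s => a ∈ s) e
        have := congrArg (fun s => b ∈ s) e
        simp at this
        grind
    refine h.of_two (a := a) (b := b) Tri.rot Tri.swap Tri.ne ?_ ?_ ?_
    · intro v w t
      have := pair a v w t (Or.inl rfl)
      have := t.ne
      have := t.rot.rot.ne
      tauto
    · intro v w t
      have := pair b v w t (Or.inr rfl)
      have := t.ne
      have := t.rot.rot.ne
      tauto
    · intro u v w t hu hv hw
      rcases tri u v w t with t' | ⟨z, hz, e⟩
      · exact t'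
      · have := congrArg (fun s => a ∈ s) e
        simp only [Finset.mem_insert, Finset.mem_singleton, true_or, eq_iff_iff, true_iff] at this
        simp only [Set.mem_insert_iff, Set.mem_singleton_iff] at hu hv hw
        grind

/-- The effect of a 4-extension on the numbers of vertices and triples and on `AC`-freeness. -/
theorem IsFourExtension.step (hG : IsFourExtension F G) :
    G.verts.card = F.verts.card + 4 ∧ G.edges.card = F.edges.card + 2 * F.verts.card + 2 ∧
      (IsACFree F.Tri → IsACFree G.Tri) := by
  obtain ⟨a, b, c, d, hn, hd, hv, he⟩ := hG
  simp only [List.nodup_cons, List.mem_cons, List.not_mem_nil, or_false, not_or,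
    List.nodup_nil, and_true, not_false_eq_true] at hn
  obtain ⟨⟨hab, hac, had⟩, ⟨hbc, hbd⟩, hcd⟩ := hn
  rw [Finset.disjoint_right] at hd
  have ha : a ∉ F.verts := hd (by simp)
  have hb : b ∉ F.verts := hd (by simp)
  have hc : c ∉ F.verts := hd (by simp)
  have hd' : d ∉ F.verts := hd (by simp)
  have hF : ∀ e ∈ F.edges, ∀ v ∈ e, v ∈ F.verts := fun e he v hv =>
    (Finset.mem_powersetCard.1 (F.edges_subset he)).1 hv
  have inj : ∀ x y, x ∉ F.verts → y ∉ F.verts →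
      (F.verts.image fun v => ({x, y, v} : Finset α)).card = F.verts.card := by
    intro x y hx hy
    refine Finset.card_image_of_injOn fun v hv w hw hvw => ?_
    simp only [Finset.mem_coe] at hv hw
    have : v ∈ ({x, y, w} : Finset α) := by
      have := congrArg (fun s => v ∈ s) hvw
      simpa using this
    grind
  refine ⟨?_, ?_, fun h => ?_⟩
  · rw [hv, Finset.card_union_of_disjoint (Finset.disjoint_right.2 hd)]
    congr 1
    rw [Finset.card_insert_of_notMem (by simp [*]), Finset.card_insert_of_notMem (by simp [*]),
      Finset.card_pair hcd]
  · rw [he, Finset.card_union_of_disjoint, Finset.card_union_of_disjoint,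
      Finset.card_union_of_disjoint, inj a b ha hb, inj c d hc hd', Finset.card_pair]
    · ring
    · intro e
      have := congrArg (fun s => a ∈ s) e
      simp [hab, hac, had] at this
    · rw [Finset.disjoint_right]
      intro e he1 he2
      obtain ⟨v, -, rfl⟩ := Finset.mem_image.1 he1
      exact ha (hF _ he2 a (by simp))
    · rw [Finset.disjoint_right]
      intro e he1 he2
      obtain ⟨v, hv, rfl⟩ := Finset.mem_image.1 he1
      rcases Finset.mem_union.1 he2 with he2 | he2
      · exact hc (hF _ he2 c (by simp))
      · obtain ⟨w, hw, e⟩ := Finset.mem_image.1 he2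
        have := congrArg (fun s => a ∈ s) e
        simp at this
        grind
    · rw [Finset.disjoint_right]
      intro e he1 he2
      simp only [Finset.mem_insert, Finset.mem_singleton] at he1
      rcases Finset.mem_union.1 he2 with he2 | he2
      · rcases Finset.mem_union.1 he2 with he2 | he2
        · rcases he1 with rfl | rfl
          · exact ha (hF _ he2 a (by simp))
          · exact hb (hF _ he2 b (by simp))
        · obtain ⟨w, hw, rfl⟩ := Finset.mem_image.1 he2
          rcases he1 with e | e
          · have := congrArg (fun s => c ∈ s) e
            simp at this
            grind
          · have := congrArg (fun s => a ∈ s) e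
            simp at this
            grind
      · obtain ⟨w, hw, rfl⟩ := Finset.mem_image.1 he2
        rcases he1 with e | e
        · have := congrArg (fun s => d ∈ s) e
          simp at this
          grind
        · have := congrArg (fun s => b ∈ s) e
          simp at this
          grind
  · have tri : ∀ u v w, G.Tri u v w → F.Tri u v w ∨
        ∃ x y z, ({x, y, z} : Finset α) = {u, v, w} ∧ ((z ∈ F.verts ∧ x = a ∧ y = b) ∨
          (z ∈ F.verts ∧ x = c ∧ y = d) ∨ (x = a ∧ y = b ∧ z = c) ∨ (x = b ∧ y = c ∧ z = d)) := by
      intro u v w t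
      rw [Tri, he] at t
      simp only [Finset.mem_union, Finset.mem_image, Finset.mem_insert,
        Finset.mem_singleton] at t
      rcases t with ((t | ⟨z, hz, t⟩) | ⟨z, hz, t⟩) | t | t
      · exact Or.inl t
      · exact Or.inr ⟨a, b, z, t, Or.inl ⟨hz, rfl, rfl⟩⟩
      · exact Or.inr ⟨c, d, z, t, Or.inr (Or.inl ⟨hz, rfl, rfl⟩)⟩
      · exact Or.inr ⟨a, b, c, t.symm, Or.inr (Or.inr (Or.inl ⟨rfl, rfl, rfl⟩))⟩
      · exact Or.inr ⟨b, c, d, t.symm, Or.inr (Or.inr (Or.inr ⟨rfl, rfl, rfl⟩))⟩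
    -- the same in terms of the vertices instead of the sets
    have perm : ∀ u v w, G.Tri u v w → F.Tri u v w ∨
        ∃ x y z, ((x = u ∧ y = v ∧ z = w) ∨ (x = u ∧ y = w ∧ z = v) ∨ (x = v ∧ y = u ∧ z = w) ∨
          (x = v ∧ y = w ∧ z = u) ∨ (x = w ∧ y = u ∧ z = v) ∨ (x = w ∧ y = v ∧ z = u)) ∧
          ((z ∈ F.verts ∧ x = a ∧ y = b) ∨
          (z ∈ F.verts ∧ x = c ∧ y = d) ∨ (x = a ∧ y = b ∧ z = c) ∨ (x = b ∧ y = c ∧ z = d)) := by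
      intro u v w t
      rcases tri u v w t with t' | ⟨x, y, z, e, hx⟩
      · exact Or.inl t'
      · refine Or.inr ⟨x, y, z, ?_, hx⟩
        have e1 : ∀ s, s ∈ ({x, y, z} : Finset α) ↔ s ∈ ({u, v, w} : Finset α) := by rw [e]; simp
        simp only [Finset.mem_insert, Finset.mem_singleton] at e1
        have n1 := t.ne
        have n2 := t.rot.ne
        have n3 := t.rot.rot.ne
        have := e1 u
        have := e1 v
        have := e1 w
        grind
    have notF : ∀ u v w, F.Tri u v w → u ∈ F.verts ∧ v ∈ F.verts ∧ w ∈ F.verts :=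
      fun u v w t => ⟨t.mem, t.rot.mem, t.rot.rot.mem⟩
    refine h.of_four (a := a) (b := b) (c := c) (d := d) Tri.rot Tri.swap Tri.ne ?_ ?_ ?_ ?_ ?_ ?_
      ?_
    · intro t
      have := perm _ _ _ t
      grind
    · intro t
      have := perm _ _ _ t
      grind
    · intro v w t
      have := perm _ _ _ t
      grind
    · intro v w t
      have := perm _ _ _ t
      grind
    · intro v w t
      have := perm _ _ _ t
      grind
    · intro v w t
      have := perm _ _ _ t
      grind
    · intro u v w t hu hv hw
      have := perm _ _ _ t
      simp only [Set.mem_insert_iff, Set.mem_singleton_iff] at hu hv hw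
      grind

end

/-! ### Extremality of the systems in the class -/

section

variable {α : Type*} [DecidableEq α] {F G : TripleSystem α}

/-- The numbers of vertices for which the extremal systems are generated from the basic ones, and
for which `bound` obeys the recursions of the extensions. The numbers `1` and `3` are exceptional,
and `0` is not the size of a star. -/
def IsLarge (n : ℕ) : Prop := (Even n ∧ 2 ≤ n) ∨ (Odd n ∧ 5 ≤ n)

/-- An `AC`-free triple system with as many triples as `bound` allows. -/
def IsExtremal (F : TripleSystem α) : Prop := IsACFree F.Tri ∧ F.edges.card = bound F.verts.card

theorem bound_add_two {n : ℕ} (hn : IsLarge n) : bound (n + 2) = bound n + n := by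
  zify
  rcases hn with ⟨hn, h2⟩ | ⟨hn, h2⟩
  · obtain ⟨m, rfl⟩ := hn.two_dvd
    rw [show 2 * m + 2 = 2 * (m + 1) by ring, bound_even, bound_even]
    push_cast
    ring
  · obtain ⟨m, rfl⟩ := hn
    rw [show 2 * m + 1 + 2 = 2 * (m + 1) + 1 by ring, bound_odd (by omega), bound_odd (by omega)]
    push_cast
    ring

theorem IsLarge.add_two {n : ℕ} (hn : IsLarge n) : IsLarge (n + 2) := by
  rcases hn with ⟨hn, h2⟩ | ⟨hn, h2⟩
  · exact Or.inl ⟨hn.add even_two, by omega⟩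
  · exact Or.inr ⟨hn.add_even even_two, by omega⟩

theorem bound_add_four {n : ℕ} (hn : IsLarge n) : bound (n + 4) = bound n + 2 * n + 2 := by
  rw [show n + 4 = n + 2 + 2 by rfl, bound_add_two hn.add_two, bound_add_two hn]
  ring

theorem IsTuranStar.extremal (hF : F.IsTuranStar) (hn : Even F.verts.card) : IsExtremal F := by
  obtain ⟨x, hx, P, Q, hd, hPQ, hP, hQ, hE⟩ := hF
  have hxPQ : ∀ v, v ∈ P ∨ v ∈ Q → v ≠ x := by
    intro v hv
    rw [← Finset.mem_union, hPQ] at hv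
    exact Finset.ne_of_mem_erase hv
  have hdis : ∀ v, v ∈ P → v ∉ Q := fun v => (Finset.disjoint_left.1 hd ·)
  have tri : ∀ u v w, F.Tri u v w → ∃ p ∈ P, ∃ q ∈ Q,
      (u = x ∧ ((v = p ∧ w = q) ∨ (v = q ∧ w = p))) ∨
      (v = x ∧ ((u = p ∧ w = q) ∨ (u = q ∧ w = p))) ∨
      (w = x ∧ ((u = p ∧ v = q) ∨ (u = q ∧ v = p))) := by
    intro u v w t
    have n1 := t.ne
    have n2 := t.rot.ne
    have n3 := t.rot.rot.ne
    rw [Tri, hE, Finset.mem_image] at t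
    obtain ⟨⟨p, q⟩, hpq, e⟩ := t
    obtain ⟨hp, hq⟩ := Finset.mem_product.1 hpq
    have e1 : ∀ s, s ∈ ({x, p, q} : Finset α) ↔ s ∈ ({u, v, w} : Finset α) := by
      intro s
      rw [← e]
    simp only [Finset.mem_insert, Finset.mem_singleton] at e1
    have := e1 u
    have := e1 v
    have := e1 w
    exact ⟨p, hp, q, hq, by grind⟩
  constructor
  · refine ⟨Tri.rot, Tri.swap, Tri.ne, fun {a b c d} t1 t2 t3 => ?_,
      fun {a b c d e f} t1 t2 t3 n1 n2 n3 n4 n5 n6 => ?_⟩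
    · have := tri _ _ _ t1
      have := tri _ _ _ t2
      have := tri _ _ _ t3
      have := t1.ne
      have := t2.ne
      have := t3.ne
      grind
    · have := tri _ _ _ t1
      have := tri _ _ _ t2
      have := tri _ _ _ t3
      have := t1.ne
      have := t2.ne
      have := t3.ne
      grind
  · rw [hE, Finset.card_image_of_injOn, Finset.card_product, hP, hQ, bound,
      if_pos (Nat.even_iff.1 hn), mul_comm]
    · congr 1
      obtain ⟨m, hm⟩ := hn.two_dvd
      omega
    · rintro ⟨p, q⟩ h1 ⟨p', q'⟩ h2 e
      simp only [Finset.coe_product, Set.mem_prod, Finset.mem_coe] at h1 h2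
      have e1 : ∀ s, s ∈ ({x, p, q} : Finset α) ↔ s ∈ ({x, p', q'} : Finset α) := by
        intro s
        rw [show ({x, p, q} : Finset α) = {x, p', q'} from e]
      simp only [Finset.mem_insert, Finset.mem_singleton] at e1
      have := e1 p
      have := e1 q
      rw [Prod.mk.injEq]
      grind

set_option maxRecDepth 20000 in
/-- A five-ring contains no copy of `C`; it contains none of `A`, which has six vertices. -/
theorem ring5_no_C : ∀ a ∈ ring5.verts, ∀ b ∈ ring5.verts, ∀ c ∈ ring5.verts, ∀ d ∈ ring5.verts,
    {a, b, d} ∈ ring5.edges → {a, c, d} ∈ ring5.edges → {b, c, d} ∉ ring5.edges := by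
  decide

theorem card_image_edges {β : Type*} [DecidableEq β] (H : TripleSystem β) {φ : β → α}
    (hφ : Set.InjOn φ H.verts) : (H.edges.image fun e => e.image φ).card = H.edges.card := by
  refine Finset.card_image_of_injOn fun e h1 e' h2 hee => ?_
  have s1 := (Finset.mem_powersetCard.1 (H.edges_subset h1)).1
  have s2 := (Finset.mem_powersetCard.1 (H.edges_subset h2)).1
  have : φ '' (e : Set β) = φ '' (e' : Set β) := by
    rw [← Finset.coe_image, ← Finset.coe_image]
    exact congrArg _ hee
  exact Finset.coe_injective ((hφ.image_eq_image_iff (by exact_mod_cast s1)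
    (by exact_mod_cast s2)).1 this)

theorem IsIso.card_eq {β : Type*} [DecidableEq β] {H : TripleSystem β} (h : F.IsIso H) :
    F.verts.card = H.verts.card ∧ F.edges.card = H.edges.card := by
  obtain ⟨φ, hb, he⟩ := h
  have hv : F.verts = H.verts.image φ := by
    apply Finset.coe_injective
    rw [Finset.coe_image, hb.image_eq]
  exact ⟨by rw [hv, Finset.card_image_of_injOn hb.injOn], by rw [he, card_image_edges H hb.injOn]⟩

theorem IsFiveRing.extremal (hF : F.IsFiveRing) : IsExtremal F ∧ F.verts.card = 5 := by
  obtain ⟨hv, he⟩ := IsIso.card_eq hF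
  have h5 : F.verts.card = 5 := hv.trans rfl
  refine ⟨⟨isFree_iff.1 ?_, by rw [he, h5]; rfl⟩, h5⟩
  rintro H (rfl | rfl) ⟨ψ, hi, hm, hE⟩
  · have := Finset.card_le_card_of_injOn ψ hm hi
    rw [h5] at this
    exact absurd this (by decide)
  · obtain ⟨φ, hb, hFE⟩ := hF
    have pre : ∀ i ∈ configC.verts, ∃ j ∈ ring5.verts, φ j = ψ i := fun i hi =>
      hb.surjOn (hm hi)
    obtain ⟨a, ha, ea⟩ := pre 1 (by simp [configC])
    obtain ⟨b, hb', eb⟩ := pre 2 (by simp [configC])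
    obtain ⟨c, hc, ec⟩ := pre 3 (by simp [configC])
    obtain ⟨d, hd, ed⟩ := pre 4 (by simp [configC])
    -- triples of `F` pull back to triples of the standard five-ring
    have key : ∀ u ∈ ring5.verts, ∀ v ∈ ring5.verts, ∀ w ∈ ring5.verts,
        ({φ u, φ v, φ w} : Finset α) ∈ F.edges → {u, v, w} ∈ ring5.edges := by
      intro u hu v hv w hw t
      rw [hFE, Finset.mem_image] at t
      obtain ⟨e, he, e1⟩ := t
      have s1 := (Finset.mem_powersetCard.1 (ring5.edges_subset he)).1
      have : φ '' (e : Set ℕ) = φ '' (({u, v, w} : Finset ℕ) : Set ℕ) := by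
        rw [← Finset.coe_image, ← Finset.coe_image, e1]
        simp [Finset.image_insert]
      have hs : (({u, v, w} : Finset ℕ) : Set ℕ) ⊆ ring5.verts := by
        intro z hz
        simp only [Finset.coe_insert, Finset.coe_singleton, Set.mem_insert_iff,
          Set.mem_singleton_iff] at hz
        rcases hz with rfl | rfl | rfl <;> assumption
      have := Finset.coe_injective ((hb.injOn.image_eq_image_iff (by exact_mod_cast s1) hs).1 this)
      exact this ▸ he
    refine ring5_no_C a ha b hb' c hc d hd (key _ ha _ hb' _ hd ?_) (key _ ha _ hc _ hd ?_)
      (key _ hb' _ hc _ hd ?_)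
    · rw [ea, eb, ed]
      simpa [Finset.image_insert] using hE {1, 2, 4} (by simp [configC])
    · rw [ea, ec, ed]
      simpa [Finset.image_insert] using hE {1, 3, 4} (by simp [configC])
    · rw [eb, ec, ed]
      simpa [Finset.image_insert] using hE {2, 3, 4} (by simp [configC])

/-- The systems that start a sequence of extensions: Turán stars on an even number of vertices and
five-rings. -/
def IsBasic (F : TripleSystem α) : Prop := (F.IsTuranStar ∧ Even F.verts.card) ∨ F.IsFiveRing

theorem IsTuranStar.two_le (hF : F.IsTuranStar) (hn : Even F.verts.card) : 2 ≤ F.verts.card := by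
  obtain ⟨x, hx, -⟩ := hF
  have := Finset.card_pos.2 ⟨x, hx⟩
  obtain ⟨m, hm⟩ := hn.two_dvd
  omega

theorem IsBasic.extremal (hF : IsBasic F) : IsExtremal F ∧ IsLarge F.verts.card := by
  rcases hF with ⟨h, hn⟩ | h
  · exact ⟨h.extremal hn, Or.inl ⟨hn, h.two_le hn⟩⟩
  · obtain ⟨h1, h2⟩ := h.extremal
    exact ⟨h1, Or.inr ⟨by rw [h2]; decide, by omega⟩⟩

/-- Extensions preserve extremality and the parity of the number of vertices. -/
theorem IsIteratedExtension.extremal (h : IsIteratedExtension F G)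
    (hF : IsExtremal F ∧ IsLarge F.verts.card) :
    (IsExtremal G ∧ IsLarge G.verts.card) ∧ ∃ k, G.verts.card = F.verts.card + 2 * k := by
  induction h with
  | refl => exact ⟨hF, 0, rfl⟩
  | tail _ hs ih =>
    obtain ⟨⟨⟨i1, i2⟩, i3⟩, k, hk⟩ := ih
    rcases hs with hs | hs
    · obtain ⟨h1, h2, h3⟩ := hs.step
      refine ⟨⟨⟨h3 i1, ?_⟩, ?_⟩, k + 1, by omega⟩
      · rw [h2, h1, bound_add_two i3, i2]
      · rw [h1]
        exact i3.add_two
    · obtain ⟨h1, h2, h3⟩ := hs.step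
      refine ⟨⟨⟨h3 i1, ?_⟩, ?_⟩, k + 2, by omega⟩
      · rw [h2, h1, bound_add_four i3, i2]
      · rw [h1]
        exact i3.add_two.add_two

end

/-! ### Decomposition of extremal systems -/

section

variable {α : Type*} [DecidableEq α] {F G : TripleSystem α}

/-- The triple system that arises by deleting the vertices in `N`. -/
def delete (F : TripleSystem α) (N : Finset α) : TripleSystem α where
  verts := F.verts \ N
  edges := F.edges.filter fun e => Disjoint e N
  edges_subset e he := by
    obtain ⟨he, hN⟩ := Finset.mem_filter.1 he
    obtain ⟨h1, h2⟩ := Finset.mem_powersetCard.1 (F.edges_subset he)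
    exact Finset.mem_powersetCard.2 ⟨Finset.subset_sdiff.2 ⟨h1, hN⟩, h2⟩

theorem delete_free (h : IsACFree F.Tri) (N : Finset α) : IsACFree (F.delete N).Tri := by
  have sub : ∀ {u v w}, (F.delete N).Tri u v w → F.Tri u v w :=
    fun t => Finset.mem_of_mem_filter _ t
  exact ⟨Tri.rot, Tri.swap, Tri.ne, fun t1 t2 t3 => h.not_C (sub t1) (sub t2) (sub t3),
    fun t1 t2 t3 => h.not_A (sub t1) (sub t2) (sub t3)⟩

/-- Deleting a dominating thick pair undoes a 2-extension. -/
theorem IsTwoTop.isTwoExtension {a b : F.verts} (h : IsTwoTop F.subTri a b) :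
    IsTwoExtension (F.delete {a.1, b.1}) F := by
  obtain ⟨hab, h1, h2, h3⟩ := h
  have hab' : a.1 ≠ b.1 := fun e => hab (Subtype.ext e)
  have g1 : ∀ z ∈ F.verts, z ≠ a.1 → z ≠ b.1 → F.Tri a.1 b.1 z := fun z hz n1 n2 =>
    h1 ⟨z, hz⟩ (fun e => n1 (congrArg Subtype.val e)) (fun e => n2 (congrArg Subtype.val e))
  have g2 : ∀ v w, F.Tri a.1 v w → v = b.1 ∨ w = b.1 := fun v w t =>
    (h2 ⟨v, t.rot.mem⟩ ⟨w, t.rot.rot.mem⟩ t).imp (congrArg Subtype.val) (congrArg Subtype.val)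
  have g3 : ∀ v w, F.Tri b.1 v w → v = a.1 ∨ w = a.1 := fun v w t =>
    (h3 ⟨v, t.rot.mem⟩ ⟨w, t.rot.rot.mem⟩ t).imp (congrArg Subtype.val) (congrArg Subtype.val)
  obtain ⟨a, ha⟩ := a
  obtain ⟨b, hb⟩ := b
  simp only at g1 g2 g3 hab' ⊢
  refine ⟨a, b, hab', Finset.sdiff_disjoint, ?_, ?_⟩
  · rw [delete, Finset.sdiff_union_of_subset]
    simp [Finset.insert_subset_iff, ha, hb]
  · ext e
    simp only [delete, Finset.mem_union, Finset.mem_filter, Finset.mem_image, Finset.mem_sdiff,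
      Finset.mem_insert, Finset.mem_singleton, not_or]
    constructor
    · intro he
      by_cases hea : a ∈ e
      · right
        obtain ⟨v, w, rfl, t⟩ := exists_tri_of_mem he hea
        have n1 := t.ne
        have n2 := t.rot.ne
        have n3 := t.rot.rot.ne
        rcases g2 v w t with rfl | rfl
        · exact ⟨w, ⟨t.rot.rot.mem, n3, n2.symm⟩, rfl⟩
        · exact ⟨v, ⟨t.rot.mem, n1.symm, n2⟩, by grind⟩
      · left
        refine ⟨he, ?_⟩
        rw [Finset.disjoint_right]
        intro z hz hze
        rcases Finset.mem_insert.1 hz with rfl | hz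
        · exact hea hze
        · rw [Finset.mem_singleton] at hz
          subst hz
          obtain ⟨v, w, rfl, t⟩ := exists_tri_of_mem he hze
          rcases g3 v w t with rfl | rfl <;> simp at hea
    · rintro (⟨he, -⟩ | ⟨z, ⟨hz, n1, n2⟩, rfl⟩)
      · exact he
      · exact g1 z hz n1 n2

/-- Deleting a dominating path undoes a 4-extension. -/
theorem IsFourTop.isFourExtension {a b c d : F.verts}
    (h : IsFourTop F.subTri a b c d) :
    IsFourExtension (F.delete {a.1, b.1, c.1, d.1}) F ∧ 5 ≤ F.verts.card := by
  obtain ⟨t1, t2, nabd, nacd, ⟨v₀, m1, m2, m3, m4⟩, h1, ga, gb, gc, gd⟩ := h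
  have g1 : ∀ z ∈ F.verts, z ≠ a.1 → z ≠ b.1 → z ≠ c.1 → z ≠ d.1 →
      F.Tri a.1 b.1 z ∧ F.Tri c.1 d.1 z := fun z hz n1 n2 n3 n4 =>
    h1 ⟨z, hz⟩ (fun e => n1 (congrArg Subtype.val e)) (fun e => n2 (congrArg Subtype.val e))
      (fun e => n3 (congrArg Subtype.val e)) (fun e => n4 (congrArg Subtype.val e))
  have ga' : ∀ v w, F.Tri a.1 v w → v = b.1 ∨ w = b.1 := fun v w t =>
    (ga ⟨v, t.rot.mem⟩ ⟨w, t.rot.rot.mem⟩ t).imp (congrArg Subtype.val) (congrArg Subtype.val)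
  have gd' : ∀ v w, F.Tri d.1 v w → v = c.1 ∨ w = c.1 := fun v w t =>
    (gd ⟨v, t.rot.mem⟩ ⟨w, t.rot.rot.mem⟩ t).imp (congrArg Subtype.val) (congrArg Subtype.val)
  have gb' : ∀ v w, F.Tri b.1 v w → v = a.1 ∨ w = a.1 ∨ v = d.1 ∨ w = d.1 := fun v w t => by
    rcases gb ⟨v, t.rot.mem⟩ ⟨w, t.rot.rot.mem⟩ t with e | e | ⟨-, e⟩ | ⟨e, -⟩ <;>
      simp [congrArg Subtype.val e.symm]
  have gc' : ∀ v w, F.Tri c.1 v w → v = a.1 ∨ w = a.1 ∨ v = d.1 ∨ w = d.1 := fun v w t => by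
    rcases gc ⟨v, t.rot.mem⟩ ⟨w, t.rot.rot.mem⟩ t with e | e | ⟨e, -⟩ | ⟨-, e⟩ <;>
      simp [congrArg Subtype.val e.symm]
  have hm : ∀ v : F.verts, v₀ ≠ v → v₀.1 ≠ v.1 := fun v hv e => hv (Subtype.ext e)
  replace m1 := hm _ m1
  replace m2 := hm _ m2
  replace m3 := hm _ m3
  replace m4 := hm _ m4
  change F.Tri a.1 b.1 c.1 at t1
  change F.Tri b.1 c.1 d.1 at t2
  change ¬ F.Tri a.1 b.1 d.1 at nabd
  change ¬ F.Tri a.1 c.1 d.1 at nacd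
  clear h1 ga gb gc gd hm
  obtain ⟨a, ha⟩ := a
  obtain ⟨b, hb⟩ := b
  obtain ⟨c, hc⟩ := c
  obtain ⟨d, hd⟩ := d
  obtain ⟨v₀, hv₀⟩ := v₀
  simp only at *
  have n1 := t1.ne
  have n2 := t1.rot.ne
  have n3 := t1.rot.rot.ne
  have n4 := t2.rot.ne
  have n5 := t2.rot.rot.ne
  have n6 : a ≠ d := by
    rintro rfl
    rcases g1 v₀ hv₀ m1 m2 m3 m4 with ⟨k1, k2⟩
    rcases ga' _ _ (Tri.rot k2) with e | e
    · exact m2 e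
    · exact n2 e.symm
  have sub : {a, b, c, d} ⊆ F.verts := by
    simp [Finset.insert_subset_iff, ha, hb, hc, hd]
  refine ⟨⟨a, b, c, d, by simp; tauto, Finset.sdiff_disjoint, ?_, ?_⟩, ?_⟩
  · rw [delete, Finset.sdiff_union_of_subset sub]
  · ext e
    simp only [delete, Finset.mem_union, Finset.mem_filter, Finset.mem_image, Finset.mem_sdiff,
      Finset.mem_insert, Finset.mem_singleton, not_or]
    constructor
    · intro he
      by_cases hea : a ∈ e
      · obtain ⟨z, rfl, t⟩ : ∃ z, e = {a, b, z} ∧ F.Tri a b z := by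
          obtain ⟨v, w, rfl, t⟩ := exists_tri_of_mem he hea
          rcases ga' v w t with rfl | rfl
          · exact ⟨w, rfl, t⟩
          · exact ⟨v, by grind, t.rot.rot.swap⟩
        by_cases hzc : z = c
        · subst hzc
          exact Or.inr (Or.inl rfl)
        · refine Or.inl (Or.inl (Or.inr ⟨z, ⟨t.rot.rot.mem, t.rot.rot.ne, t.rot.ne.symm, hzc, ?_⟩,
            rfl⟩))
          rintro rfl
          exact nabd t
      by_cases hed : d ∈ e
      · obtain ⟨z, rfl, t⟩ : ∃ z, e = {d, c, z} ∧ F.Tri d c z := by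
          obtain ⟨v, w, rfl, t⟩ := exists_tri_of_mem he hed
          rcases gd' v w t with rfl | rfl
          · exact ⟨w, rfl, t⟩
          · exact ⟨v, by grind, t.rot.rot.swap⟩
        by_cases hzb : z = b
        · subst hzb
          exact Or.inr (Or.inr (by grind))
        · refine Or.inl (Or.inr ⟨z, ⟨t.rot.rot.mem, ?_, hzb, t.rot.ne.symm, t.rot.rot.ne⟩,
            by grind⟩)
          rintro rfl
          simp at hea
      · refine Or.inl (Or.inl (Or.inl ⟨he, ?_⟩))
        rw [Finset.disjoint_right]
        intro z hz hze
        simp only [Finset.mem_insert, Finset.mem_singleton] at hz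
        rcases hz with rfl | rfl | rfl | rfl
        · exact hea hze
        · obtain ⟨v, w, rfl, t⟩ := exists_tri_of_mem he hze
          rcases gb' v w t with rfl | rfl | rfl | rfl <;> simp at hea hed
        · obtain ⟨v, w, rfl, t⟩ := exists_tri_of_mem he hze
          rcases gc' v w t with rfl | rfl | rfl | rfl <;> simp at hea hed
        · exact hed hze
    · rintro (((⟨he, -⟩ | ⟨z, ⟨hz, k1, k2, k3, k4⟩, rfl⟩) | ⟨z, ⟨hz, k1, k2, k3, k4⟩, rfl⟩) |
        rfl | rfl)
      · exact he
      · exact (g1 z hz k1 k2 k3 k4).1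
      · exact (g1 z hz k1 k2 k3 k4).2
      · exact t1
      · exact t2
  · have h5 : ({v₀, a, b, c, d} : Finset α).card = 5 := by
      rw [Finset.card_insert_of_notMem, Finset.card_insert_of_notMem,
        Finset.card_insert_of_notMem, Finset.card_pair] <;> simp <;> tauto
    rw [← h5]
    exact Finset.card_le_card (Finset.insert_subset hv₀ sub)

theorem IsStar.isTuranStar {x : F.verts} {P Q : Finset F.verts}
    (h : IsStar F.subTri x P Q) (hP : P.card = (F.verts.card - 1) / 2)
    (hQ : Q.card = F.verts.card / 2) : F.IsTuranStar := by
  obtain ⟨hd, hv, hx, hT⟩ := h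
  refine ⟨x, x.2, P.image Subtype.val, Q.image Subtype.val, ?_, ?_, ?_, ?_, ?_⟩
  · rwa [Finset.disjoint_image Subtype.val_injective]
  · rw [← Finset.image_union]
    ext v
    simp only [Finset.mem_image, Finset.mem_union, hv, Finset.mem_erase]
    constructor
    · rintro ⟨v, n, rfl⟩
      exact ⟨fun e => n (Subtype.ext e), v.2⟩
    · rintro ⟨n, hv⟩
      exact ⟨⟨v, hv⟩, fun e => n (congrArg Subtype.val e), rfl⟩
  · rw [Finset.card_image_of_injective _ Subtype.val_injective, hP]
  · rw [Finset.card_image_of_injective _ Subtype.val_injective, hQ]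
  · ext e
    simp only [Finset.mem_image, Finset.mem_product, Prod.exists]
    constructor
    · intro he
      have hxe : x.1 ∈ e := by
        obtain ⟨u, v, w, rfl, t⟩ := exists_tri he
        rcases hx ⟨u, t.mem⟩ ⟨v, t.rot.mem⟩ ⟨w, t.rot.rot.mem⟩ t with rfl | rfl | rfl <;> simp
      obtain ⟨v, w, rfl, t⟩ := exists_tri_of_mem he hxe
      rcases (hT ⟨v, t.rot.mem⟩ ⟨w, t.rot.rot.mem⟩).1 t with ⟨k1, k2⟩ | ⟨k1, k2⟩
      · exact ⟨v, w, ⟨⟨_, k1, rfl⟩, ⟨_, k2, rfl⟩⟩, rfl⟩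
      · exact ⟨w, v, ⟨⟨_, k2, rfl⟩, ⟨_, k1, rfl⟩⟩, by grind⟩
    · rintro ⟨_, _, ⟨⟨p, hp, rfl⟩, ⟨q, hq, rfl⟩⟩, rfl⟩
      exact (hT p q).2 (Or.inl ⟨hp, hq⟩)

theorem Ring.isFiveRing {a b c d e : F.verts} (hF : IsExtremal F) (h : Ring F.subTri a b c d e)
    (hv : ∀ v, v ∈ ({a, b, c, d, e} : Set F.verts)) : F.IsFiveRing := by
  have hn := h.distinct (subTri_free hF.1)
  have hval : ∀ {u v : F.verts}, u ≠ v → u.1 ≠ v.1 := fun n e => n (Subtype.ext e)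
  let φ : ℕ → F.verts := fun i => if i = 1 then a else if i = 2 then b else if i = 3 then c else
    if i = 4 then d else e
  have hb : Set.BijOn (fun i => (φ i).1) ring5.verts F.verts := by
    refine ⟨fun i _ => (φ i).2, ?_, ?_⟩
    · intro i hi j hj hij
      replace hij : φ i = φ j := Subtype.ext hij
      simp only [ring5, Finset.coe_insert, Finset.coe_singleton, Set.mem_insert_iff,
        Set.mem_singleton_iff] at hi hj
      rcases hi with rfl | rfl | rfl | rfl | rfl <;>
        rcases hj with rfl | rfl | rfl | rfl | rfl <;> simp [φ] at hij ⊢ <;> grind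
    · intro v hv'
      have := hv ⟨v, hv'⟩
      simp only [Set.mem_insert_iff, Set.mem_singleton_iff] at this
      rcases this with e | e | e | e | e
      · exact ⟨1, by simp [ring5], congrArg Subtype.val e.symm⟩
      · exact ⟨2, by simp [ring5], congrArg Subtype.val e.symm⟩
      · exact ⟨3, by simp [ring5], congrArg Subtype.val e.symm⟩
      · exact ⟨4, by simp [ring5], congrArg Subtype.val e.symm⟩
      · exact ⟨5, by simp [ring5], congrArg Subtype.val e.symm⟩
  have hcard : F.verts.card = 5 := by
    have : F.verts = ring5.verts.image fun i => (φ i).1 := by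
      apply Finset.coe_injective
      rw [Finset.coe_image, hb.image_eq]
    rw [this, Finset.card_image_of_injOn hb.injOn]
    rfl
  -- the five triples of the ring are all, since there are only `bound 5 = 5`
  refine ⟨fun i => (φ i).1, hb, (Finset.eq_of_subset_of_card_le ?_ ?_).symm⟩
  · intro s hs
    obtain ⟨f, hf, rfl⟩ := Finset.mem_image.1 hs
    simp only [ring5, Finset.mem_insert, Finset.mem_singleton] at hf
    obtain ⟨r1, r2, r3, r4, r5⟩ := h
    simp only [subTri, Tri] at r1 r2 r3 r4 r5
    rcases hf with rfl | rfl | rfl | rfl | rfl <;> simpa [Finset.image_insert, φ]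
  · rw [card_image_edges ring5 hb.injOn, hF.2, hcard]
    rfl

/-- Every extremal system arises by extensions from a basic system. -/
theorem IsExtremal.exists_basic (n : ℕ) : ∀ F : TripleSystem α, F.verts.card = n → IsExtremal F →
    IsLarge n → ∃ F₀, IsBasic F₀ ∧ IsIteratedExtension F₀ F := by
  induction n using Nat.strong_induction_on with
  | _ n ih =>
    intro F hn hF hL
    -- two vertices and no triple form a Turán star with an empty part
    by_cases h2 : n = 2
    · rw [h2] at hn
      obtain ⟨x, y, hxy, hv⟩ := Finset.card_eq_two.1 hn
      refine ⟨F, Or.inl ⟨⟨x, by simp [hv], ∅, {y}, by simp, ?_, by simp [hn], by simp [hn], ?_⟩,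
        by simp [hn]⟩, Relation.ReflTransGen.refl⟩
      · rw [hv]
        ext z
        simp only [Finset.empty_union, Finset.mem_singleton, Finset.mem_erase, Finset.mem_insert]
        grind
      · have := hF.2
        rw [hn] at this
        simpa using Finset.card_eq_zero.1 this
    have h4 : 4 ≤ n := by
      rcases hL with ⟨h, _⟩ | ⟨h, _⟩
      · obtain ⟨m, hm⟩ := h.two_dvd
        omega
      · omega
    obtain ⟨hT, hne⟩ := (card_edges_le hF.1).2 (hn ▸ h4) hF.2
    rcases (subTri_free hF.1).structure_of_tight hT hne with
      ⟨a, b, h⟩ | ⟨a, b, c, d, h⟩ | ⟨x, P, Q, h, hP, hQ, he⟩ | ⟨a, b, c, d, e, h, hv⟩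
    · have hs := h.isTwoExtension
      obtain ⟨s1, s2, -⟩ := hs.step
      set F' := F.delete {a.1, b.1}
      have hfree : IsACFree F'.Tri := delete_free hF.1 _
      have hle := (card_edges_le hfree).1
      have hbd := hF.2
      -- the three vertices left would span two triples
      by_cases h5 : n = 5
      · have e3 : F'.verts.card = 3 := by omega
        have b5 : bound 5 = 5 := rfl
        have b3 : bound 3 = 1 := rfl
        rw [e3, b3] at hle
        rw [hn, h5, b5] at hbd
        omega
      have hL' : IsLarge F'.verts.card := by
        rcases hL with ⟨⟨m, hm⟩, _⟩ | ⟨⟨m, hm⟩, _⟩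
        · exact Or.inl ⟨⟨m - 1, by omega⟩, by omega⟩
        · exact Or.inr ⟨⟨m - 1, by omega⟩, by omega⟩
      have := bound_add_two hL'
      rw [← s1] at this
      obtain ⟨F₀, k1, k2⟩ := ih F'.verts.card (by omega) F' rfl ⟨hfree, by omega⟩ hL'
      exact ⟨F₀, k1, k2.tail (Or.inl hs)⟩
    · obtain ⟨hs, hn5⟩ := h.isFourExtension
      obtain ⟨s1, s2, -⟩ := hs.step
      set F' := F.delete {a.1, b.1, c.1, d.1}
      have hfree : IsACFree F'.Tri := delete_free hF.1 _
      have hle := (card_edges_le hfree).1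
      have hbd := hF.2
      -- the remaining one or three vertices would span one or two triples
      by_cases h5 : n = 5
      · have e1 : F'.verts.card = 1 := by omega
        have b5 : bound 5 = 5 := rfl
        have b1 : bound 1 = 0 := rfl
        rw [e1, b1] at hle
        rw [hn, h5, b5] at hbd
        omega
      by_cases h7 : n = 7
      · have e3 : F'.verts.card = 3 := by omega
        have b7 : bound 7 = 10 := rfl
        have b3 : bound 3 = 1 := rfl
        rw [e3, b3] at hle
        rw [hn, h7, b7] at hbd
        omega
      have hL' : IsLarge F'.verts.card := by
        rcases hL with ⟨⟨m, hm⟩, _⟩ | ⟨⟨m, hm⟩, _⟩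
        · exact Or.inl ⟨⟨m - 2, by omega⟩, by omega⟩
        · exact Or.inr ⟨⟨m - 2, by omega⟩, by omega⟩
      have := bound_add_four hL'
      rw [← s1] at this
      obtain ⟨F₀, k1, k2⟩ := ih F'.verts.card (by omega) F' rfl ⟨hfree, by omega⟩ hL'
      exact ⟨F₀, k1, k2.tail (Or.inr hs)⟩
    · rw [Fintype.card_coe] at hP hQ he
      exact ⟨F, Or.inl ⟨h.isTuranStar hP hQ, he⟩, Relation.ReflTransGen.refl⟩
    · exact ⟨F, Or.inr (Ring.isFiveRing hF h hv), Relation.ReflTransGen.refl⟩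

end

/-! ### Existence of extremal systems -/

theorem isExtremal_iff {α : Type*} [DecidableEq α] {F : TripleSystem α} :
    IsExtremal F ↔ F.IsFree {configA, configC} ∧ F.edges.card = bound F.verts.card := by
  rw [isFree_iff, IsExtremal]

/-- A triple system on natural numbers has a 2-extension. -/
theorem exists_twoExtension (F : TripleSystem ℕ) : ∃ G : TripleSystem ℕ, IsTwoExtension F G := by
  obtain ⟨a, ha⟩ := Infinite.exists_notMem_finset F.verts
  obtain ⟨b, hb⟩ := Infinite.exists_notMem_finset (insert a F.verts)
  rw [Finset.mem_insert, not_or] at hb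
  refine ⟨⟨F.verts ∪ {a, b}, F.edges ∪ F.verts.image (fun v => {a, b, v}), ?_⟩, a, b,
    fun e => hb.1 e.symm, ?_, rfl, rfl⟩
  · refine Finset.union_subset (F.edges_subset.trans
      (Finset.powersetCard_mono Finset.subset_union_left)) fun e he => ?_
    obtain ⟨v, hv, rfl⟩ := Finset.mem_image.1 he
    refine Finset.mem_powersetCard.2 ⟨?_, Finset.card_eq_three.2 ⟨a, b, v, fun e => hb.1 e.symm,
      fun e => ha (e ▸ hv), fun e => hb.2 (e ▸ hv), rfl⟩⟩
    simp only [Finset.insert_subset_iff, Finset.singleton_subset_iff, Finset.mem_union,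
      Finset.mem_insert, Finset.mem_singleton]
    tauto
  · simp [ha, hb.2]

theorem exists_of_twoExtension {n : ℕ} (h : ∃ F : TripleSystem ℕ, F.verts.card = n ∧ IsExtremal F)
    (hn : bound (n + 2) = bound n + n) :
    ∃ F : TripleSystem ℕ, F.verts.card = n + 2 ∧ IsExtremal F := by
  obtain ⟨F, h1, h2, h3⟩ := h
  obtain ⟨G, hG⟩ := exists_twoExtension F
  obtain ⟨s1, s2, s3⟩ := hG.step
  exact ⟨G, by omega, s3 h2, by rw [s2, s1, h3, h1, hn]⟩

theorem isACFree_of_edges_eq_empty {α : Type*} [DecidableEq α] {F : TripleSystem α}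
    (h : F.edges = ∅) : IsACFree F.Tri := by
  have hF : ∀ {u v w}, ¬ F.Tri u v w := fun {u v w} => by simp [Tri, h]
  exact ⟨Tri.rot, Tri.swap, Tri.ne, fun t => (hF t).elim, fun t => (hF t).elim⟩

/-- Iterated 2-extensions of the empty system, a single vertex, or a five-ring attain the bound. -/
theorem exists_extremal (n : ℕ) : ∃ F : TripleSystem ℕ, F.verts.card = n ∧ IsExtremal F := by
  induction n using Nat.strong_induction_on with
  | _ n ih =>
    by_cases h2 : n < 2
    · refine ⟨⟨Finset.range n, ∅, by simp⟩, by simp, isACFree_of_edges_eq_empty rfl, ?_⟩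
      interval_cases n <;> rfl
    by_cases h5 : n = 5
    · have := IsFiveRing.extremal (F := ring5) ⟨id, Set.bijOn_id _, by simp⟩
      exact ⟨ring5, h5 ▸ rfl, this.1⟩
    obtain ⟨k, rfl⟩ : ∃ k, n = k + 2 := ⟨n - 2, by omega⟩
    refine exists_of_twoExtension (ih k (by omega)) ?_
    by_cases hk : k < 2
    · interval_cases k <;> rfl
    · refine bound_add_two ?_
      rcases Nat.even_or_odd k with he | ho
      · exact Or.inl ⟨he, by omega⟩
      · obtain ⟨m, rfl⟩ := ho
        exact Or.inr ⟨odd_two_mul_add_one m, by omega⟩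

theorem ex_eq_bound (n : ℕ) : ex n {configA, configC} = bound n := by
  refine IsGreatest.csSup_eq ⟨?_, ?_⟩
  · obtain ⟨F, h1, h2⟩ := exists_extremal n
    rw [isExtremal_iff, h1] at h2
    exact ⟨F, h1, h2.1, h2.2⟩
  · rintro m ⟨F, rfl, h2, rfl⟩
    exact (card_edges_le (isFree_iff.1 h2)).1

/-- The description of `InClassF` without the parameter `k`: extensions preserve the parity of the
number of vertices. -/
theorem inClassF_iff {α : Type*} [DecidableEq α] {F : TripleSystem α} :
    InClassF F.verts.card F ↔ ∃ F₀, IsBasic F₀ ∧ IsIteratedExtension F₀ F := by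
  constructor
  · rintro ⟨-, ⟨he, k, F₀, h1, h2, h3, h4⟩ | ⟨ho, F₀, h1, h2⟩⟩
    · refine ⟨F₀, Or.inl ⟨h3, ?_⟩, h4⟩
      rw [h2, Nat.even_sub (by omega)]
      simp [he]
    · exact ⟨F₀, Or.inr h1, h2⟩
  · rintro ⟨F₀, h1, h2⟩
    obtain ⟨-, k, hk⟩ := h2.extremal h1.extremal
    refine ⟨rfl, ?_⟩
    rcases h1 with ⟨h1, he⟩ | h1
    · have := h1.two_le he
      refine Or.inl ⟨?_, k, F₀, by omega, by omega, h1, h2⟩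
      rw [hk]
      exact he.add (even_two_mul k)
    · refine Or.inr ⟨?_, F₀, h1, h2⟩
      rw [hk, h1.extremal.2]
      exact Odd.add_even (by decide) (even_two_mul k)

end TripleSystem

theorem theorem9p1 :
    (∀ n : ℕ, Even n ∨ n = 1 ∨ n = 3 →
      (TripleSystem.ex n {TripleSystem.configA, TripleSystem.configC} : ℤ)
        = ⌊((n : ℚ) - 1) ^ 2 / 4⌋) ∧
    (∀ n : ℕ, Odd n → 5 ≤ n →
      (TripleSystem.ex n {TripleSystem.configA, TripleSystem.configC} : ℚ)
        = ((n : ℚ) - 1) ^ 2 / 4 + 1) ∧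
    (∀ {α : Type*} [DecidableEq α] (n : ℕ) (F : TripleSystem α), 4 ≤ n → F.verts.card = n →
      ((F.IsFree {TripleSystem.configA, TripleSystem.configC} ∧
          F.edges.card = TripleSystem.ex n {TripleSystem.configA, TripleSystem.configC}) ↔
        TripleSystem.InClassF n F)) := by
  refine ⟨fun n hn => ?_, fun n hn h5 => ?_, fun {α} _ n F h4 hn => ?_⟩
  · rw [TripleSystem.ex_eq_bound]
    symm
    rcases hn with hn | rfl | rfl
    · obtain ⟨m, rfl⟩ := hn.two_dvd
      rw [TripleSystem.bound_even, Int.floor_eq_iff]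
      push_cast
      constructor <;> nlinarith
    · norm_num [TripleSystem.bound]
    · norm_num [TripleSystem.bound]
  · rw [TripleSystem.ex_eq_bound]
    obtain ⟨m, rfl⟩ := hn
    have := TripleSystem.bound_odd (m := m) (by omega)
    have h : ((TripleSystem.bound (2 * m + 1) : ℤ) : ℚ) = ((m ^ 2 + 1 : ℤ) : ℚ) := by rw [this]
    push_cast at h ⊢
    rw [h]
    ring
  · subst hn
    have hL : TripleSystem.IsLarge F.verts.card := by
      rcases Nat.even_or_odd F.verts.card with he | ho
      · exact Or.inl ⟨he, by omega⟩
      · obtain ⟨m, hm⟩ := ho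
        exact Or.inr ⟨⟨m, hm⟩, by omega⟩
    rw [TripleSystem.ex_eq_bound, ← TripleSystem.isExtremal_iff, TripleSystem.inClassF_iff]
    constructor
    · exact fun h => TripleSystem.IsExtremal.exists_basic _ F rfl h hL
    · rintro ⟨F₀, h1, h2⟩
      exact (h2.extremal h1.extremal).1.1
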